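/- Let $N2$ be the (Neveu--Schwarz) $N=2$ super-Virasoro algebra, that is, the complex Lie superalgebra with basis $L_m, J_n, C$ ($m,n\in\mathbb Z$; even) and $G^1_r, G^2_r$ ($r\in\mathbb Z-\frac12$; odd), where $C$ is central and \begin{align*} [L_m,L_n]&=(m-n)L_{m+n}+\tfrac{m^3-m}{12}\,\delta_{m,-n}\,C, & [L_m,J_n]&=-nJ_{m+n}, & [J_m,J_n]&=\tfrac{m}{3}\,\delta_{m,-n}\,C,\\ [L_m,G^l_r]&=\left(\tfrac m2-r\right)G^l_{m+r}, & [G^1_r,J_n]&=-iG^2_{r+n}, & [G^2_r,J_n]&=iG^1_{r+n},\\ [G^l_r,G^l_s]&=2L_{r+s}+\tfrac13\left(r^2-\tfrac14\right)\delta_{r,-s}\,C, & [G^1_r,G^2_s]&=i(r-s)J_{r+s} & (l&=1,2). \end{align*} A representation of $N2$ on a complex vector superspace $V$ has central charge $c$ if $C$ acts as $c\cdot\mathrm{id}_V$. It is a lowest weight representation of lowest weight $(h,q)$ if it is generated by a nonzero vector $\Omega$ with $L_m\Omega=J_m\Omega=G^1_r\Omega=G^2_r\Omega=0$ for all $m>0$,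 $r>0$, $L_0\Omega=h\Omega$ and $J_0\Omega=q\Omega$. It is irreducible if $V\neq 0$ and $V$ has no invariant graded subspaces other than $0$ and $V$. It is unitary if there is a scalar product $(\cdot|\cdot)$ on $V$ (a positive definite Hermitian form) such that $L_m^\dagger=L_{-m}$, $J_n^\dagger=J_{-n}$ and $(G^l_r)^\dagger=G^l_{-r}$ for all $m,n\in\mathbb Z$, $r\in\mathbb Z-\frac12$, $l=1,2$, where $A^\dagger=B$ means $(Au|v)=(u|Bv)$ for all $u,v\in V$. Let $c\ge 3$ be real. Then every irreducible lowest weight representation of $N2$ with central charge $c$ and lowest weight $(h,q)=(0,0)$ is unitary. -/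

import Mathlib

/-- A complex Lie superalgebra structure on a complex vector space `g`: a `ℤ/2`-grading
(`part 0` even, `part 1` odd) and a graded bracket satisfying super skew-symmetry and the
super Jacobi identity. -/
structure LieSuperalgebra (g : Type*) [AddCommGroup g] [Module ℂ g] where
  part : ZMod 2 → Submodule ℂ g
  isCompl_part : IsCompl (part 0) (part 1)
  br : g →ₗ[ℂ] g →ₗ[ℂ] g
  br_mem : ∀ (i j : ZMod 2), ∀ x ∈ part i, ∀ y ∈ part j, br x y ∈ part (i + j)
  br_skew : ∀ (i j : ZMod 2), ∀ x ∈ part i, ∀ y ∈ part j,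
    br x y = -((-1 : ℂ) ^ (i.val * j.val) • br y x)
  br_jacobi : ∀ (i j : ZMod 2), ∀ x ∈ part i, ∀ y ∈ part j, ∀ z : g,
    br x (br y z) = br (br x y) z + (-1 : ℂ) ^ (i.val * j.val) • br y (br x z)

/-- A representation of a complex Lie superalgebra on a complex vector superspace `V`
(with even part `part 0` and odd part `part 1`). -/
structure LieSuperalgebra.Rep {g : Type*} [AddCommGroup g] [Module ℂ g]
    (A : LieSuperalgebra g) (V : Type*) [AddCommGroup V] [Module ℂ V] where
  part : ZMod 2 → Submodule ℂ V
  isCompl_part : IsCompl (part 0) (part 1)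
  act : g →ₗ[ℂ] Module.End ℂ V
  act_mem : ∀ (i j : ZMod 2), ∀ x ∈ A.part i, ∀ v ∈ part j, act x v ∈ part (i + j)
  act_br : ∀ (i j : ZMod 2), ∀ x ∈ A.part i, ∀ y ∈ A.part j, ∀ v : V,
    act (A.br x y) v = act x (act y v) - (-1 : ℂ) ^ (i.val * j.val) • act y (act x v)

namespace LieSuperalgebra.Rep

variable {g : Type*} [AddCommGroup g] [Module ℂ g] {A : LieSuperalgebra g}
  {V : Type*} [AddCommGroup V] [Module ℂ V]

/-- `W` is stable under the action of the Lie superalgebra. -/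
def IsInvariant (π : A.Rep V) (W : Submodule ℂ V) : Prop :=
  ∀ (x : g), ∀ v ∈ W, π.act x v ∈ W

/-- `W` is a sub-superspace: it is spanned by its even and odd vectors. -/
def IsGraded (π : A.Rep V) (W : Submodule ℂ V) : Prop :=
  (W ⊓ π.part 0) ⊔ (W ⊓ π.part 1) = W

/-- Irreducibility of a representation on a superspace: the space is nonzero and has no
invariant sub-superspaces other than `0` and the whole space. -/
def IsIrreducible (π : A.Rep V) : Prop :=
  Nontrivial V ∧
    ∀ W : Submodule ℂ V, π.IsInvariant W → π.IsGraded W → W = ⊥ ∨ W = ⊤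

/-- `v` generates the representation. -/
def IsCyclic (π : A.Rep V) (v : V) : Prop :=
  ∀ W : Submodule ℂ V, π.IsInvariant W → v ∈ W → W = ⊤

end LieSuperalgebra.Rep

namespace N2

/-- Labels of the standard basis of the (Neveu-Schwarz) `N = 2` super-Virasoro algebra.
`G1 k` and `G2 k` stand for the modes `G¹_r` and `G²_r` with `r = k + 1/2`; `C` is the
central element. -/
inductive Gen
  | L (m : ℤ)
  | J (n : ℤ)
  | G1 (k : ℤ)
  | G2 (k : ℤ)
  | C

/-- `L`, `J`, `C` are even, `G¹`, `G²` are odd. -/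
def Gen.parity : Gen → ZMod 2
  | .L _ => 0
  | .J _ => 0
  | .G1 _ => 1
  | .G2 _ => 1
  | .C => 0

/-- The underlying vector space of the `N = 2` super-Virasoro algebra. -/
abbrev Space : Type := Gen →₀ ℂ

/-- The basis vector with label `a`. -/
noncomputable def e (a : Gen) : Space := Finsupp.single a 1

/-- `1` at `0`, and `0` elsewhere. -/
def delta (n : ℤ) : ℂ := if n = 0 then 1 else 0

/-- The brackets of the basis vectors. With `r = k + 1/2` and `s = l + 1/2` one has
`r + s = k + l + 1` and `r - s = k - l`. -/
noncomputable def brGen : Gen → Gen → Space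
  | .L m, .L n => ((m : ℂ) - n) • e (.L (m + n)) +
      (((m : ℂ) ^ 3 - m) / 12 * delta (m + n)) • e .C
  | .L m, .J n => (-(n : ℂ)) • e (.J (m + n))
  | .J n, .L m => (n : ℂ) • e (.J (m + n))
  | .L m, .G1 k => ((m : ℂ) / 2 - (k + 1 / 2)) • e (.G1 (m + k))
  | .G1 k, .L m => (-((m : ℂ) / 2 - (k + 1 / 2))) • e (.G1 (m + k))
  | .L m, .G2 k => ((m : ℂ) / 2 - (k + 1 / 2)) • e (.G2 (m + k))
  | .G2 k, .L m => (-((m : ℂ) / 2 - (k + 1 / 2))) • e (.G2 (m + k))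
  | .J m, .J n => ((m : ℂ) / 3 * delta (m + n)) • e .C
  | .G1 k, .J n => (-Complex.I) • e (.G2 (k + n))
  | .J n, .G1 k => Complex.I • e (.G2 (k + n))
  | .G2 k, .J n => Complex.I • e (.G1 (k + n))
  | .J n, .G2 k => (-Complex.I) • e (.G1 (k + n))
  | .G1 k, .G1 l => (2 : ℂ) • e (.L (k + l + 1)) +
      ((((k : ℂ) + 1 / 2) ^ 2 - 1 / 4) / 3 * delta (k + l + 1)) • e .C
  | .G2 k, .G2 l => (2 : ℂ) • e (.L (k + l + 1)) +
      ((((k : ℂ) + 1 / 2) ^ 2 - 1 / 4) / 3 * delta (k + l + 1)) • e .C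
  | .G1 k, .G2 l => (Complex.I * ((k : ℂ) - l)) • e (.J (k + l + 1))
  | .G2 l, .G1 k => (Complex.I * ((k : ℂ) - l)) • e (.J (k + l + 1))
  | .C, _ => 0
  | _, .C => 0

/-- The bilinear extension of `brGen`. -/
noncomputable def br : Space →ₗ[ℂ] Space →ₗ[ℂ] Space :=
  Finsupp.linearCombination ℂ fun a => Finsupp.linearCombination ℂ fun b => brGen a b

theorem delta_cases (n : ℤ) : (n = 0 ∧ delta n = 1) ∨ delta n = 0 := by
  unfold delta
  split_ifs with h
  · exact Or.inl ⟨h, rfl⟩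
  · exact Or.inr rfl

theorem br_e (a b : Gen) : br (e a) (e b) = brGen a b := by
  simp [br, e]

/-- The span of the basis vectors of parity `i`. -/
noncomputable def part (i : ZMod 2) : Submodule ℂ Space :=
  Submodule.span ℂ (e '' {a | a.parity = i})

theorem e_mem (a : Gen) : e a ∈ part a.parity :=
  Submodule.subset_span ⟨a, rfl, rfl⟩

theorem span_e : Submodule.span ℂ (Set.range e) = ⊤ := by
  have := (Finsupp.basisSingleOne (R := ℂ) (ι := Gen)).span_eq
  rwa [Finsupp.coe_basisSingleOne] at this

theorem part_eq (i : ZMod 2) : part i = Finsupp.supported ℂ ℂ {a : Gen | a.parity = i} :=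
  (Finsupp.supported_eq_span_single ℂ _).symm

theorem isCompl_part : IsCompl (part 0) (part 1) := by
  simp only [part_eq]
  constructor
  · rw [Finsupp.disjoint_supported_supported_iff, Set.disjoint_left]
    intro a h0 h1
    simp only [Set.mem_ofPred_eq] at h0 h1
    rw [h0] at h1
    exact absurd h1 (by decide)
  · apply Finsupp.codisjoint_supported_supported
    rw [codisjoint_iff, Set.top_eq_univ, Set.eq_univ_iff_forall]
    rintro (_ | _ | _ | _ | _)
    · exact Or.inl rfl
    · exact Or.inl rfl
    · exact Or.inr rfl
    · exact Or.inr rfl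
    · exact Or.inl rfl

theorem brGen_mem (a b : Gen) : brGen a b ∈ part (a.parity + b.parity) := by
  have h2 : (1 : ZMod 2) + 1 = 0 := by decide
  have hL : ∀ n, e (.L n) ∈ part 0 := fun n => e_mem (.L n)
  have hJ : ∀ n, e (.J n) ∈ part 0 := fun n => e_mem (.J n)
  have hC : e .C ∈ part 0 := e_mem .C
  have h3 : ∀ n, e (.G1 n) ∈ part 1 := fun n => e_mem (.G1 n)
  have h4 : ∀ n, e (.G2 n) ∈ part 1 := fun n => e_mem (.G2 n)
  rcases a with m | m | m | m | _ <;> rcases b with n | n | n | n | _ <;>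
    simp only [brGen, Gen.parity, add_zero, zero_add, h2, Submodule.zero_mem] <;>
    first
    | exact Submodule.smul_mem _ _ (hL _)
    | exact Submodule.smul_mem _ _ (hJ _)
    | exact Submodule.smul_mem _ _ hC
    | exact Submodule.smul_mem _ _ (h3 _)
    | exact Submodule.smul_mem _ _ (h4 _)
    | exact Submodule.add_mem _ (Submodule.smul_mem _ _ (hL _)) (Submodule.smul_mem _ _ hC)

theorem brGen_skew (a b : Gen) :
    brGen a b = -((-1 : ℂ) ^ (a.parity.val * b.parity.val) • brGen b a) := by
  rcases a with m | m | m | m | _ <;> rcases b with n | n | n | n | _ <;>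
    simp only [brGen, Gen.parity, ZMod.val_zero, ZMod.val_one, mul_zero, mul_one,
      pow_zero, pow_one, one_smul, smul_zero, neg_zero, neg_smul, neg_neg]
  all_goals
    rw [add_comm n m]
    first
    | module
    | (rcases delta_cases (m + n) with ⟨h, h'⟩ | h'
       · obtain rfl : n = -m := by omega
         simp only [h']
         push_cast
         module
       · simp only [h']
         module)
    | (rcases delta_cases (m + n + 1) with ⟨h, h'⟩ | h'
       · obtain rfl : n = -m - 1 := by omega
         simp only [h']
         push_cast
         module
       · simp only [h']
         module)

set_option maxHeartbeats 4000000 in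
theorem brGen_jacobi (a b c : Gen) :
    br (e a) (brGen b c) = br (brGen a b) (e c) +
      (-1 : ℂ) ^ (a.parity.val * b.parity.val) • br (e b) (brGen a c) := by
  have hI : Complex.I ^ 2 = -1 := Complex.I_sq
  rcases a with m | m | m | m | _ <;> rcases b with n | n | n | n | _ <;>
    rcases c with p | p | p | p | _ <;>
    simp only [brGen, Gen.parity, ZMod.val_zero, ZMod.val_one, mul_zero, mul_one,
      pow_zero, pow_one, one_smul, smul_zero, map_add, map_smul, map_zero, br_e,
      LinearMap.add_apply, LinearMap.smul_apply, LinearMap.zero_apply, add_zero, smul_add]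
  all_goals
    try (
      push_cast
      ring_nf
      match_scalars <;> ring_nf <;> (try simp only [hI]) <;> (try ring_nf))
  all_goals
    first
    | (rcases delta_cases (m + n + p) with ⟨h, h'⟩ | h'
       · have h2 : (p : ℂ) = -m - n := by
           rw [show p = -m - n by omega]
           push_cast
           ring
         rw [h', h2]
         ring
       · rw [h']
         ring)
    | (rcases delta_cases (1 + m + n + p) with ⟨h, h'⟩ | h'
       · have h2 : (p : ℂ) = -m - n - 1 := by
           rw [show p = -m - n - 1 by omega]
           push_cast
           ring
         rw [h', h2]
         ring
       · rw [h']
         ring)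
    | (rcases delta_cases (1 + m + p + n) with ⟨h, h'⟩ | h'
       · have h2 : (p : ℂ) = -m - n - 1 := by
           rw [show p = -m - n - 1 by omega]
           push_cast
           ring
         rw [h', h2]
         ring
       · rw [h']
         ring)

theorem br_mem (i j : ZMod 2) (x : Space) (hx : x ∈ part i) (y : Space) (hy : y ∈ part j) :
    br x y ∈ part (i + j) := by
  induction hx using Submodule.span_induction with
  | zero => simp
  | add x x' _ _ h h' =>
    rw [map_add, LinearMap.add_apply]
    exact Submodule.add_mem _ h h'
  | smul t x _ h =>
    rw [map_smul, LinearMap.smul_apply]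
    exact Submodule.smul_mem _ _ h
  | mem x hx =>
    obtain ⟨a, rfl, rfl⟩ := hx
    induction hy using Submodule.span_induction with
    | zero => simp
    | add y y' _ _ h h' =>
      rw [map_add]
      exact Submodule.add_mem _ h h'
    | smul t y _ h =>
      rw [map_smul]
      exact Submodule.smul_mem _ _ h
    | mem y hy =>
      obtain ⟨b, rfl, rfl⟩ := hy
      rw [br_e]
      exact brGen_mem a b

theorem br_skew (i j : ZMod 2) (x : Space) (hx : x ∈ part i) (y : Space) (hy : y ∈ part j) :
    br x y = -((-1 : ℂ) ^ (i.val * j.val) • br y x) := by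
  induction hx using Submodule.span_induction with
  | zero => simp
  | add x x' _ _ h h' =>
    rw [map_add, map_add, LinearMap.add_apply, h, h']
    module
  | smul t x _ h =>
    rw [map_smul, map_smul, LinearMap.smul_apply, h]
    module
  | mem x hx =>
    obtain ⟨a, rfl, rfl⟩ := hx
    induction hy using Submodule.span_induction with
    | zero => simp
    | add y y' _ _ h h' =>
      rw [map_add, map_add, LinearMap.add_apply, h, h']
      module
    | smul t y _ h =>
      rw [map_smul, map_smul, LinearMap.smul_apply, h]
      module
    | mem y hy =>
      obtain ⟨b, rfl, rfl⟩ := hy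
      rw [br_e, br_e]
      exact brGen_skew a b

theorem br_jacobi (i j : ZMod 2) (x : Space) (hx : x ∈ part i) (y : Space) (hy : y ∈ part j)
    (z : Space) :
    br x (br y z) = br (br x y) z + (-1 : ℂ) ^ (i.val * j.val) • br y (br x z) := by
  induction hx using Submodule.span_induction with
  | zero => simp
  | add x x' _ _ h h' =>
    simp only [map_add, LinearMap.add_apply, h, h']
    module
  | smul t x _ h =>
    simp only [map_smul, LinearMap.smul_apply, h]
    module
  | mem x hx =>
    obtain ⟨a, rfl, rfl⟩ := hx
    induction hy using Submodule.span_induction with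
    | zero => simp
    | add y y' _ _ h h' =>
      simp only [map_add, LinearMap.add_apply, h, h']
      module
    | smul t y _ h =>
      simp only [map_smul, LinearMap.smul_apply, h]
      module
    | mem y hy =>
      obtain ⟨b, rfl, rfl⟩ := hy
      have hz : z ∈ Submodule.span ℂ (Set.range e) := span_e ▸ Submodule.mem_top
      induction hz using Submodule.span_induction with
      | zero => simp
      | add z z' _ _ h h' =>
        simp only [map_add, h, h']
        module
      | smul t z _ h =>
        simp only [map_smul, h]
        module
      | mem z hz =>
        obtain ⟨c, rfl⟩ := hz
        simp only [br_e]
        exact brGen_jacobi a b c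

/-- The (Neveu-Schwarz) `N = 2` super-Virasoro algebra. -/
noncomputable def alg : LieSuperalgebra Space where
  part := part
  isCompl_part := isCompl_part
  br := br
  br_mem := br_mem
  br_skew := br_skew
  br_jacobi := br_jacobi

variable {V : Type*} [AddCommGroup V] [Module ℂ V]

/-- `π` has central charge `c`: the central element acts as the scalar `c`. -/
def HasCentralCharge (π : alg.Rep V) (c : ℂ) : Prop :=
  ∀ v : V, π.act (e .C) v = c • v

/-- `v` is a lowest weight vector of lowest weight `(h, q)`: it is nonzero, it is annihilated
by all modes of positive index, and `L₀ v = h v`, `J₀ v = q v`. -/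
structure IsLowestWeightVector (π : alg.Rep V) (h q : ℂ) (v : V) : Prop where
  ne_zero : v ≠ 0
  L_pos : ∀ m : ℤ, 0 < m → π.act (e (.L m)) v = 0
  J_pos : ∀ n : ℤ, 0 < n → π.act (e (.J n)) v = 0
  G1_pos : ∀ k : ℤ, 0 ≤ k → π.act (e (.G1 k)) v = 0
  G2_pos : ∀ k : ℤ, 0 ≤ k → π.act (e (.G2 k)) v = 0
  L_zero : π.act (e (.L 0)) v = h • v
  J_zero : π.act (e (.J 0)) v = q • v

/-- `π` is a lowest weight representation of lowest weight `(h, q)`: it is generated by a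
lowest weight vector of that weight. -/
def IsLowestWeight (π : alg.Rep V) (h q : ℂ) : Prop :=
  ∃ v : V, IsLowestWeightVector π h q v ∧ π.IsCyclic v

/-- `π` is unitary: there is a scalar product on `V` (positive definite, antilinear in the
first and linear in the second variable) for which `L_m† = L_{-m}`, `J_n† = J_{-n}` and
`(Gⁱ_r)† = Gⁱ_{-r}`. If `r = k + 1/2`, then `-r = (-1 - k) + 1/2`. -/
def IsUnitary (π : alg.Rep V) : Prop :=
  ∃ s : InnerProductSpace.Core ℂ V,
    (∀ (m : ℤ) (u v : V),
      s.inner (π.act (e (.L m)) u) v = s.inner u (π.act (e (.L (-m))) v)) ∧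
    (∀ (n : ℤ) (u v : V),
      s.inner (π.act (e (.J n)) u) v = s.inner u (π.act (e (.J (-n))) v)) ∧
    (∀ (k : ℤ) (u v : V),
      s.inner (π.act (e (.G1 k)) u) v = s.inner u (π.act (e (.G1 (-1 - k))) v)) ∧
    (∀ (k : ℤ) (u v : V),
      s.inner (π.act (e (.G2 k)) u) v = s.inner u (π.act (e (.G2 (-1 - k))) v))

end N2

/-! Write `c = 3 (1 + r²)` with `r` real, which is possible exactly when `c ≥ 3`. The algebra is
realised with this central charge on the Fock space of two free bosons `a`, `b` and two free real
fermions `φ`, `χ`, which carries a positive definite form. The first supercurrent is `φ a + χ b`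
plus `i r` times a derivative of `φ`; the second arises from the rotation `(φ, χ) ↦ (χ, -φ)`. The
derivative term raises the central charge from `3` to `c`, but it spoils hermiticity.

The remedy is to shift each `a n` by a number, `ah n = a n - i r shift n`. Commutators do not
change, the supercurrents kill the vacuum down to the mode `-1/2`, and the failure of hermiticity
becomes the same for all modes: the adjoint of `G k` is `G (-1 - k) + i r ∑ φ t`, where the sum is
formally the field `φ` at one point of the circle, called the point at infinity (`G_adj`). The
current `J` has the right adjoint from the start.

On the cyclic module of the vacuum `Ω` this defect vanishes. If `u` is orthogonal to all degrees but
its own, a mode number `k` large enough makes the other two terms of the adjoint relation zero, so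
the defect, which does not depend on `k`, is zero as well (`defect_eq_zero`). Orthogonality of
degrees starts from `(Ω | L 0 v) = (Ω | L 1 v)` (`inner_vac_L`), which shows by induction that `Ω`
is orthogonal to every nonzero degree (`inner_vac_eq_zero`); it then passes to words in the creators
(`inner_eq_zero`). Hence the form is invariant on the cyclic module (`gen_contravariant`).

The bracket relations are proved without normal ordering. An operator that commutes with all free
modes is a scalar (`exists_eq_smul_one`), so two sides of a relation need only be compared through
their brackets with the free modes, where infinite sums collapse to one term. The remaining scalar
is excluded by a sign operator or computed on the vacuum.

An abstract irreducible representation with vacuum `v` is compared with the Fock module through the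
submodule of the product generated by `(v, Ω)`. Definiteness of the form on one side and
irreducibility on the other make it the graph of an injective intertwiner, along which the form is
pulled back (`isUnitary_of_contravariant`). -/

namespace N2

/-- Twice the `L₀`-eigenvalue added by a generator. -/
def Gen.deg : Gen → ℤ
  | .L m => -2 * m
  | .J m => -2 * m
  | .G1 k => -(2 * k + 1)
  | .G2 k => -(2 * k + 1)
  | .C => 0

/-- The negative modes of `J`, `G¹`, `G²`, which generate all negative modes. -/
def Gen.IsCreator : Gen → Prop
  | .J n => n < 0
  | .G1 k => k < 0
  | .G2 k => k < 0
  | .L _ => False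
  | .C => False

theorem Gen.IsCreator.deg_pos {a : Gen} (h : a.IsCreator) : 0 < a.deg := by
  cases a <;> simp only [Gen.IsCreator, Gen.deg] at * <;> omega

/-- This makes vectors of fixed degree homogeneous for the superspace grading, as soon as the vacuum
is. -/
theorem Gen.parity_eq_deg (a : Gen) : a.parity = (a.deg : ZMod 2) := by
  have h2 : (2 : ZMod 2) = 0 := by decide
  cases a <;> simp [Gen.parity, Gen.deg, h2]

/-- This is all that the degree bookkeeping needs to know of the structure constants. Central terms
cause no trouble, because `delta` is nonzero only in total degree zero. -/
theorem brGen_mem_deg (a b : Gen) :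
    brGen a b ∈ Submodule.span ℂ (e '' {d | d.deg = a.deg + b.deg}) := by
  have hmem (d : Gen) (hd : d.deg = a.deg + b.deg) (t : ℂ) :
      t • e d ∈ Submodule.span ℂ (e '' {d | d.deg = a.deg + b.deg}) :=
    Submodule.smul_mem _ _ (Submodule.subset_span ⟨d, hd, rfl⟩)
  have hdel (n : ℤ) (hn : n = 0 → Gen.deg .C = a.deg + b.deg) (t : ℂ) :
      (t * delta n) • e .C ∈ Submodule.span ℂ (e '' {d | d.deg = a.deg + b.deg}) := by
    rcases delta_cases n with ⟨h, -⟩ | h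
    · exact hmem _ (hn h) _
    · simp [h]
  rcases a with m | m | m | m | _ <;> rcases b with n | n | n | n | _ <;> simp only [brGen] <;>
    first
    | exact Submodule.zero_mem _
    | (refine Submodule.add_mem _ (hmem _ ?_ _) (hdel _ ?_ _) <;>
        simp only [Gen.deg] <;> intros <;> omega)
    | (refine hmem _ ?_ _; simp only [Gen.deg]; omega)
    | (refine hdel _ ?_ _; simp only [Gen.deg]; intros; omega)

/-! ### Modules generated by a vacuum vector and their degree grading -/

section Action

variable {M : Type*} [AddCommGroup M] [Module ℂ M]

/-- The operators `X a` satisfy the bracket relations of the generators, with central charge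
`c`. -/
structure IsAction (c : ℂ) (X : Gen → Module.End ℂ M) : Prop where
  central (v : M) : X .C v = c • v
  br (a b : Gen) (v : M) : X a (X b v) - (-1 : ℂ) ^ (a.parity.val * b.parity.val) • X b (X a v) =
    Finsupp.linearCombination ℂ X (brGen a b) v

/-- `w` is annihilated by all generators which do not raise the degree. -/
def IsVacuum (X : Gen → Module.End ℂ M) (w : M) : Prop :=
  ∀ a : Gen, a ≠ .C → a.deg ≤ 0 → X a w = 0

/-- `u` is obtained from `w` by applying creators of total degree `n`. -/
inductive Mono (X : Gen → Module.End ℂ M) (w : M) : ℤ → M → Prop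
  | vac : Mono X w 0 w
  | step (a : Gen) (ha : a.IsCreator) (n : ℤ) (u : M) (hu : Mono X w n u) :
      Mono X w (a.deg + n) (X a u)

/-- The span of the vectors of degree `n` obtained from `w` by creators. -/
def piece (X : Gen → Module.End ℂ M) (w : M) (n : ℤ) : Submodule ℂ M :=
  Submodule.span ℂ {u | Mono X w n u}

variable {c : ℂ} {X : Gen → Module.End ℂ M} {w : M}

theorem Mono.mem {n : ℤ} {u : M} (h : Mono X w n u) : u ∈ piece X w n :=
  Submodule.subset_span h

theorem Mono.eq_or_pos {n : ℤ} {u : M} (h : Mono X w n u) : (n = 0 ∧ u = w) ∨ 0 < n := by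
  induction h with
  | vac => exact Or.inl ⟨rfl, rfl⟩
  | step a ha n u _ ih =>
    have := ha.deg_pos
    right
    rcases ih with ⟨h, -⟩ | h <;> omega

@[elab_as_elim]
theorem piece_induction {n : ℤ} {p : ∀ u, u ∈ piece X w n → Prop}
    (hm : ∀ u (hu : Mono X w n u), p u hu.mem) (h0 : p 0 (Submodule.zero_mem _))
    (hadd : ∀ u v hu hv, p u hu → p v hv → p (u + v) (Submodule.add_mem _ hu hv))
    (hsmul : ∀ (t : ℂ) u hu, p u hu → p (t • u) (Submodule.smul_mem _ t hu))
    {u : M} (hu : u ∈ piece X w n) : p u hu :=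
  Submodule.span_induction hm h0 hadd hsmul hu

theorem piece_neg {n : ℤ} (hn : n < 0) : piece X w n = ⊥ := by
  rw [piece, Submodule.span_eq_bot]
  intro u hu
  rcases hu.eq_or_pos with ⟨h, -⟩ | h <;> omega

theorem piece_zero : piece X w 0 = Submodule.span ℂ {w} := by
  rw [piece]
  congr 1
  ext u
  simp only [Set.mem_ofPred_eq, Set.mem_singleton_iff]
  constructor
  · intro h
    rcases h.eq_or_pos with ⟨-, h⟩ | h
    · exact h
    · omega
  · rintro rfl
    exact .vac

theorem linearCombination_brGen_mem (p : Submodule ℂ M) (a b : Gen) (u : M)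
    (h : ∀ d : Gen, d.deg = a.deg + b.deg → X d u ∈ p) :
    Finsupp.linearCombination ℂ X (brGen a b) u ∈ p := by
  have key : ∀ x ∈ Submodule.span ℂ (e '' {d | d.deg = a.deg + b.deg}),
      Finsupp.linearCombination ℂ X x u ∈ p := by
    intro x hx
    induction hx using Submodule.span_induction with
    | mem x hx =>
      obtain ⟨d, hd, rfl⟩ := hx
      simpa [e] using h d hd
    | zero => simp
    | add x y _ _ h h' => simpa using p.add_mem h h'
    | smul t x _ h => simpa using p.smul_mem t h
  exact key _ (brGen_mem_deg a b)

theorem creator_mem_piece {a : Gen} (ha : a.IsCreator) {n : ℤ} {u : M} (hu : u ∈ piece X w n) :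
    X a u ∈ piece X w (a.deg + n) := by
  induction hu using piece_induction with
  | hm u hu => exact (Mono.step a ha n u hu).mem
  | h0 => simp
  | hadd u v _ _ h h' => simpa using Submodule.add_mem _ h h'
  | hsmul t u _ h => simpa using Submodule.smul_mem _ t h

/-- The anticommutator with the mode `-1/2` of `G¹` produces `L m`, and its central term vanishes
for `m ≠ 0`. This is why the modes of `L` are not needed among the creators, and why adjoints will
only have to be studied for `J`, `G¹` and `G²`. -/
theorem IsAction.L_neg (hX : IsAction c X) {m : ℤ} (hm : m < 0) (u : M) :
    X (.L m) u = (1 / 2 : ℂ) • (X (.G1 m) (X (.G1 (-1)) u) + X (.G1 (-1)) (X (.G1 m) u)) := by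
  have h := hX.br (.G1 m) (.G1 (-1)) u
  have hd : delta m = 0 := by simp [delta, hm.ne]
  simp only [brGen, Gen.parity, ZMod.val_one, neg_add_cancel_right, hd, e, map_add, map_smul,
    Finsupp.linearCombination_single, LinearMap.add_apply, LinearMap.smul_apply] at h
  simp only [mul_one, pow_one, neg_smul, one_smul, sub_neg_eq_add, mul_zero, zero_smul,
    add_zero] at h
  rw [h, smul_smul]
  norm_num

/-- Induction on the word: `a` is moved past the outermost creator. The bracket gives other
generators acting on the shorter word, so the claim must be made for all generators at once. -/
theorem IsAction.map_mono (hX : IsAction c X) (hw : IsVacuum X w) {n : ℤ} {u : M}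
    (hu : Mono X w n u) (a : Gen) : X a u ∈ piece X w (a.deg + n) := by
  induction hu generalizing a with
  | vac =>
    by_cases hC : a = .C
    · subst hC
      rw [hX.central]
      exact Submodule.smul_mem _ _ Mono.vac.mem
    by_cases hd : a.deg ≤ 0
    · rw [hw a hC hd]
      exact Submodule.zero_mem _
    rcases a with m | m | m | m | _
    -- The only generators of positive degree that are not creators are the negative modes of `L`.
    · have hm : m < 0 := by simp only [Gen.deg] at hd; omega
      rw [hX.L_neg hm]
      have h1 : Gen.IsCreator (.G1 (-1)) := by simp [Gen.IsCreator]
      have h2 : Gen.IsCreator (.G1 m) := hm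
      refine Submodule.smul_mem _ _ (Submodule.add_mem _ ?_ ?_)
      · convert creator_mem_piece (X := X) (w := w) h2 (creator_mem_piece h1 Mono.vac.mem) using 2
        simp only [Gen.deg]
        omega
      · convert creator_mem_piece (X := X) (w := w) h1 (creator_mem_piece h2 Mono.vac.mem) using 2
        simp only [Gen.deg]
        omega
    all_goals
      first
      | exact absurd rfl hC
      | (refine creator_mem_piece ?_ Mono.vac.mem
         simp only [Gen.deg, Gen.IsCreator] at hd ⊢
         omega)
  | step b hb n u hu ih =>
    rw [sub_eq_iff_eq_add.mp (hX.br a b u)]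
    refine Submodule.add_mem _ ?_ (Submodule.smul_mem _ _ ?_)
    · refine linearCombination_brGen_mem _ _ _ _ fun d hd => ?_
      convert ih d using 2
      omega
    · convert creator_mem_piece (X := X) (w := w) hb (ih a) using 2
      omega

theorem IsAction.map_piece (hX : IsAction c X) (hw : IsVacuum X w) (a : Gen) {n m : ℤ}
    (hm : a.deg + n = m) {u : M} (hu : u ∈ piece X w n) : X a u ∈ piece X w m := by
  subst hm
  induction hu using piece_induction with
  | hm u hu => exact hX.map_mono hw hu a
  | h0 => simp
  | hadd u v _ _ h h' => simpa using Submodule.add_mem _ h h'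
  | hsmul t u _ h => simpa using Submodule.smul_mem _ t h

theorem IsAction.L_zero_creator (hX : IsAction c X) {a : Gen} (ha : a.IsCreator) (u : M) :
    X (.L 0) (X a u) = X a (X (.L 0) u) + ((a.deg : ℂ) / 2) • X a u := by
  have h := hX.br (.L 0) a u
  rcases a with m | m | m | m | _ <;> simp only [Gen.IsCreator] at ha
  all_goals
    simp only [brGen, Gen.parity, ZMod.val_zero, ZMod.val_one, zero_mul, pow_zero, one_smul,
      zero_add, e, map_smul, Finsupp.linearCombination_single, LinearMap.smul_apply] at h
    rw [sub_eq_iff_eq_add.mp h, add_comm]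
    congr 2
    simp only [Gen.deg]
    push_cast
    ring

theorem IsAction.L_zero_piece (hX : IsAction c X) (hw : IsVacuum X w) {n : ℤ} {u : M}
    (hu : u ∈ piece X w n) : X (.L 0) u = ((n : ℂ) / 2) • u := by
  induction hu using piece_induction with
  | hm u hu =>
    induction hu with
    | vac => simpa using hw (.L 0) (by simp) (by simp [Gen.deg])
    | step a ha n u _ ih =>
      rw [hX.L_zero_creator ha, ih]
      simp only [map_smul]
      push_cast
      module
  | h0 => simp
  | hadd u v _ _ h h' => simp [h, h']
  | hsmul t u _ h => rw [map_smul, h, smul_comm]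

/-- Eigenvectors for the distinct eigenvalues `n / 2` are linearly independent. -/
theorem eq_zero_of_sum_eigenvectors (T : Module.End ℂ M) (f : ℤ →₀ M)
    (hf : ∀ n, T (f n) = ((n : ℂ) / 2) • f n) (h0 : (f.sum fun _ x => x) = 0) : f = 0 := by
  have hinj : Function.Injective fun n : ℤ => (n : ℂ) / 2 := by
    intro a b hab
    simpa using hab
  have hind := T.eigenspaces_iSupIndep.comp hinj
  rw [iSupIndep_iff_finsetSum_eq_zero_imp_eq_zero] at hind
  ext n
  by_cases hn : n ∈ f.support
  · exact hind f.support f (fun i _ => by simpa [Module.End.mem_eigenspace_iff] using hf i) h0 n hn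
  · simpa using hn

theorem IsAction.map_iSup_piece (hX : IsAction c X) (hw : IsVacuum X w) (a : Gen) {u : M}
    (hu : u ∈ ⨆ n, piece X w n) : X a u ∈ ⨆ n, piece X w n := by
  induction hu using Submodule.iSup_induction' with
  | mem n u hu => exact Submodule.mem_iSup_of_mem _ (hX.map_piece hw a rfl hu)
  | zero => simp
  | add u v _ _ h h' => simpa using Submodule.add_mem _ h h'

theorem exists_pieces {u : M} (hu : u ∈ ⨆ n, piece X w n) :
    ∃ f : ℤ →₀ M, (∀ n, f n ∈ piece X w n) ∧ (f.sum fun _ x => x) = u :=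
  (Submodule.mem_iSup_iff_exists_finsupp _ _).mp hu

/-- A vector of `L₀`-weight zero in the span of the pieces is a multiple of the vacuum. -/
theorem IsAction.mem_span_of_L_zero (hX : IsAction c X) (hw : IsVacuum X w) {u : M}
    (hu : u ∈ ⨆ n, piece X w n) (h0 : X (.L 0) u = 0) : u ∈ Submodule.span ℂ {w} := by
  obtain ⟨f, hf, rfl⟩ := exists_pieces hu
  have h := eq_zero_of_sum_eigenvectors (X (.L 0)) (f.mapRange (X (.L 0)) (map_zero _))
    (fun n => by simp [hX.L_zero_piece hw (hf n)])
    (by rw [Finsupp.sum_mapRange_index (by simp), ← h0, Finsupp.sum, Finsupp.sum, map_sum])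
  rw [Finsupp.sum]
  refine Submodule.sum_mem _ fun n hn => ?_
  have hn' := DFunLike.congr_fun h n
  rw [Finsupp.mapRange_apply, hX.L_zero_piece hw (hf n), Finsupp.zero_apply, smul_eq_zero] at hn'
  rcases hn' with hn' | hn'
  · have : n = 0 := by simpa using hn'
    subst this
    exact piece_zero (X := X) ▸ hf 0
  · exact absurd hn' (Finsupp.mem_support_iff.mp hn)

end Action

end N2

namespace N2

/-- The label of the adjoint generator. -/
def Gen.adj : Gen → Gen
  | .L m => .L (-m)
  | .J m => .J (-m)
  | .G1 k => .G1 (-1 - k)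
  | .G2 k => .G2 (-1 - k)
  | .C => .C

/-! ### Vacuum representations of the superalgebra -/

section Rep

variable {V : Type*} [AddCommGroup V] [Module ℂ V]

/-- The operators by which the generators act in a representation. -/
noncomputable def repGen (π : alg.Rep V) (a : Gen) : Module.End ℂ V := π.act (e a)

theorem act_eq_linearCombination (π : alg.Rep V) :
    π.act = Finsupp.linearCombination ℂ (repGen π) := by
  ext a : 2
  simp [repGen, e]

theorem repGen_isAction {π : alg.Rep V} {c : ℂ} (h : HasCentralCharge π c) :
    IsAction c (repGen π) where
  central := h
  br a b v := by
    have := π.act_br a.parity b.parity (e a) (e_mem a) (e b) (e_mem b) v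
    rw [← act_eq_linearCombination, ← br_e]
    exact this.symm

theorem repGen_isVacuum {π : alg.Rep V} {v : V} (h : IsLowestWeightVector π 0 0 v) :
    IsVacuum (repGen π) v := by
  rintro (m | m | m | m | _) hC hd <;> simp only [Gen.deg] at hd
  · rcases (by omega : 0 < m ∨ m = 0) with h' | rfl
    · exact h.L_pos m h'
    · simpa [repGen] using h.L_zero
  · rcases (by omega : 0 < m ∨ m = 0) with h' | rfl
    · exact h.J_pos m h'
    · simpa [repGen] using h.J_zero
  · exact h.G1_pos m (by omega)
  · exact h.G2_pos m (by omega)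
  · exact absurd rfl hC

theorem isInvariant_of_repGen {π : alg.Rep V} {W : Submodule ℂ V}
    (h : ∀ a, ∀ v ∈ W, repGen π a v ∈ W) : π.IsInvariant W := by
  intro x v hv
  rw [act_eq_linearCombination, Finsupp.linearCombination_apply, Finsupp.sum]
  simp only [LinearMap.sum_apply, LinearMap.smul_apply]
  exact Submodule.sum_mem _ fun a _ => Submodule.smul_mem _ _ (h a v hv)

theorem Mono.mem_part {π : alg.Rep V} {v : V} {p : ZMod 2} (hv : v ∈ π.part p) {n : ℤ} {u : V}
    (hu : Mono (repGen π) v n u) : u ∈ π.part (n + p) := by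
  induction hu with
  | vac => simpa using hv
  | step a _ n u _ ih =>
    have := π.act_mem _ _ (e a) (e_mem a) u ih
    rw [a.parity_eq_deg, ← add_assoc] at this
    simpa [repGen] using this

theorem piece_le_part {π : alg.Rep V} {v : V} {p : ZMod 2} (hv : v ∈ π.part p) (n : ℤ) :
    piece (repGen π) v n ≤ π.part (n + p) :=
  Submodule.span_le.mpr fun _ hu => hu.mem_part hv

theorem part_le (π : alg.Rep V) (W : Submodule ℂ V) (i : ZMod 2) :
    W ⊓ π.part i ≤ (W ⊓ π.part 0) ⊔ (W ⊓ π.part 1) := by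
  rcases (by decide : ∀ i : ZMod 2, i = 0 ∨ i = 1) i with rfl | rfl
  · exact le_sup_left
  · exact le_sup_right

theorem iSup_piece_eq_top {π : alg.Rep V} {c : ℂ} (hc : HasCentralCharge π c) {v : V}
    (hv : IsLowestWeightVector π 0 0 v) (hcyc : π.IsCyclic v) :
    ⨆ n, piece (repGen π) v n = ⊤ :=
  hcyc _ (isInvariant_of_repGen fun a _ hu =>
      (repGen_isAction hc).map_iSup_piece (repGen_isVacuum hv) a hu)
    (Submodule.mem_iSup_of_mem 0 Mono.vac.mem)

/-- A cyclic vacuum vector is homogeneous. -/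
theorem exists_mem_part {π : alg.Rep V} {c : ℂ} (hc : HasCentralCharge π c) {v : V}
    (hv : IsLowestWeightVector π 0 0 v) (hcyc : π.IsCyclic v) : ∃ p, v ∈ π.part p := by
  obtain ⟨v0, h0, v1, h1, hsum⟩ := Submodule.mem_sup.mp
    (π.isCompl_part.sup_eq_top ▸ Submodule.mem_top : v ∈ π.part 0 ⊔ π.part 1)
  have hL (i : ZMod 2) {x : V} (hx : x ∈ π.part i) : π.act (e (.L 0)) x ∈ π.part i := by
    simpa [Gen.parity] using π.act_mem 0 i _ (e_mem (.L 0)) x hx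
  have hz : π.act (e (.L 0)) v0 + π.act (e (.L 0)) v1 = 0 := by
    rw [← map_add, hsum, hv.L_zero, zero_smul]
  -- The vector `L 0 v0 = -L 0 v1` is both even and odd.
  have hL0 : π.act (e (.L 0)) v0 = 0 :=
    (Submodule.disjoint_def.mp π.isCompl_part.disjoint) _ (hL 0 h0)
      (eq_neg_of_add_eq_zero_left hz ▸ Submodule.neg_mem _ (hL 1 h1))
  -- Weight zero is one-dimensional, so the even component of `v` is a multiple of `v`; if the
  -- factor is zero, `v` is odd.
  obtain ⟨t, ht⟩ := Submodule.mem_span_singleton.mp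
    ((repGen_isAction hc).mem_span_of_L_zero (repGen_isVacuum hv)
      (iSup_piece_eq_top hc hv hcyc ▸ Submodule.mem_top) hL0)
  rcases eq_or_ne t 0 with rfl | h
  · refine ⟨1, ?_⟩
    rw [zero_smul] at ht
    rwa [← hsum, ← ht, zero_add]
  · refine ⟨0, ?_⟩
    have : v = t⁻¹ • v0 := by rw [← ht, smul_smul, inv_mul_cancel₀ h, one_smul]
    rw [this]
    exact Submodule.smul_mem _ _ h0

end Rep

/-! ### The product of two modules and the submodule of a diagonal vacuum -/

section Product

variable {V F : Type*} [AddCommGroup V] [Module ℂ V] [AddCommGroup F] [Module ℂ F]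
  {c : ℂ} {X : Gen → Module.End ℂ V} {Y : Gen → Module.End ℂ F} {v : V} {w : F}

/-- The generators acting on a product. -/
def prodGen (X : Gen → Module.End ℂ V) (Y : Gen → Module.End ℂ F) (a : Gen) :
    Module.End ℂ (V × F) :=
  (X a).prodMap (Y a)

theorem linearCombination_prodGen (x : Space) (u : V × F) :
    Finsupp.linearCombination ℂ (prodGen X Y) x u =
      (Finsupp.linearCombination ℂ X x u.1, Finsupp.linearCombination ℂ Y x u.2) := by
  induction x using Finsupp.induction_linear with
  | zero => rfl
  | add x y hx hy => simp [hx, hy]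
  | single a t => simp [prodGen, LinearMap.prodMap_apply]

theorem IsAction.prod (hX : IsAction c X) (hY : IsAction c Y) : IsAction c (prodGen X Y) where
  central u := Prod.ext (hX.central u.1) (hY.central u.2)
  br a b u := by
    rw [linearCombination_prodGen]
    exact Prod.ext (hX.br a b u.1) (hY.br a b u.2)

theorem IsVacuum.prod (hv : IsVacuum X v) (hw : IsVacuum Y w) :
    IsVacuum (prodGen X Y) (v, w) :=
  fun a hC hd => Prod.ext (hv a hC hd) (hw a hC hd)

theorem Mono.fst {n : ℤ} {u : V × F} (h : Mono (prodGen X Y) (v, w) n u) : Mono X v n u.1 := by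
  induction h with
  | vac => exact .vac
  | step a ha n u _ ih => exact .step a ha n _ ih

theorem Mono.snd {n : ℤ} {u : V × F} (h : Mono (prodGen X Y) (v, w) n u) : Mono Y w n u.2 := by
  induction h with
  | vac => exact .vac
  | step a ha n u _ ih => exact .step a ha n _ ih

theorem fst_mem_piece {n : ℤ} {u : V × F} (h : u ∈ piece (prodGen X Y) (v, w) n) :
    u.1 ∈ piece X v n := by
  induction h using piece_induction with
  | hm u hu => exact hu.fst.mem
  | h0 => simp
  | hadd u v _ _ h h' => simpa using Submodule.add_mem _ h h'
  | hsmul t u _ h => simpa using Submodule.smul_mem _ t h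

theorem snd_mem_piece {n : ℤ} {u : V × F} (h : u ∈ piece (prodGen X Y) (v, w) n) :
    u.2 ∈ piece Y w n := by
  induction h using piece_induction with
  | hm u hu => exact hu.snd.mem
  | h0 => simp
  | hadd u v _ _ h h' => simpa using Submodule.add_mem _ h h'
  | hsmul t u _ h => simpa using Submodule.smul_mem _ t h

theorem snd_mem_iSup_piece {u : V × F} (h : u ∈ ⨆ n, piece (prodGen X Y) (v, w) n) :
    u.2 ∈ ⨆ n, piece Y w n := by
  induction h using Submodule.iSup_induction' with
  | mem n u hu => exact Submodule.mem_iSup_of_mem n (snd_mem_piece hu)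
  | zero => simp
  | add u v _ _ h h' => simpa using Submodule.add_mem _ h h'

/-- The second entries of the homogeneous components are `L 0`-eigenvectors with distinct
eigenvalues and sum zero, so each of them is zero. Thus the kernel of the second projection is
itself graded by degree. -/
theorem exists_pieces_of_snd_eq_zero (hY : IsAction c Y) (hw : IsVacuum Y w) {y : V}
    (h : ((y, 0) : V × F) ∈ ⨆ n, piece (prodGen X Y) (v, w) n) :
    ∃ f : ℤ →₀ V, (∀ n, ((f n, 0) : V × F) ∈ piece (prodGen X Y) (v, w) n) ∧
      (f.sum fun _ x => x) = y := by
  obtain ⟨f, hf, hsum⟩ := exists_pieces h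
  have h2 := eq_zero_of_sum_eigenvectors (Y (.L 0)) (f.mapRange Prod.snd rfl)
    (fun n => by simpa using hY.L_zero_piece hw (snd_mem_piece (hf n)))
    (by
      rw [Finsupp.sum_mapRange_index (by simp), Finsupp.sum, ← Prod.snd_sum]
      exact congrArg Prod.snd hsum)
  refine ⟨f.mapRange Prod.fst rfl, fun n => ?_, ?_⟩
  · have := DFunLike.congr_fun h2 n
    rw [Finsupp.mapRange_apply, Finsupp.zero_apply] at this
    rw [Finsupp.mapRange_apply, ← this]
    exact hf n
  · rw [Finsupp.sum_mapRange_index (by simp), Finsupp.sum, ← Prod.fst_sum]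
    exact congrArg Prod.fst hsum

theorem exists_pieces_of_fst_eq_zero (hX : IsAction c X) (hv : IsVacuum X v) {y : F}
    (h : ((0, y) : V × F) ∈ ⨆ n, piece (prodGen X Y) (v, w) n) :
    ∃ f : ℤ →₀ F, (∀ n, ((0, f n) : V × F) ∈ piece (prodGen X Y) (v, w) n) ∧
      (f.sum fun _ x => x) = y := by
  obtain ⟨f, hf, hsum⟩ := exists_pieces h
  have h2 := eq_zero_of_sum_eigenvectors (X (.L 0)) (f.mapRange Prod.fst rfl)
    (fun n => by simpa using hX.L_zero_piece hv (fst_mem_piece (hf n)))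
    (by
      rw [Finsupp.sum_mapRange_index (by simp), Finsupp.sum, ← Prod.fst_sum]
      exact congrArg Prod.fst hsum)
  refine ⟨f.mapRange Prod.snd rfl, fun n => ?_, ?_⟩
  · have := DFunLike.congr_fun h2 n
    rw [Finsupp.mapRange_apply, Finsupp.zero_apply] at this
    rw [Finsupp.mapRange_apply, ← this]
    exact hf n
  · rw [Finsupp.sum_mapRange_index (by simp), Finsupp.sum, ← Prod.snd_sum]
    exact congrArg Prod.snd hsum

end Product

/-! ### Transfer of an invariant scalar product to an irreducible representation -/

section Comparison

variable {V F : Type*} [AddCommGroup V] [Module ℂ V] [AddCommGroup F] [Module ℂ F]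

/-- The pull-back of a scalar product along an injective linear map. -/
@[reducible]
noncomputable def coreComap (s : InnerProductSpace.Core ℂ F) (f : V →ₗ[ℂ] F)
    (hf : Function.Injective f) : InnerProductSpace.Core ℂ V where
  inner x y := s.inner (f x) (f y)
  conj_inner_symm x y := s.conj_inner_symm _ _
  re_inner_nonneg x := s.re_inner_nonneg _
  add_left x y z := by
    rw [map_add]
    exact s.add_left _ _ _
  smul_left x y r := by
    rw [map_smul]
    exact s.smul_left _ _ _
  definite x hx := hf (by rw [map_zero]; exact s.definite _ hx)

variable {c : ℂ} {Y : Gen → Module.End ℂ F} {w : F} {s : InnerProductSpace.Core ℂ F}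

theorem core_add_right (s : InnerProductSpace.Core ℂ F) (x y z : F) :
    s.inner x (y + z) = s.inner x y + s.inner x z := by
  rw [← s.conj_inner_symm, s.add_left, map_add, s.conj_inner_symm, s.conj_inner_symm]

theorem core_smul_right (s : InnerProductSpace.Core ℂ F) (x y : F) (t : ℂ) :
    s.inner x (t • y) = t * s.inner x y := by
  rw [← s.conj_inner_symm, s.smul_left, map_mul, s.conj_inner_symm, Complex.conj_conj]

theorem core_zero_left (s : InnerProductSpace.Core ℂ F) (x : F) : s.inner 0 x = 0 := by
  simpa using s.smul_left 0 x 0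

theorem core_zero_right (s : InnerProductSpace.Core ℂ F) (x : F) : s.inner x 0 = 0 := by
  simpa using core_smul_right s x 0 0

/-- Creators can be moved from one side of the form to the other, and `N` is stable; hence
orthogonality to `w` spreads to the whole cyclic module, which contains `N`. Definiteness then gives
`N = ⊥`. -/
theorem eq_zero_of_inner_piece
    (hs : ∀ a, ∀ u ∈ ⨆ n, piece Y w n, ∀ u' ∈ ⨆ n, piece Y w n,
      s.inner (Y a u) u' = s.inner u (Y a.adj u'))
    (N : Submodule ℂ F) (hN : ∀ a, ∀ u ∈ N, Y a u ∈ N) (hle : N ≤ ⨆ n, piece Y w n)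
    (hw : ∀ u ∈ N, s.inner w u = 0) : N = ⊥ := by
  have hmono : ∀ n x, Mono Y w n x → ∀ u ∈ N, s.inner x u = 0 := by
    intro n x hx
    induction hx with
    | vac => exact hw
    | step a _ n x hx ih =>
      intro u hu
      rw [hs a x (Submodule.mem_iSup_of_mem n hx.mem) u (hle hu)]
      exact ih _ (hN _ _ hu)
  rw [Submodule.eq_bot_iff]
  intro u hu
  apply s.definite
  have hall : ∀ x ∈ ⨆ n, piece Y w n, s.inner x u = 0 := by
    intro x hx
    induction hx using Submodule.iSup_induction' with
    | mem n x hx =>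
      induction hx using piece_induction with
      | hm x hx => exact hmono n x hx u hu
      | h0 => exact core_zero_left s u
      | hadd x y _ _ h h' => rw [s.add_left, h, h', add_zero]
      | hsmul t x _ h => rw [s.smul_left, h, mul_zero]
    | zero => exact core_zero_left s u
    | add x y _ _ h h' => rw [s.add_left, h, h', add_zero]
  exact hall u (hle hu)

/-- If the cyclic module of a vacuum vector carries an invariant scalar product, then every
irreducible vacuum representation of the same central charge is unitary. -/
theorem isUnitary_of_contravariant {π : alg.Rep V} (hπc : HasCentralCharge π c)
    (hirr : π.IsIrreducible) (hlw : IsLowestWeight π 0 0) (hY : IsAction c Y)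
    (hw : IsVacuum Y w) (hw0 : w ≠ 0)
    (hs : ∀ a, ∀ u ∈ ⨆ n, piece Y w n, ∀ u' ∈ ⨆ n, piece Y w n,
      s.inner (Y a u) u' = s.inner u (Y a.adj u')) : IsUnitary π := by
  obtain ⟨v, hv, hcyc⟩ := hlw
  obtain ⟨p, hp⟩ := exists_mem_part hπc hv hcyc
  have hX := repGen_isAction hπc
  have hvv := repGen_isVacuum hv
  set U : Submodule ℂ (V × F) := ⨆ n, piece (prodGen (repGen π) Y) (v, w) n with hU
  have hUmap : ∀ a, ∀ u ∈ U, prodGen (repGen π) Y a u ∈ U := fun a u hu =>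
    (hX.prod hY).map_iSup_piece (hvv.prod hw) a hu
  have hvac : (v, w) ∈ U := Submodule.mem_iSup_of_mem 0 Mono.vac.mem
  have hfst : Function.Surjective ((LinearMap.fst ℂ V F).comp U.subtype) := by
    rw [← LinearMap.range_eq_top]
    refine hcyc _ (isInvariant_of_repGen ?_) ⟨⟨(v, w), hvac⟩, rfl⟩
    rintro a _ ⟨⟨u, hu⟩, rfl⟩
    exact ⟨⟨_, hUmap a u hu⟩, rfl⟩
  -- The kernel of the projection to `V` is orthogonal to `w`, degree by degree.
  have hN : U.comap (LinearMap.inr ℂ V F) = ⊥ := by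
    refine eq_zero_of_inner_piece hs _ ?_ ?_ ?_
    · intro a u hu
      simpa [prodGen, LinearMap.prodMap_apply] using hUmap a _ hu
    · intro u hu
      exact snd_mem_iSup_piece (u := (0, u)) hu
    · intro u hu
      obtain ⟨f, hf, rfl⟩ := exists_pieces_of_fst_eq_zero hX hvv (y := u) hu
      have hterm (n : ℤ) : s.inner w (f n) = 0 := by
        rcases eq_or_ne n 0 with rfl | hn
        -- Degree zero of the diagonal module is spanned by `(v, w)`, and `v ≠ 0`, so a zero first
        -- entry forces a zero second entry.
        · have h0 := hf 0
          rw [piece_zero, Submodule.mem_span_singleton] at h0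
          obtain ⟨t, ht⟩ := h0
          have ht0 : t = 0 := (smul_eq_zero.mp (congrArg Prod.fst ht)).resolve_right hv.ne_zero
          have : f 0 = 0 := by
            rw [ht0, zero_smul] at ht
            exact (congrArg Prod.snd ht).symm
          rw [this, core_zero_right]
        -- In degree `n ≠ 0` the operator `L 0` is symmetric, with eigenvalue `0` on `w` and `n / 2`
        -- on `f n`.
        · have hfn := snd_mem_piece (hf n)
          have h1 := hs (.L 0) w (Submodule.mem_iSup_of_mem 0 Mono.vac.mem) (f n)
            (Submodule.mem_iSup_of_mem n hfn)
          rw [hw (.L 0) (by simp) (by simp [Gen.deg]), core_zero_left,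
            show Gen.adj (.L 0) = .L 0 by simp [Gen.adj], hY.L_zero_piece hw hfn,
            core_smul_right] at h1
          simpa [hn] using h1.symm
      rw [Finsupp.sum]
      exact Finset.sum_induction f (fun x => s.inner w x = 0)
        (fun x y hx hy => by rw [core_add_right, hx, hy, add_zero]) (core_zero_right s w)
        (fun n _ => hterm n)
  have hK : U.comap (LinearMap.inl ℂ V F) = ⊥ := by
    refine (hirr.2 _ (isInvariant_of_repGen ?_) ?_).resolve_right ?_
    · intro a u hu
      simpa [prodGen, LinearMap.prodMap_apply] using hUmap a _ hu
    · refine le_antisymm (sup_le inf_le_left inf_le_left) ?_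
      intro y hy
      -- Irreducibility only concerns graded subspaces. Each component of fixed degree lies in a
      -- single part, because `v` is homogeneous.
      obtain ⟨f, hf, rfl⟩ := exists_pieces_of_snd_eq_zero hY hw (y := y) hy
      refine Submodule.sum_mem _ fun n _ => part_le π _ (n + p) ⟨?_, ?_⟩
      · exact Submodule.mem_iSup_of_mem n (hf n)
      · exact piece_le_part hp n (fst_mem_piece (hf n))
    · intro htop
      -- If the kernel of the projection to `F` were everything, subtracting `(v, 0)` from `(v, w)`
      -- would put `w` into the trivial kernel on the other side.
      have hy' : v ∈ U.comap (LinearMap.inl ℂ V F) := htop ▸ Submodule.mem_top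
      have hy : ((v, 0) : V × F) ∈ U := hy'
      have h0w : ((0, w) : V × F) ∈ U := by simpa using Submodule.sub_mem _ hvac hy
      have : w ∈ U.comap (LinearMap.inr ℂ V F) := h0w
      rw [hN] at this
      exact hw0 this
  have hinj1 : Function.Injective ((LinearMap.fst ℂ V F).comp U.subtype) := by
    rw [← LinearMap.ker_eq_bot, Submodule.eq_bot_iff]
    rintro ⟨⟨x, y⟩, hu⟩ (rfl : x = 0)
    have : y ∈ U.comap (LinearMap.inr ℂ V F) := hu
    rw [hN] at this
    exact Subtype.ext (Prod.ext rfl this)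
  have hinj2 : Function.Injective ((LinearMap.snd ℂ V F).comp U.subtype) := by
    rw [← LinearMap.ker_eq_bot, Submodule.eq_bot_iff]
    rintro ⟨⟨x, y⟩, hu⟩ (rfl : y = 0)
    have : x ∈ U.comap (LinearMap.inl ℂ V F) := hu
    rw [hK] at this
    exact Subtype.ext (Prod.ext this rfl)
  -- `U` is now the graph of an injective map from `V` to `F`.
  let E := LinearEquiv.ofBijective _ ⟨hinj1, hfst⟩
  let f : V →ₗ[ℂ] F := ((LinearMap.snd ℂ V F).comp U.subtype).comp E.symm.toLinearMap
  have hf : Function.Injective f := hinj2.comp E.symm.injective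
  have hfU (x : V) : (x, f x) ∈ U := by
    have h1 : (E.symm x).1.1 = x := E.apply_symm_apply x
    have h2 : (E.symm x).1 = (x, f x) := Prod.ext h1 rfl
    exact h2 ▸ (E.symm x).2
  have hfmap (a : Gen) (x : V) : f (repGen π a x) = Y a (f x) := by
    have h1 := Submodule.sub_mem _ (hfU (repGen π a x)) (hUmap a _ (hfU x))
    have h2 : f (repGen π a x) - Y a (f x) ∈ U.comap (LinearMap.inr ℂ V F) := by
      simpa [prodGen, LinearMap.prodMap_apply] using h1
    rw [hN] at h2
    exact sub_eq_zero.mp h2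
  have hfmem (x : V) : f x ∈ ⨆ n, piece Y w n := snd_mem_iSup_piece (u := (x, f x)) (hfU x)
  have key (a : Gen) (x y : V) : (coreComap s f hf).inner (repGen π a x) y =
      (coreComap s f hf).inner x (repGen π a.adj y) := by
    change s.inner _ _ = s.inner _ _
    rw [hfmap, hfmap]
    exact hs a _ (hfmem x) _ (hfmem y)
  exact ⟨coreComap s f hf, fun m => key (.L m), fun n => key (.J n), fun k => key (.G1 k),
    fun k => key (.G2 k)⟩

end Comparison

end N2

/-! ### Sums of operators that are finite on every vector -/

section LocSum

variable {ι M : Type*} [AddCommGroup M] [Module ℂ M]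

/-- On every vector all but finitely many of the operators vanish. -/
def LocFin (f : ι → Module.End ℂ M) : Prop :=
  ∀ v, (Function.support fun i => f i v).Finite

open Classical in
/-- The pointwise sum of a locally finite family of operators (`0` for other families). -/
noncomputable def locSum (f : ι → Module.End ℂ M) : Module.End ℂ M :=
  if h : LocFin f then
    { toFun := fun v => ∑ᶠ i, f i v
      map_add' := fun u v => by
        simp only [map_add]
        exact finsum_add_distrib (h u) (h v)
      map_smul' := fun t v => by
        simp only [map_smul, RingHom.id_apply]
        exact (smul_finsum' t (h v)).symm }
  else 0

variable {f g : ι → Module.End ℂ M}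

theorem locSum_apply (h : LocFin f) (v : M) : locSum f v = ∑ᶠ i, f i v := by
  rw [locSum, dif_pos h]
  rfl

theorem LocFin.mul_right (h : LocFin f) (T : Module.End ℂ M) : LocFin fun i => f i * T :=
  fun v => h (T v)

theorem LocFin.mul_left (h : LocFin f) (T : Module.End ℂ M) : LocFin fun i => T * f i :=
  fun v => (h v).subset fun i hi hi' => hi (by simp [Module.End.mul_apply, hi'])

theorem LocFin.smul (h : LocFin f) (t : ℂ) : LocFin fun i => t • f i :=
  fun v => (h v).subset fun i hi hi' => hi (by simp [hi'])

theorem LocFin.add (hf : LocFin f) (hg : LocFin g) : LocFin fun i => f i + g i :=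
  fun v => ((hf v).union (hg v)).subset fun i hi => by
    by_contra hcon
    simp only [Set.mem_union, Function.mem_support, not_or, not_not] at hcon
    exact hi (by simp [hcon.1, hcon.2])

theorem locSum_mul (h : LocFin f) (T : Module.End ℂ M) :
    locSum f * T = locSum fun i => f i * T := by
  ext v
  rw [locSum_apply (h.mul_right T), Module.End.mul_apply, locSum_apply h]
  rfl

theorem mul_locSum (h : LocFin f) (T : Module.End ℂ M) :
    T * locSum f = locSum fun i => T * f i := by
  ext v
  rw [locSum_apply (h.mul_left T), Module.End.mul_apply, locSum_apply h, map_finsum T (h v)]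
  rfl

theorem smul_locSum (h : LocFin f) (t : ℂ) : t • locSum f = locSum fun i => t • f i := by
  ext v
  rw [locSum_apply (h.smul t), LinearMap.smul_apply, locSum_apply h, smul_finsum' t (h v)]
  rfl

theorem locSum_add (hf : LocFin f) (hg : LocFin g) :
    locSum f + locSum g = locSum fun i => f i + g i := by
  ext v
  rw [locSum_apply (hf.add hg), LinearMap.add_apply, locSum_apply hf, locSum_apply hg]
  exact (finsum_add_distrib (hf v) (hg v)).symm

theorem locFin_of_eq_zero (i : ι) (h : ∀ j, j ≠ i → f j = 0) : LocFin f :=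
  fun v => (Set.finite_singleton i).subset fun j hj => by
    by_contra hcon
    exact hj (by simp [h j hcon])

theorem locSum_eq_single (i : ι) (h : ∀ j, j ≠ i → f j = 0) : locSum f = f i := by
  ext v
  rw [locSum_apply (locFin_of_eq_zero i h)]
  exact finsum_eq_single _ i fun j hj => by simp [h j hj]

theorem locSum_eq_zero (h : ∀ j, f j = 0) : locSum f = 0 := by
  have : LocFin f := fun v => by simp [h]
  ext v
  rw [locSum_apply this]
  simp [h]

/-- The bracket `f T + t T f` of a locally finite sum, when it reduces to a single term. -/
theorem locSum_bracket (h : LocFin f) (T : Module.End ℂ M) (t : ℂ) (i : ι)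
    (hi : ∀ j, j ≠ i → f j * T + t • (T * f j) = 0) :
    locSum f * T + t • (T * locSum f) = f i * T + t • (T * f i) := by
  rw [locSum_mul h, mul_locSum h, smul_locSum (h.mul_left T),
    locSum_add (h.mul_right T) ((h.mul_left T).smul t)]
  exact locSum_eq_single i hi

theorem locSum_bracket_eq_zero (h : LocFin f) (T : Module.End ℂ M) (t : ℂ)
    (hi : ∀ j, f j * T + t • (T * f j) = 0) : locSum f * T + t • (T * locSum f) = 0 := by
  rw [locSum_mul h, mul_locSum h, smul_locSum (h.mul_left T),
    locSum_add (h.mul_right T) ((h.mul_left T).smul t)]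
  exact locSum_eq_zero hi

theorem locSum_apply_eq_single (h : LocFin f) (v : M) (i : ι) (hi : ∀ j, j ≠ i → f j v = 0) :
    locSum f v = f i v := by
  rw [locSum_apply h]
  exact finsum_eq_single _ i hi

theorem locSum_apply_eq_zero (h : LocFin f) (v : M) (hi : ∀ j, f j v = 0) :
    locSum f v = 0 := by
  rw [locSum_apply h]
  simp [hi]

/-- Every vector is killed by all modes of sufficiently large index. -/
def LocNil (f : ℤ → Module.End ℂ M) : Prop := ∀ v, ∃ N : ℤ, ∀ n, N ≤ n → f n v = 0

/-- The factors commute, so no normal ordering is needed: for large `n` the factor `A n` kills the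
vector, for very negative `n` the factor `P (k - n)` does. -/
theorem LocNil.locFin_mul {P A : ℤ → Module.End ℂ M} (hP : LocNil P) (hA : LocNil A)
    (hPA : ∀ m n, P m * A n = A n * P m) (k : ℤ) : LocFin fun n => P (k - n) * A n := by
  intro v
  obtain ⟨N, hN⟩ := hP v
  obtain ⟨N', hN'⟩ := hA v
  refine (Set.finite_Ioo (k - N) N').subset fun n hn => ?_
  by_contra hcon
  rw [Set.mem_Ioo, not_and_or, not_lt, not_lt] at hcon
  apply hn
  rcases hcon with h | h
  · change (P (k - n) * A n) v = 0
    rw [hPA, Module.End.mul_apply, hN _ (by omega), map_zero]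
  · change (P (k - n) * A n) v = 0
    rw [Module.End.mul_apply, hN' _ h, map_zero]

theorem LocNil.locFin_mul_anti {P A : ℤ → Module.End ℂ M} (hP : LocNil P) (hA : LocNil A)
    (hPA : ∀ m n, P m * A n = -(A n * P m)) (k : ℤ) : LocFin fun n => P (k - n) * A n := by
  intro v
  obtain ⟨N, hN⟩ := hP v
  obtain ⟨N', hN'⟩ := hA v
  refine (Set.finite_Ioo (k - N) N').subset fun n hn => ?_
  by_contra hcon
  rw [Set.mem_Ioo, not_and_or, not_lt, not_lt] at hcon
  apply hn
  rcases hcon with h | h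
  · change (P (k - n) * A n) v = 0
    rw [hPA, LinearMap.neg_apply, Module.End.mul_apply, hN _ (by omega), map_zero, neg_zero]
  · change (P (k - n) * A n) v = 0
    rw [Module.End.mul_apply, hN' _ h, map_zero]

end LocSum

/-! ### The abstract Fock space and its irreducibility -/

open N2 (delta)

/-- A Fock space of two free bosons `a`, `b` and two free real fermions `φ`, `χ` (the fermionic
modes `φ k` having index `k + 1/2`), with its scalar product and the two sign operators
`Γ = (-1)^F` and `Δ` (changing the sign of `b` and `χ`). -/
structure FockSpace (F : Type*) [AddCommGroup F] [Module ℂ F] where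
  a : ℤ → Module.End ℂ F
  b : ℤ → Module.End ℂ F
  φ : ℤ → Module.End ℂ F
  χ : ℤ → Module.End ℂ F
  Γ : Module.End ℂ F
  Δ : Module.End ℂ F
  vac : F
  form : InnerProductSpace.Core ℂ F
  aa : ∀ m n, a m * a n - a n * a m = ((m : ℂ) * delta (m + n)) • 1
  bb : ∀ m n, b m * b n - b n * b m = ((m : ℂ) * delta (m + n)) • 1
  ab : ∀ m n, a m * b n = b n * a m
  φa : ∀ m n, φ m * a n = a n * φ m
  φb : ∀ m n, φ m * b n = b n * φ m
  χa : ∀ m n, χ m * a n = a n * χ m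
  χb : ∀ m n, χ m * b n = b n * χ m
  φφ : ∀ k l, φ k * φ l + φ l * φ k = delta (k + l + 1) • 1
  χχ : ∀ k l, χ k * χ l + χ l * χ k = delta (k + l + 1) • 1
  φχ : ∀ k l, φ k * χ l = -(χ l * φ k)
  a_nil : LocNil a
  b_nil : LocNil b
  φ_nil : LocNil φ
  χ_nil : LocNil χ
  a_vac : ∀ n, 0 ≤ n → a n vac = 0
  b_vac : ∀ n, 0 ≤ n → b n vac = 0
  φ_vac : ∀ k, 0 ≤ k → φ k vac = 0
  χ_vac : ∀ k, 0 ≤ k → χ k vac = 0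
  a_adj : ∀ n u v, form.inner (a n u) v = form.inner u (a (-n) v)
  b_adj : ∀ n u v, form.inner (b n u) v = form.inner u (b (-n) v)
  φ_adj : ∀ k u v, form.inner (φ k u) v = form.inner u (φ (-1 - k) v)
  χ_adj : ∀ k u v, form.inner (χ k u) v = form.inner u (χ (-1 - k) v)
  vac_ne : vac ≠ 0
  cyclic : ∀ W : Submodule ℂ F, vac ∈ W → (∀ n < 0, ∀ v ∈ W, a n v ∈ W) →
    (∀ n < 0, ∀ v ∈ W, b n v ∈ W) → (∀ k < 0, ∀ v ∈ W, φ k v ∈ W) →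
    (∀ k < 0, ∀ v ∈ W, χ k v ∈ W) → W = ⊤
  Γa : ∀ n, Γ * a n = a n * Γ
  Γb : ∀ n, Γ * b n = b n * Γ
  Γφ : ∀ k, Γ * φ k = -(φ k * Γ)
  Γχ : ∀ k, Γ * χ k = -(χ k * Γ)
  Γ_vac : Γ vac = vac
  Δa : ∀ n, Δ * a n = a n * Δ
  Δb : ∀ n, Δ * b n = -(b n * Δ)
  Δφ : ∀ k, Δ * φ k = φ k * Δ
  Δχ : ∀ k, Δ * χ k = -(χ k * Δ)
  Δ_vac : Δ vac = vac

namespace FockSpace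

variable {F : Type*} [AddCommGroup F] [Module ℂ F] (H : FockSpace F)

/-- The same Fock space with `φ` and `χ` replaced by `χ` and `-φ`. -/
noncomputable def rot : FockSpace F where
  a := H.a
  b := H.b
  φ := H.χ
  χ := fun k => -H.φ k
  Γ := H.Γ
  Δ := H.Δ * H.Γ
  vac := H.vac
  form := H.form
  aa := H.aa
  bb := H.bb
  ab := H.ab
  φa := H.χa
  φb := H.χb
  χa m n := by rw [neg_mul, mul_neg, H.φa]
  χb m n := by rw [neg_mul, mul_neg, H.φb]
  φφ := H.χχ
  χχ k l := by rw [neg_mul_neg, neg_mul_neg, H.φφ]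
  φχ k l := by rw [mul_neg, neg_mul, H.φχ, neg_neg]
  a_nil := H.a_nil
  b_nil := H.b_nil
  φ_nil := H.χ_nil
  χ_nil v := by
    obtain ⟨N, hN⟩ := H.φ_nil v
    exact ⟨N, fun n hn => by rw [LinearMap.neg_apply, hN n hn, neg_zero]⟩
  a_vac := H.a_vac
  b_vac := H.b_vac
  φ_vac := H.χ_vac
  χ_vac k hk := by rw [LinearMap.neg_apply, H.φ_vac k hk, neg_zero]
  a_adj := H.a_adj
  b_adj := H.b_adj
  φ_adj := H.χ_adj
  χ_adj k u v := by
    rw [LinearMap.neg_apply, LinearMap.neg_apply, ← neg_one_smul ℂ (H.φ k u),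
      ← neg_one_smul ℂ (H.φ _ v), H.form.smul_left, N2.core_smul_right, H.φ_adj]
    simp
  vac_ne := H.vac_ne
  cyclic W h0 ha hb hφ hχ := H.cyclic W h0 ha hb
    (fun k hk v hv => by simpa using W.neg_mem (hχ k hk v hv)) hφ
  Γa := H.Γa
  Γb := H.Γb
  Γφ := H.Γχ
  Γχ k := by rw [mul_neg, neg_mul, H.Γφ]
  Γ_vac := H.Γ_vac
  Δa n := by rw [mul_assoc, H.Γa, ← mul_assoc, H.Δa, mul_assoc]
  Δb n := by rw [mul_assoc, H.Γb, ← mul_assoc, H.Δb, neg_mul, mul_assoc]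
  Δφ k := by rw [mul_assoc, H.Γχ, mul_neg, ← mul_assoc, H.Δχ, neg_mul, neg_neg, mul_assoc]
  Δχ k := by
    rw [mul_neg, mul_assoc, H.Γφ, mul_neg, ← mul_assoc, H.Δφ, neg_neg, neg_mul, neg_neg,
      mul_assoc]
  Δ_vac := by rw [Module.End.mul_apply, H.Γ_vac, H.Δ_vac]

/-- A vector killed by all annihilation modes is a multiple of the vacuum. -/
theorem exists_smul_vac {x : F} (ha : ∀ n, 0 < n → H.a n x = 0) (hb : ∀ n, 0 < n → H.b n x = 0)
    (hφ : ∀ k, 0 ≤ k → H.φ k x = 0) (hχ : ∀ k, 0 ≤ k → H.χ k x = 0) :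
    ∃ t : ℂ, x = t • H.vac := by
  have hne : H.form.inner H.vac H.vac ≠ 0 := fun h => H.vac_ne (H.form.definite _ h)
  set t := H.form.inner H.vac x / H.form.inner H.vac H.vac with ht
  refine ⟨t, sub_eq_zero.mp ?_⟩
  set y := x - t • H.vac with hy
  have hya : ∀ n, 0 < n → H.a n y = 0 := fun n hn => by simp [hy, ha n hn, H.a_vac n hn.le]
  have hyb : ∀ n, 0 < n → H.b n y = 0 := fun n hn => by simp [hy, hb n hn, H.b_vac n hn.le]
  have hyφ : ∀ n, 0 ≤ n → H.φ n y = 0 := fun n hn => by simp [hy, hφ n hn, H.φ_vac n hn]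
  have hyχ : ∀ n, 0 ≤ n → H.χ n y = 0 := fun n hn => by simp [hy, hχ n hn, H.χ_vac n hn]
  have h0 : H.form.inner H.vac y = 0 := by
    rw [hy, sub_eq_add_neg, ← neg_smul, N2.core_add_right, N2.core_smul_right, ht]
    field_simp
    ring
  -- The vectors orthogonal to `y` include the vacuum and are stable under creation modes, because
  -- the adjoint annihilation modes kill `y`. By cyclicity `y` is orthogonal to itself.
  let W : Submodule ℂ F :=
    { carrier := {w | H.form.inner w y = 0}
      add_mem' := fun {u v} hu hv => by
        simp only [Set.mem_ofPred_eq] at *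
        rw [H.form.add_left, hu, hv, add_zero]
      zero_mem' := N2.core_zero_left _ _
      smul_mem' := fun r u hu => by
        simp only [Set.mem_ofPred_eq] at *
        rw [H.form.smul_left, hu, mul_zero] }
  have hW : W = ⊤ := by
    refine H.cyclic W h0 ?_ ?_ ?_ ?_ <;> intro n hn v _
    · change H.form.inner _ _ = 0
      rw [H.a_adj, hya _ (by omega), N2.core_zero_right]
    · change H.form.inner _ _ = 0
      rw [H.b_adj, hyb _ (by omega), N2.core_zero_right]
    · change H.form.inner _ _ = 0
      rw [H.φ_adj, hyφ _ (by omega), N2.core_zero_right]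
    · change H.form.inner _ _ = 0
      rw [H.χ_adj, hyχ _ (by omega), N2.core_zero_right]
  have : y ∈ W := hW ▸ Submodule.mem_top
  exact H.form.definite y this

/-- An operator which commutes (up to a sign `ε` for the fermions) with all modes is determined
by its value on the vacuum. -/
theorem eq_zero_of_vac {X : Module.End ℂ F} (ε : ℂ) (ha : ∀ n, X * H.a n = H.a n * X)
    (hb : ∀ n, X * H.b n = H.b n * X) (hφ : ∀ n, X * H.φ n = ε • (H.φ n * X))
    (hχ : ∀ n, X * H.χ n = ε • (H.χ n * X)) (h0 : X H.vac = 0) : X = 0 := by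
  have hker : LinearMap.ker X = ⊤ := by
    refine H.cyclic _ h0 ?_ ?_ ?_ ?_ <;> intro n _ v hv <;> rw [LinearMap.mem_ker] at hv ⊢
    · simpa [hv] using LinearMap.congr_fun (ha n) v
    · simpa [hv] using LinearMap.congr_fun (hb n) v
    · simpa [hv] using LinearMap.congr_fun (hφ n) v
    · simpa [hv] using LinearMap.congr_fun (hχ n) v
  exact LinearMap.ker_eq_top.mp hker

theorem exists_apply_vac {X : Module.End ℂ F} (ε : ℂ) (hε : ε ≠ 0)
    (ha : ∀ n, X * H.a n = H.a n * X)
    (hb : ∀ n, X * H.b n = H.b n * X) (hφ : ∀ n, X * H.φ n = ε • (H.φ n * X))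
    (hχ : ∀ n, X * H.χ n = ε • (H.χ n * X)) : ∃ t : ℂ, X H.vac = t • H.vac := by
  refine H.exists_smul_vac (fun n hn => ?_) (fun n hn => ?_) (fun n hn => ?_) (fun n hn => ?_)
  · simpa [H.a_vac n hn.le] using (LinearMap.congr_fun (ha n) H.vac).symm
  · simpa [H.b_vac n hn.le] using (LinearMap.congr_fun (hb n) H.vac).symm
  · simpa [H.φ_vac n hn, hε] using (LinearMap.congr_fun (hφ n) H.vac).symm
  · simpa [H.χ_vac n hn, hε] using (LinearMap.congr_fun (hχ n) H.vac).symm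

/-- An operator commuting with all modes is a scalar. -/
theorem exists_eq_smul_one {X : Module.End ℂ F} (ha : ∀ n, X * H.a n = H.a n * X)
    (hb : ∀ n, X * H.b n = H.b n * X) (hφ : ∀ n, X * H.φ n = H.φ n * X)
    (hχ : ∀ n, X * H.χ n = H.χ n * X) : ∃ t : ℂ, X = t • 1 := by
  obtain ⟨t, ht⟩ := H.exists_apply_vac 1 one_ne_zero ha hb (by simpa using hφ) (by simpa using hχ)
  refine ⟨t, sub_eq_zero.mp (H.eq_zero_of_vac 1 ?_ ?_ ?_ ?_ (by simp [ht]))⟩ <;> intro n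
  · simp [sub_mul, mul_sub, ha]
  · simp [sub_mul, mul_sub, hb]
  · simp [sub_mul, mul_sub, hφ]
  · simp [sub_mul, mul_sub, hχ]

/-- An operator commuting with all modes up to signs vanishes if it anticommutes with an operator
fixing the vacuum. -/
theorem eq_zero_of_anticommute {X : Module.End ℂ F} (ε : ℂ) (hε : ε ≠ 0)
    (ha : ∀ n, X * H.a n = H.a n * X)
    (hb : ∀ n, X * H.b n = H.b n * X) (hφ : ∀ n, X * H.φ n = ε • (H.φ n * X))
    (hχ : ∀ n, X * H.χ n = ε • (H.χ n * X)) (T : Module.End ℂ F) (hT : T H.vac = H.vac)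
    (hTX : T * X = -(X * T)) : X = 0 := by
  refine H.eq_zero_of_vac ε ha hb hφ hχ ?_
  obtain ⟨t, ht⟩ := H.exists_apply_vac ε hε ha hb hφ hχ
  have h := LinearMap.congr_fun hTX H.vac
  simp only [Module.End.mul_apply, LinearMap.neg_apply, hT, ht, map_smul] at h
  have h2 : (2 : ℂ) • (t • H.vac) = 0 := by
    rw [two_smul]
    nth_rewrite 1 [h]
    exact neg_add_cancel _
  rw [ht]
  exact (smul_eq_zero.mp h2).resolve_left two_ne_zero

end FockSpace

open N2 (delta delta_cases)

/-! ### Jacobi identities in an associative ring -/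

section Brackets

variable {R : Type*} [Ring R]

theorem bracket_anti_even {A B C X Y : R} (hA : A * C - C * A = X) (hB : B * C - C * B = Y) :
    (A * B + B * A) * C - C * (A * B + B * A) = (A * Y + Y * A) + (X * B + B * X) := by
  subst hA hB
  noncomm_ring

theorem bracket_anti_odd {A B C X Y : R} (hA : A * C + C * A = X) (hB : B * C + C * B = Y) :
    (A * B + B * A) * C - C * (A * B + B * A) = (A * Y - Y * A) + (B * X - X * B) := by
  subst hA hB
  noncomm_ring

theorem bracket_comm_anti {L G C X Z : R} (hL : L * C - C * L = X) (hG : G * C + C * G = Z) :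
    (L * G - G * L) * C + C * (L * G - G * L) = (L * Z - Z * L) - (G * X + X * G) := by
  subst hL hG
  noncomm_ring

theorem bracket_comm_comm {L G C X Z : R} (hL : L * C - C * L = X) (hG : G * C - C * G = Z) :
    (L * G - G * L) * C - C * (L * G - G * L) = (L * Z - Z * L) - (G * X - X * G) := by
  subst hL hG
  noncomm_ring

end Brackets

/-! ### The first supercurrent and the Virasoro modes -/

namespace FockSpace

variable {F : Type*} [AddCommGroup F] [Module ℂ F] (H : FockSpace F) (q : ℂ)

/-- The shift of the modes of `a`. -/
noncomputable def shift (n : ℤ) : ℂ := if n < 0 then 1 else if n = 0 then 1 / 2 else 0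

/-- The value `1 / 2` at `0` is chosen for this identity: it gives every mode of `ah` the same
defect of hermiticity. -/
theorem shift_add_shift_neg (n : ℤ) : shift n + shift (-n) = 1 := by
  unfold shift
  rcases lt_trichotomy n 0 with h | rfl | h
  · simp [h, h.ne, not_lt.mpr h.le]
  · norm_num
  · simp [h, h.ne', not_lt.mpr h.le]

/-- The shifted modes of `a`. -/
noncomputable def ah (n : ℤ) : Module.End ℂ F := H.a n - (Complex.I * q * shift n) • 1

theorem ah_ah (m n : ℤ) : H.ah q m * H.ah q n - H.ah q n * H.ah q m =
    ((m : ℂ) * delta (m + n)) • 1 := by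
  rw [← H.aa, ah, ah]
  simp only [sub_mul, mul_sub, smul_mul_assoc, mul_smul_comm, one_mul, mul_one]
  module

theorem ah_comm {T : Module.End ℂ F} {n : ℤ} (h : T * H.a n = H.a n * T) :
    T * H.ah q n = H.ah q n * T := by
  simp [ah, mul_sub, sub_mul, h]

theorem ah_nil : LocNil (H.ah q) := by
  intro v
  obtain ⟨N, hN⟩ := H.a_nil v
  refine ⟨max N 1, fun n hn => ?_⟩
  have h1 : 1 ≤ n := le_trans (le_max_right _ _) hn
  rw [ah, shift, if_neg (by omega), if_neg (by omega), mul_zero, zero_smul, sub_zero,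
    hN n (le_trans (le_max_left _ _) hn)]

/-- The modes of the product of a fermion and a boson. -/
noncomputable def prodModes (P A : ℤ → Module.End ℂ F) (k : ℤ) : Module.End ℂ F :=
  locSum fun n => P (k - n) * A n

/-- The modes of the supercurrent `φ a + χ b + i q ∂φ`. -/
noncomputable def G (k : ℤ) : Module.End ℂ F :=
  prodModes H.φ (H.ah q) k + prodModes H.χ H.b k - (Complex.I * q * (k + 1 / 2)) • H.φ k

section prodModes

variable {P Q A B : ℤ → Module.End ℂ F} (hP : LocNil P) (hA : LocNil A)
  (hPA : ∀ m n, P m * A n = A n * P m)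
include hP hA hPA

/-- Only the summand `n = k + l + 1` has a nonzero bracket with `P l`. -/
theorem prodModes_anti_fermion (hPP : ∀ k l, P k * P l + P l * P k = delta (k + l + 1) • 1)
    (k l : ℤ) : prodModes P A k * P l + P l * prodModes P A k = A (k + l + 1) := by
  have key (n : ℤ) : P (k - n) * A n * P l + (1 : ℂ) • (P l * (P (k - n) * A n)) =
      delta (k - n + l + 1) • A n := by
    rw [mul_assoc, ← hPA, ← mul_assoc, ← mul_assoc, one_smul, ← add_mul, hPP, smul_mul_assoc,
      one_mul]
  have h := locSum_bracket (hP.locFin_mul hA hPA k) (P l) 1 (k + l + 1) fun n hn => by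
    rw [key, delta, if_neg (by omega), zero_smul]
  rw [one_smul, key, delta, if_pos (by omega), one_smul] at h
  exact h

theorem prodModes_anti_other (hPQ : ∀ k l, P k * Q l = -(Q l * P k))
    (hQA : ∀ m n, Q m * A n = A n * Q m) (k l : ℤ) :
    prodModes P A k * Q l + Q l * prodModes P A k = 0 := by
  have h := locSum_bracket_eq_zero (hP.locFin_mul hA hPA k) (Q l) 1 fun n => by
    rw [mul_assoc, ← hQA, ← mul_assoc, ← mul_assoc, one_smul, hPQ, neg_mul, neg_add_cancel]
  rwa [one_smul] at h

theorem prodModes_comm_boson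
    (hAA : ∀ m n, A m * A n - A n * A m = ((m : ℂ) * delta (m + n)) • 1) (k m : ℤ) :
    prodModes P A k * A m - A m * prodModes P A k = (-(m : ℂ)) • P (k + m) := by
  have key (n : ℤ) : P (k - n) * A n * A m + (-1 : ℂ) • (A m * (P (k - n) * A n)) =
      ((n : ℂ) * delta (n + m)) • P (k - n) := by
    rw [← mul_assoc (A m), ← hPA, mul_assoc, mul_assoc, neg_one_smul, ← sub_eq_add_neg, ← mul_sub,
      hAA, mul_smul_comm, mul_one]
  have h := locSum_bracket (hP.locFin_mul hA hPA k) (A m) (-1) (-m) fun n hn => by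
    rw [key, delta, if_neg (by omega), mul_zero, zero_smul]
  rw [key, delta, if_pos (by omega), neg_one_smul, ← sub_eq_add_neg, mul_one] at h
  rw [prodModes, h]
  push_cast
  rw [sub_neg_eq_add]

theorem prodModes_comm {T : Module.End ℂ F} (hPT : ∀ n, T * P n = P n * T)
    (hAT : ∀ n, T * A n = A n * T) (k : ℤ) : T * prodModes P A k = prodModes P A k * T := by
  rw [prodModes, mul_locSum (hP.locFin_mul hA hPA k), locSum_mul (hP.locFin_mul hA hPA k)]
  congr 1
  funext n
  rw [← mul_assoc, hPT, mul_assoc, hAT, mul_assoc]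

theorem prodModes_anticomm {T : Module.End ℂ F} (s t : ℂ) (hPT : ∀ n, T * P n = s • (P n * T))
    (hAT : ∀ n, T * A n = t • (A n * T)) (k : ℤ) :
    T * prodModes P A k = (s * t) • (prodModes P A k * T) := by
  rw [prodModes, mul_locSum (hP.locFin_mul hA hPA k), locSum_mul (hP.locFin_mul hA hPA k),
    smul_locSum ((hP.locFin_mul hA hPA k).mul_right T)]
  congr 1
  funext n
  rw [← mul_assoc, hPT, smul_mul_assoc, mul_assoc, hAT, mul_smul_comm, smul_smul, mul_assoc]

end prodModes

theorem φah (m n : ℤ) : H.φ m * H.ah q n = H.ah q n * H.φ m := H.ah_comm q (H.φa m n)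

theorem χah (m n : ℤ) : H.χ m * H.ah q n = H.ah q n * H.χ m := H.ah_comm q (H.χa m n)

/-- In this bracket and the next three the infinite sums have collapsed to single modes. The
relations of the supercurrent with itself are derived from these four brackets, the sign `Γ` and the
action on the vacuum. -/
theorem G_φ (k l : ℤ) : H.G q k * H.φ l + H.φ l * H.G q k =
    H.ah q (k + l + 1) - (Complex.I * q * (k + 1 / 2) * delta (k + l + 1)) • 1 := by
  have h1 := prodModes_anti_fermion H.φ_nil (H.ah_nil q) (H.φah q) H.φφ k l
  have h2 := prodModes_anti_other (Q := H.φ) H.χ_nil H.b_nil H.χb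
    (fun k l => by rw [H.φχ, neg_neg]) H.φb k l
  rw [mul_smul, ← H.φφ k l, ← h1, ← sub_eq_zero, ← h2, G]
  simp only [add_mul, mul_add, sub_mul, mul_sub, smul_mul_assoc, mul_smul_comm]
  module

theorem G_χ (k l : ℤ) : H.G q k * H.χ l + H.χ l * H.G q k = H.b (k + l + 1) := by
  have h1 := prodModes_anti_fermion H.χ_nil H.b_nil H.χb H.χχ k l
  have h2 := prodModes_anti_other (Q := H.χ) H.φ_nil (H.ah_nil q) (H.φah q) H.φχ (H.χah q) k l
  rw [← h1, ← sub_eq_zero, ← h2, G]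
  simp only [add_mul, mul_add, sub_mul, mul_sub, smul_mul_assoc, mul_smul_comm, H.φχ]
  module

theorem G_ah (k m : ℤ) : H.G q k * H.ah q m - H.ah q m * H.G q k = (-(m : ℂ)) • H.φ (k + m) := by
  have h1 := prodModes_comm_boson H.φ_nil (H.ah_nil q) (H.φah q) (H.ah_ah q) k m
  have h2 := prodModes_comm H.χ_nil H.b_nil H.χb (T := H.ah q m)
    (fun n => (H.χah q n m).symm) (fun n => (H.ah_comm q (H.ab m n).symm).symm) k
  rw [← h1, G]
  simp only [add_mul, mul_add, sub_mul, mul_sub, smul_mul_assoc, mul_smul_comm, h2, H.φah]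
  module

theorem G_b (k m : ℤ) : H.G q k * H.b m - H.b m * H.G q k = (-(m : ℂ)) • H.χ (k + m) := by
  have h1 := prodModes_comm_boson H.χ_nil H.b_nil H.χb H.bb k m
  have h2 := prodModes_comm H.φ_nil (H.ah_nil q) (H.φah q) (T := H.b m)
    (fun n => (H.φb n m).symm) (fun n => H.ah_comm q (H.ab n m).symm) k
  rw [← h1, G]
  simp only [add_mul, mul_add, sub_mul, mul_sub, smul_mul_assoc, mul_smul_comm, h2, H.φb]
  module

theorem Γ_G (k : ℤ) : H.Γ * H.G q k = -(H.G q k * H.Γ) := by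
  have h1 := prodModes_anticomm H.φ_nil (H.ah_nil q) (H.φah q) (T := H.Γ) (-1) 1
    (by simp [H.Γφ]) (fun n => by simp [H.ah_comm q (H.Γa n)]) k
  have h2 := prodModes_anticomm H.χ_nil H.b_nil H.χb (T := H.Γ) (-1) 1
    (by simp [H.Γχ]) (by simp [H.Γb]) k
  rw [G, mul_sub, mul_add, h1, h2, mul_smul_comm, H.Γφ]
  simp only [add_mul, sub_mul, smul_mul_assoc]
  module

theorem Δ_G (k : ℤ) : H.Δ * H.G q k = H.G q k * H.Δ := by
  have h1 := prodModes_comm H.φ_nil (H.ah_nil q) (H.φah q) (T := H.Δ) H.Δφ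
    (fun n => H.ah_comm q (H.Δa n)) k
  have h2 := prodModes_anticomm H.χ_nil H.b_nil H.χb (T := H.Δ) (-1) (-1)
    (by simp [H.Δχ]) (by simp [H.Δb]) k
  rw [G, mul_sub, mul_add, h1, h2, mul_smul_comm, H.Δφ]
  simp only [add_mul, sub_mul, smul_mul_assoc]
  module

theorem G_vac {k : ℤ} (hk : -1 ≤ k) : H.G q k H.vac = 0 := by
  have hφ : LocFin fun n => H.φ (k - n) * H.ah q n :=
    H.φ_nil.locFin_mul (H.ah_nil q) (H.φah q) k
  have hχ : LocFin fun n => H.χ (k - n) * H.b n := H.χ_nil.locFin_mul H.b_nil H.χb k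
  have hah {n : ℤ} (hn : 0 < n) : H.ah q n H.vac = 0 := by
    simp [ah, H.a_vac n hn.le, shift, hn.ne', not_lt.mpr hn.le]
  have h2 : prodModes H.χ H.b k H.vac = 0 := by
    refine locSum_apply_eq_zero hχ _ fun n => ?_
    rcases le_or_gt 0 n with hn | hn
    · rw [Module.End.mul_apply, H.b_vac n hn, map_zero]
    · rw [H.χb, Module.End.mul_apply, H.χ_vac _ (by omega), map_zero]
  have h1 : prodModes H.φ (H.ah q) k H.vac = H.φ k (H.ah q 0 H.vac) := by
    rw [prodModes, locSum_apply_eq_single hφ _ 0]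
    · rw [Module.End.mul_apply, sub_zero]
    intro n hn
    rcases lt_or_gt_of_ne hn with hn | hn
    · rw [H.φah, Module.End.mul_apply, H.φ_vac _ (by omega), map_zero]
    · rw [Module.End.mul_apply, hah hn, map_zero]
  rw [G, LinearMap.sub_apply, LinearMap.add_apply, h1, h2]
  rcases (by omega : 0 ≤ k ∨ k = -1) with hk | rfl
  · rw [← Module.End.mul_apply, H.φah, Module.End.mul_apply, LinearMap.smul_apply,
      H.φ_vac k hk]
    simp
  -- For `k = -1` the shift `1 / 2` of the zero mode contributes `-i q / 2` times `φ (-1)` on the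
  -- vacuum, and the derivative term cancels it.
  · simp only [ah, shift, LinearMap.sub_apply, LinearMap.smul_apply, H.a_vac 0 le_rfl,
      Module.End.one_apply, map_sub, map_smul, map_zero]
    norm_num

/-- The Virasoro modes. -/
noncomputable def L (n : ℤ) : Module.End ℂ F :=
  (1 / 2 : ℂ) • (H.G q (n - 1) * H.G q 0 + H.G q 0 * H.G q (n - 1))

/-- Here and in the next three brackets the result depends on `k` and `l` only through `k + l`. This
is why the anticommutator agrees with `2 L (k + l + 1)` up to a scalar, although `L` is defined from
the special modes `n - 1` and `0`. -/
theorem GG_ah (k l m : ℤ) :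
    (H.G q k * H.G q l + H.G q l * H.G q k) * H.ah q m -
      H.ah q m * (H.G q k * H.G q l + H.G q l * H.G q k) =
    (-2 * (m : ℂ)) • H.ah q (k + l + 1 + m) +
      (Complex.I * q * m * (k + l + 1) * delta (k + l + 1 + m)) • 1 := by
  rw [bracket_anti_even (H.G_ah q k m) (H.G_ah q l m)]
  have h1 := H.G_φ q k (l + m)
  have h2 := H.G_φ q l (k + m)
  rw [show k + (l + m) + 1 = k + l + 1 + m by ring] at h1
  rw [show l + (k + m) + 1 = k + l + 1 + m by ring] at h2
  simp only [mul_smul_comm, smul_mul_assoc]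
  rw [← smul_add, ← smul_add, h1, add_comm (H.φ _ * _), h2]
  module

theorem GG_b (k l m : ℤ) :
    (H.G q k * H.G q l + H.G q l * H.G q k) * H.b m -
      H.b m * (H.G q k * H.G q l + H.G q l * H.G q k) =
    (-2 * (m : ℂ)) • H.b (k + l + 1 + m) := by
  rw [bracket_anti_even (H.G_b q k m) (H.G_b q l m)]
  have h1 := H.G_χ q k (l + m)
  have h2 := H.G_χ q l (k + m)
  rw [show k + (l + m) + 1 = k + l + 1 + m by ring] at h1
  rw [show l + (k + m) + 1 = k + l + 1 + m by ring] at h2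
  simp only [mul_smul_comm, smul_mul_assoc]
  rw [← smul_add, ← smul_add, h1, add_comm (H.χ _ * _), h2]
  module

theorem GG_φ (k l m : ℤ) :
    (H.G q k * H.G q l + H.G q l * H.G q k) * H.φ m -
      H.φ m * (H.G q k * H.G q l + H.G q l * H.G q k) =
    (-(2 * m + k + l + 2) : ℂ) • H.φ (k + l + 1 + m) := by
  rw [bracket_anti_odd (H.G_φ q k m) (H.G_φ q l m)]
  have h1 := H.G_ah q k (l + m + 1)
  have h2 := H.G_ah q l (k + m + 1)
  rw [show k + (l + m + 1) = k + l + 1 + m by ring] at h1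
  rw [show l + (k + m + 1) = k + l + 1 + m by ring] at h2
  simp only [mul_sub, sub_mul, mul_smul_comm, smul_mul_assoc, mul_one, one_mul]
  rw [sub_eq_iff_eq_add.mp h1, sub_eq_iff_eq_add.mp h2]
  push_cast
  module

theorem GG_χ (k l m : ℤ) :
    (H.G q k * H.G q l + H.G q l * H.G q k) * H.χ m -
      H.χ m * (H.G q k * H.G q l + H.G q l * H.G q k) =
    (-(2 * m + k + l + 2) : ℂ) • H.χ (k + l + 1 + m) := by
  rw [bracket_anti_odd (H.G_χ q k m) (H.G_χ q l m)]
  have h1 := H.G_b q k (l + m + 1)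
  have h2 := H.G_b q l (k + m + 1)
  rw [show k + (l + m + 1) = k + l + 1 + m by ring] at h1
  rw [show l + (k + m + 1) = k + l + 1 + m by ring] at h2
  rw [h1, h2]
  push_cast
  module

theorem L_ah (n m : ℤ) : H.L q n * H.ah q m - H.ah q m * H.L q n =
    (-(m : ℂ)) • H.ah q (n + m) + (Complex.I * q * m * n / 2 * delta (n + m)) • 1 := by
  have h := H.GG_ah q (n - 1) 0 m
  rw [show n - 1 + 0 + 1 + m = n + m by ring] at h
  rw [L, smul_mul_assoc, mul_smul_comm, ← smul_sub, h]
  push_cast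
  module

theorem L_b (n m : ℤ) : H.L q n * H.b m - H.b m * H.L q n = (-(m : ℂ)) • H.b (n + m) := by
  have h := H.GG_b q (n - 1) 0 m
  rw [show n - 1 + 0 + 1 + m = n + m by ring] at h
  rw [L, smul_mul_assoc, mul_smul_comm, ← smul_sub, h]
  module

theorem L_φ (n m : ℤ) : H.L q n * H.φ m - H.φ m * H.L q n =
    (-(m + 1 / 2 + n / 2) : ℂ) • H.φ (n + m) := by
  have h := H.GG_φ q (n - 1) 0 m
  rw [show n - 1 + 0 + 1 + m = n + m by ring] at h
  rw [L, smul_mul_assoc, mul_smul_comm, ← smul_sub, h]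
  push_cast
  module

theorem L_χ (n m : ℤ) : H.L q n * H.χ m - H.χ m * H.L q n =
    (-(m + 1 / 2 + n / 2) : ℂ) • H.χ (n + m) := by
  have h := H.GG_χ q (n - 1) 0 m
  rw [show n - 1 + 0 + 1 + m = n + m by ring] at h
  rw [L, smul_mul_assoc, mul_smul_comm, ← smul_sub, h]
  push_cast
  module

theorem comm_a_of_comm_ah {X : Module.End ℂ F} {n : ℤ} (h : X * H.ah q n = H.ah q n * X) :
    X * H.a n = H.a n * X := by
  simpa [ah, mul_sub, sub_mul] using h

/-- The anticommutator of two supercurrent modes, up to a scalar. -/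
theorem exists_GG (k l : ℤ) : ∃ t : ℂ, H.G q k * H.G q l + H.G q l * H.G q k =
    (2 : ℂ) • H.L q (k + l + 1) + t • 1 := by
  suffices h : ∃ t : ℂ, H.G q k * H.G q l + H.G q l * H.G q k - (2 : ℂ) • H.L q (k + l + 1) =
      t • 1 by
    obtain ⟨t, ht⟩ := h
    exact ⟨t, by rw [← ht]; abel⟩
  refine H.exists_eq_smul_one (fun m => H.comm_a_of_comm_ah q ?_) (fun m => ?_) (fun m => ?_)
    (fun m => ?_)
  · rw [← sub_eq_zero, sub_mul, mul_sub, sub_sub_sub_comm, GG_ah, smul_mul_assoc, mul_smul_comm,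
      ← smul_sub, L_ah]
    push_cast
    module
  · rw [← sub_eq_zero, sub_mul, mul_sub, sub_sub_sub_comm, GG_b, smul_mul_assoc, mul_smul_comm,
      ← smul_sub, L_b]
    module
  · rw [← sub_eq_zero, sub_mul, mul_sub, sub_sub_sub_comm, GG_φ, smul_mul_assoc, mul_smul_comm,
      ← smul_sub, L_φ]
    push_cast
    module
  · rw [← sub_eq_zero, sub_mul, mul_sub, sub_sub_sub_comm, GG_χ, smul_mul_assoc, mul_smul_comm,
      ← smul_sub, L_χ]
    push_cast
    module

theorem Γ_L (n : ℤ) : H.Γ * H.L q n = H.L q n * H.Γ := by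
  have h (k l : ℤ) : H.Γ * (H.G q k * H.G q l) = H.G q k * H.G q l * H.Γ := by
    rw [← mul_assoc, H.Γ_G, neg_mul, mul_assoc, H.Γ_G, mul_neg, neg_neg, mul_assoc]
  rw [L, mul_smul_comm, mul_add, h, h, ← add_mul, smul_mul_assoc]

theorem L_vac {n : ℤ} (hn : 0 ≤ n) : H.L q n H.vac = 0 := by
  simp [L, Module.End.mul_apply, H.G_vac q (k := n - 1) (by omega), H.G_vac q (k := 0) (by omega)]

theorem L_G (m k : ℤ) : H.L q m * H.G q k - H.G q k * H.L q m =
    ((m : ℂ) / 2 - (k + 1 / 2)) • H.G q (m + k) := by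
  rw [← sub_eq_zero]
  -- The difference of the two sides is odd, so it anticommutes with `Γ`, and no scalar has to be
  -- computed.
  refine H.eq_zero_of_anticommute (-1) (by simp) (fun n => H.comm_a_of_comm_ah q ?_) (fun n => ?_)
    (fun n => ?_) (fun n => ?_) H.Γ H.Γ_vac ?_
  · rw [← sub_eq_zero, sub_mul, mul_sub, sub_sub_sub_comm,
      bracket_comm_comm (H.L_ah q m n) (H.G_ah q k n)]
    have h0 := H.G_ah q (m + k) n
    have h1 := H.L_φ q m (k + n)
    have h2 := H.G_ah q k (m + n)
    rw [show m + (k + n) = m + k + n by ring] at h1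
    rw [show k + (m + n) = m + k + n by ring] at h2
    simp only [mul_add, add_mul, mul_smul_comm, smul_mul_assoc, mul_one, one_mul]
    rw [sub_eq_iff_eq_add.mp h0, sub_eq_iff_eq_add.mp h1, sub_eq_iff_eq_add.mp h2]
    push_cast
    module
  · rw [← sub_eq_zero, sub_mul, mul_sub, sub_sub_sub_comm,
      bracket_comm_comm (H.L_b q m n) (H.G_b q k n)]
    have h0 := H.G_b q (m + k) n
    have h1 := H.L_χ q m (k + n)
    have h2 := H.G_b q k (m + n)
    rw [show m + (k + n) = m + k + n by ring] at h1
    rw [show k + (m + n) = m + k + n by ring] at h2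
    simp only [mul_smul_comm, smul_mul_assoc]
    rw [sub_eq_iff_eq_add.mp h0, sub_eq_iff_eq_add.mp h1, sub_eq_iff_eq_add.mp h2]
    push_cast
    module
  · rw [neg_one_smul, ← sub_eq_zero, sub_neg_eq_add, sub_mul, mul_sub, sub_add_sub_comm,
      bracket_comm_anti (H.L_φ q m n) (H.G_φ q k n)]
    have h0 := H.G_φ q (m + k) n
    have h1 := H.L_ah q m (k + n + 1)
    have h2 := H.G_φ q k (m + n)
    rw [show m + (k + n + 1) = m + k + n + 1 by ring] at h1
    rw [show k + (m + n) + 1 = m + k + n + 1 by ring] at h2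
    simp only [mul_sub, sub_mul, mul_smul_comm, smul_mul_assoc, mul_one, one_mul]
    rw [eq_sub_iff_add_eq.mpr h0, sub_eq_iff_eq_add.mp h1, eq_sub_iff_add_eq.mpr h2]
    rcases delta_cases (m + k + n + 1) with ⟨h, hd⟩ | hd
    · obtain rfl : n = -m - k - 1 := by omega
      rw [hd]
      push_cast
      module
    · rw [hd]
      push_cast
      module
  · rw [neg_one_smul, ← sub_eq_zero, sub_neg_eq_add, sub_mul, mul_sub, sub_add_sub_comm,
      bracket_comm_anti (H.L_χ q m n) (H.G_χ q k n)]
    have h0 := H.G_χ q (m + k) n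
    have h1 := H.L_b q m (k + n + 1)
    have h2 := H.G_χ q k (m + n)
    rw [show m + (k + n + 1) = m + k + n + 1 by ring] at h1
    rw [show k + (m + n) + 1 = m + k + n + 1 by ring] at h2
    simp only [mul_smul_comm, smul_mul_assoc]
    rw [eq_sub_iff_add_eq.mpr h0, sub_eq_iff_eq_add.mp h1, eq_sub_iff_add_eq.mpr h2]
    push_cast
    module
  · rw [mul_sub, mul_sub, ← mul_assoc, ← mul_assoc, Γ_L, Γ_G, mul_assoc, Γ_G, neg_mul, mul_assoc,
      Γ_L, mul_smul_comm, Γ_G]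
    simp only [sub_mul, smul_mul_assoc, mul_neg, neg_sub, smul_neg, mul_assoc]
    abel

end FockSpace

theorem bracket_anticommutator {R : Type*} [Ring R] {T A B X Y : R} (hA : T * A - A * T = X)
    (hB : T * B - B * T = Y) :
    T * (A * B + B * A) - (A * B + B * A) * T = (X * B + B * X) + (A * Y + Y * A) := by
  subst hA hB
  noncomm_ring

theorem locSum_apply_eq_pair {ι M : Type*} [AddCommGroup M] [Module ℂ M]
    {f : ι → Module.End ℂ M} (h : LocFin f) (v : M) {i j : ι} (hij : i ≠ j)
    (hk : ∀ k, k ≠ i → k ≠ j → f k v = 0) : locSum f v = f i v + f j v := by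
  classical
  rw [locSum_apply h, finsum_eq_sum_of_support_subset (s := {i, j}) _ (fun k hkv => ?_),
    Finset.sum_pair hij]
  by_contra hcon
  simp only [Finset.coe_insert, Finset.coe_singleton, Set.mem_insert_iff, Set.mem_singleton_iff,
    not_or] at hcon
  exact hkv (hk k hcon.1 hcon.2)

/-! ### Central terms, the second supercurrent and the `U(1)` current -/

namespace FockSpace

variable {F : Type*} [AddCommGroup F] [Module ℂ F] (H : FockSpace F) (q : ℂ)

include H in
theorem smul_one_inj {s t : ℂ} (h : (s • 1 : Module.End ℂ F) = t • 1) : s = t := by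
  have h1 := LinearMap.congr_fun h H.vac
  simpa [sub_smul, H.vac_ne, sub_eq_zero] using
    (show (s - t) • H.vac = 0 by simpa [sub_smul, sub_eq_zero] using h1)

theorem L_GG (m k l : ℤ) :
    H.L q m * (H.G q k * H.G q l + H.G q l * H.G q k) -
      (H.G q k * H.G q l + H.G q l * H.G q k) * H.L q m =
    ((m : ℂ) / 2 - (k + 1 / 2)) • (H.G q (m + k) * H.G q l + H.G q l * H.G q (m + k)) +
    ((m : ℂ) / 2 - (l + 1 / 2)) • (H.G q k * H.G q (m + l) + H.G q (m + l) * H.G q k) := by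
  rw [bracket_anticommutator (H.L_G q m k) (H.L_G q m l)]
  simp only [smul_mul_assoc, mul_smul_comm, smul_add]

theorem two_L (n : ℤ) :
    (2 : ℂ) • H.L q n = H.G q (n - 1) * H.G q 0 + H.G q 0 * H.G q (n - 1) := by
  rw [L, smul_smul]
  norm_num

/-- The central term of the anticommutator of two supercurrent modes. -/
noncomputable def central (k l : ℤ) : ℂ := (H.exists_GG q k l).choose

theorem GG_central (k l : ℤ) : H.G q k * H.G q l + H.G q l * H.G q k =
    (2 : ℂ) • H.L q (k + l + 1) + H.central q k l • 1 := (H.exists_GG q k l).choose_spec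

theorem central_comm (k l : ℤ) : H.central q k l = H.central q l k := by
  apply H.smul_one_inj
  have h1 := H.GG_central q k l
  rw [add_comm, H.GG_central q l k, add_comm l k] at h1
  exact (add_left_cancel h1).symm

/-- `L` is normalised by the anticommutators with the mode `0`, which has index `1 / 2` and hence no
central term. -/
theorem central_zero (k : ℤ) : H.central q k 0 = 0 := by
  apply H.smul_one_inj
  have h1 := H.GG_central q k 0
  rw [two_L, show k + 0 + 1 - 1 = k by ring] at h1
  rw [zero_smul]
  exact left_eq_add.mp h1

theorem L_zero_L (n : ℤ) : H.L q 0 * H.L q n - H.L q n * H.L q 0 = (-(n : ℂ)) • H.L q n := by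
  have h := H.L_GG q 0 (n - 1) 0
  rw [zero_add, zero_add, ← two_L] at h
  rw [show H.L q n = (1 / 2 : ℂ) • (2 : ℂ) • H.L q n by rw [smul_smul]; norm_num,
    mul_smul_comm, smul_mul_assoc, ← smul_sub, h]
  push_cast
  module

/-- Commuting the relation with `L 0` multiplies the operators by `-(k + l + 1)` but kills the
scalar. -/
theorem central_eq_zero {k l : ℤ} (h : k + l + 1 ≠ 0) : H.central q k l = 0 := by
  have h1 := H.L_GG q 0 k l
  rw [zero_add, zero_add, GG_central, mul_add, add_mul, mul_smul_comm, smul_mul_assoc,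
    add_sub_add_comm, ← smul_sub, L_zero_L, mul_smul_comm, smul_mul_assoc, one_mul, mul_one,
    sub_self] at h1
  have h2 : ((k + l + 1 : ℤ) * H.central q k l : ℂ) • (1 : Module.End ℂ F) = (0 : ℂ) • 1 := by
    rw [← sub_eq_zero] at h1
    rw [zero_smul, ← h1]
    push_cast
    module
  have h3 := H.smul_one_inj h2
  exact (mul_eq_zero.mp h3).resolve_left (by exact_mod_cast h)

/-- The commutator of `L 1` and `2 L (-1)` can be computed from `{G k, G (-2 - k)}` for any `k`, and
the answer cannot depend on `k`. For `k = -1` both central terms vanish. -/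
theorem central_recursion (k : ℤ) : (k : ℂ) * H.central q (k + 1) (-1 - (k + 1)) =
    (k + 2) * H.central q k (-1 - k) := by
  have key (k : ℤ) : H.L q 1 * ((2 : ℂ) • H.L q (-1)) - ((2 : ℂ) • H.L q (-1)) * H.L q 1 =
      (4 : ℂ) • H.L q 0 +
        (-k * H.central q (k + 1) (-1 - (k + 1)) + (k + 2) * H.central q k (-1 - k)) • 1 := by
    have h := H.L_GG q 1 k (-2 - k)
    rw [GG_central, GG_central, GG_central, H.central_eq_zero q (by omega : k + (-2 - k) + 1 ≠ 0),
      zero_smul, add_zero, show k + (-2 - k) + 1 = -1 by ring,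
      show 1 + k + (-2 - k) + 1 = 0 by ring, show k + (1 + (-2 - k)) + 1 = 0 by ring,
      show 1 + (-2 - k) = -1 - k by ring, show -2 - k = -1 - (k + 1) by ring, add_comm 1 k] at h
    rw [h]
    push_cast
    module
  have h := (key k).symm.trans (key (-1))
  have h0 : H.central q (-1) (-1 - -1) = 0 := by
    rw [show (-1 - -1 : ℤ) = 0 by norm_num, central_zero]
  have h0' : H.central q (-1 + 1) (-1 - (-1 + 1)) = 0 := by
    rw [show (-1 + 1 : ℤ) = 0 by norm_num, show (-1 - 0 : ℤ) = -1 by norm_num, central_comm,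
      central_zero]
  have h1 := H.smul_one_inj (add_left_cancel h)
  rw [h0, h0'] at h1
  linear_combination -h1

theorem ah_vac {n : ℤ} (hn : 0 < n) : H.ah q n H.vac = 0 := by
  simp [ah, H.a_vac n hn.le, shift, hn.ne', not_lt.mpr hn.le]

theorem ah_zero_vac : H.ah q 0 H.vac = -(Complex.I * q / 2) • H.vac := by
  simp only [ah, LinearMap.sub_apply, H.a_vac 0 le_rfl, shift, LinearMap.smul_apply,
    Module.End.one_apply]
  norm_num
  module

theorem G_neg_two_vac : H.G q (-2) H.vac =
    H.φ (-1) (H.ah q (-1) H.vac) + H.χ (-1) (H.b (-1) H.vac) +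
      (Complex.I * q) • H.φ (-2) H.vac := by
  have hφ : LocFin fun n => H.φ (-2 - n) * H.ah q n :=
    H.φ_nil.locFin_mul (H.ah_nil q) (H.φah q) (-2)
  have hχ : LocFin fun n => H.χ (-2 - n) * H.b n := H.χ_nil.locFin_mul H.b_nil H.χb (-2)
  have h2 : prodModes H.χ H.b (-2) H.vac = H.χ (-1) (H.b (-1) H.vac) := by
    rw [prodModes, locSum_apply_eq_single hχ _ (-1)]
    · rfl
    intro n hn
    rcases le_or_gt 0 n with h | h
    · rw [Module.End.mul_apply, H.b_vac n h, map_zero]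
    · rw [H.χb, Module.End.mul_apply, H.χ_vac _ (by omega), map_zero]
  have h1 : prodModes H.φ (H.ah q) (-2) H.vac =
      H.φ (-1) (H.ah q (-1) H.vac) + H.φ (-2) (H.ah q 0 H.vac) := by
    rw [prodModes, locSum_apply_eq_pair hφ _ (show (-1 : ℤ) ≠ 0 by norm_num)]
    · rfl
    intro n hn hn'
    rcases lt_or_gt_of_ne hn' with h | h
    · rw [H.φah, Module.End.mul_apply, H.φ_vac _ (by omega), map_zero]
    · rw [Module.End.mul_apply, H.ah_vac q h, map_zero]
  rw [G, LinearMap.sub_apply, LinearMap.add_apply, h1, h2, LinearMap.smul_apply, ah_zero_vac,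
    map_smul]
  push_cast
  module

/-- The vacuum value of `{G 1, G (-2)}`: the terms `φ a` and `χ b` contribute `1` each, the
derivative term contributes `(i q) (-2 i q) = 2 q²`, and `L 0` kills the vacuum. -/
theorem central_one : H.central q 1 (-1 - 1) = 2 * (1 + q ^ 2) := by
  have hI := Complex.I_sq
  have h := LinearMap.congr_fun (H.GG_central q 1 (-2)) H.vac
  simp only [LinearMap.add_apply, Module.End.mul_apply, H.G_vac q (k := 1) (by norm_num), map_zero,
    add_zero, LinearMap.smul_apply, Module.End.one_apply] at h
  have e1 := LinearMap.congr_fun (H.G_φ q 1 (-1)) (H.ah q (-1) H.vac)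
  have e2 := LinearMap.congr_fun (H.G_ah q 1 (-1)) H.vac
  have e3 := LinearMap.congr_fun (H.G_χ q 1 (-1)) (H.b (-1) H.vac)
  have e4 := LinearMap.congr_fun (H.G_b q 1 (-1)) H.vac
  have e5 := LinearMap.congr_fun (H.G_φ q 1 (-2)) H.vac
  have e6 := LinearMap.congr_fun (H.ah_ah q 1 (-1)) H.vac
  have e7 := LinearMap.congr_fun (H.bb 1 (-1)) H.vac
  norm_num [delta, Module.End.mul_apply, H.G_vac q (k := 1) (by norm_num), H.φ_vac 0 le_rfl,
    H.χ_vac 0 le_rfl, H.ah_vac q one_pos, H.b_vac 1 one_pos.le, ah_zero_vac,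
    H.L_vac q le_rfl] at h e1 e2 e3 e4 e5 e6 e7
  rw [e2, map_zero, add_zero, e6] at e1
  rw [e4, map_zero, add_zero, e7] at e3
  rw [G_neg_two_vac, map_add, map_add, e1, e3, map_smul, e5] at h
  have h' : (H.central q 1 (-2) - 2 * (1 + q ^ 2)) • H.vac = 0 := by
    rw [sub_smul, ← h]
    match_scalars
    linear_combination (-2 * q ^ 2) * hI
  have := (smul_eq_zero.mp h').resolve_right H.vac_ne
  rw [show (-1 - 1 : ℤ) = -2 by norm_num]
  exact sub_eq_zero.mp this

theorem central_eq (k : ℤ) : H.central q k (-1 - k) = (k ^ 2 + k) * (1 + q ^ 2) := by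
  have hnat (n : ℕ) : H.central q n (-1 - n) = (n ^ 2 + n) * (1 + q ^ 2) := by
    induction n with
    | zero =>
      rw [show (-1 - ((0 : ℕ) : ℤ)) = -1 by norm_num, central_comm]
      simp [central_zero]
    | succ n ih =>
      -- The recursion at `0` says nothing about the index `1`, which is why that value was computed
      -- directly.
      rcases Nat.eq_zero_or_pos n with rfl | hn
      · have := H.central_one q
        norm_num at this ⊢
        exact this
      · have h := H.central_recursion q n
        rw [ih] at h
        have hn' : ((n : ℤ) : ℂ) ≠ 0 := by exact_mod_cast hn.ne'
        apply mul_left_cancel₀ hn'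
        push_cast at h ⊢
        rw [h]
        ring
  rcases Int.le_total 0 k with hk | hk
  · lift k to ℕ using hk
    exact_mod_cast hnat k
  · rcases eq_or_lt_of_le hk with rfl | hk
    · simpa using hnat 0
    -- The symmetry of the central term exchanges `k` and `-1 - k`, and `k ^ 2 + k` is invariant
    -- under it.
    · obtain ⟨n, hn⟩ : ∃ n : ℕ, -1 - k = n := ⟨(-1 - k).toNat, by omega⟩
      have hk' : k = -1 - n := by omega
      have := hnat n
      rw [central_comm, hn, hk', this]
      push_cast
      ring

/-- The anticommutator of two supercurrent modes. -/
theorem G_G (k l : ℤ) : H.G q k * H.G q l + H.G q l * H.G q k =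
    (2 : ℂ) • H.L q (k + l + 1) + ((k ^ 2 + k) * (1 + q ^ 2) * delta (k + l + 1)) • 1 := by
  rw [GG_central]
  rcases delta_cases (k + l + 1) with ⟨h, h'⟩ | h'
  · obtain rfl : l = -1 - k := by omega
    rw [h', central_eq, mul_one]
  · have : k + l + 1 ≠ 0 := fun h => by simp [delta, h] at h'
    rw [h', H.central_eq_zero q this, mul_zero]

theorem L_L (m n : ℤ) : H.L q m * H.L q n - H.L q n * H.L q m =
    ((m : ℂ) - n) • H.L q (m + n) +
      (((m : ℂ) ^ 3 - m) / 12 * (3 * (1 + q ^ 2)) * delta (m + n)) • 1 := by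
  have h := H.L_GG q m (n - 1) 0
  rw [G_G, G_G, G_G, show n - 1 + 0 + 1 = n by ring, show m + (n - 1) + 0 + 1 = m + n by ring,
    show n - 1 + (m + 0) + 1 = m + n by ring] at h
  simp only [mul_add (H.L q m), add_mul _ _ (H.L q m), mul_smul_comm, smul_mul_assoc, mul_one,
    one_mul, add_sub_add_right_eq_sub, ← smul_sub] at h
  rw [show H.L q m * H.L q n - H.L q n * H.L q m =
    (1 / 2 : ℂ) • (2 : ℂ) • (H.L q m * H.L q n - H.L q n * H.L q m) by
      rw [smul_smul]; norm_num, h]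
  rcases delta_cases (m + n) with ⟨h', h''⟩ | h'
  · obtain rfl : n = -m := by omega
    rw [h'']
    push_cast
    module
  · rw [h']
    push_cast
    module

/-- The modes of the second supercurrent. -/
noncomputable def G' (k : ℤ) : Module.End ℂ F := H.rot.G q k

theorem G'_φ (k l : ℤ) : H.G' q k * H.φ l + H.φ l * H.G' q k = -H.b (k + l + 1) := by
  have h : H.G' q k * -H.φ l + -H.φ l * H.G' q k = H.b (k + l + 1) := H.rot.G_χ q k l
  rw [← h, mul_neg, neg_mul, neg_add, neg_neg, neg_neg]

theorem G'_χ (k l : ℤ) : H.G' q k * H.χ l + H.χ l * H.G' q k =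
    H.ah q (k + l + 1) - (Complex.I * q * (k + 1 / 2) * delta (k + l + 1)) • 1 :=
  H.rot.G_φ q k l

theorem G'_ah (k m : ℤ) : H.G' q k * H.ah q m - H.ah q m * H.G' q k =
    (-(m : ℂ)) • H.χ (k + m) := H.rot.G_ah q k m

theorem G'_b (k m : ℤ) : H.G' q k * H.b m - H.b m * H.G' q k = (m : ℂ) • H.φ (k + m) := by
  have h : H.G' q k * H.b m - H.b m * H.G' q k = (-(m : ℂ)) • (-H.φ (k + m)) := H.rot.G_b q k m
  rw [h, smul_neg, neg_smul, neg_neg]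

/-- Both supercurrents square to the same Virasoro modes: the two operators have the same brackets
with all free modes, and the remaining scalar vanishes. Every relation of `G` with `L` thereby
carries over to `G'`. -/
theorem rot_L (n : ℤ) : H.rot.L q n = H.L q n := by
  have hex (n : ℤ) : ∃ t : ℂ, H.rot.L q n - H.L q n = t • 1 := by
    have h1 (m : ℤ) : H.rot.L q n * H.ah q m - H.ah q m * H.rot.L q n = _ := H.rot.L_ah q n m
    have h2 (m : ℤ) : H.rot.L q n * H.b m - H.b m * H.rot.L q n = _ := H.rot.L_b q n m
    have h3 (m : ℤ) : H.rot.L q n * H.χ m - H.χ m * H.rot.L q n = _ := H.rot.L_φ q n m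
    have h4 (m : ℤ) : H.rot.L q n * -H.φ m - -H.φ m * H.rot.L q n = _ := H.rot.L_χ q n m
    refine H.exists_eq_smul_one (fun m => H.comm_a_of_comm_ah q ?_) (fun m => ?_) (fun m => ?_)
      (fun m => ?_) <;> rw [← sub_eq_zero, sub_mul, mul_sub, sub_sub_sub_comm]
    · rw [h1, L_ah]
      exact sub_self _
    · rw [h2, L_b]
      exact sub_self _
    · have h4' : H.rot.L q n * H.φ m - H.φ m * H.rot.L q n =
          (-(m + 1 / 2 + n / 2) : ℂ) • H.φ (n + m) := by
        have h5 : H.rot.L q n * -H.φ m - -H.φ m * H.rot.L q n =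
          (-(m + 1 / 2 + n / 2) : ℂ) • (-H.φ (n + m)) := h4 m
        rw [mul_neg, neg_mul, ← neg_sub', smul_neg] at h5
        exact neg_injective h5
      rw [h4', L_φ, sub_self]
    · rw [h3, L_χ]
      exact sub_self _
  obtain ⟨t, ht⟩ := hex n
  have ht' := eq_add_of_sub_eq ht
  suffices t = 0 by rw [ht', this, zero_smul, zero_add]
  rcases eq_or_ne n 0 with rfl | hn
  · have h1 := LinearMap.congr_fun ht H.vac
    have h2 : H.rot.L q 0 H.vac = 0 := H.rot.L_vac q le_rfl
    rw [LinearMap.sub_apply, h2, H.L_vac q le_rfl] at h1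
    simpa [H.vac_ne] using h1.symm
  -- Scalars drop out of the commutator with `L 0` but not out of the right-hand side, hence `n t =
  -- 0`.
  · obtain ⟨s, hs⟩ := hex 0
    have h1 := H.rot.L_zero_L q n
    rw [ht', eq_add_of_sub_eq hs] at h1
    have h2 := H.L_zero_L q n
    have h3 : ((n : ℂ) * t) • (1 : Module.End ℂ F) = (0 : ℂ) • 1 := by
      simp only [add_mul, mul_add, smul_mul_assoc, mul_smul_comm, one_mul, mul_one] at h1
      rw [← sub_eq_zero] at h1 h2
      linear_combination (norm := module) h1 - h2
    exact (mul_eq_zero.mp (H.smul_one_inj h3)).resolve_left (by exact_mod_cast hn)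

theorem G'_G' (k l : ℤ) : H.G' q k * H.G' q l + H.G' q l * H.G' q k =
    (2 : ℂ) • H.L q (k + l + 1) + ((k ^ 2 + k) * (1 + q ^ 2) * delta (k + l + 1)) • 1 := by
  rw [← rot_L]
  exact H.rot.G_G q k l

theorem L_G' (m k : ℤ) : H.L q m * H.G' q k - H.G' q k * H.L q m =
    ((m : ℂ) / 2 - (k + 1 / 2)) • H.G' q (m + k) := by
  rw [← rot_L]
  exact H.rot.L_G q m k

/-- The modes of the `U(1)` current. -/
noncomputable def J (n : ℤ) : Module.End ℂ F :=
  (-Complex.I) • (locSum fun l => H.φ (n - 1 - l) * H.χ l) + q • H.b n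

theorem locFin_φχ (n : ℤ) : LocFin fun l => H.φ (n - 1 - l) * H.χ l :=
  H.φ_nil.locFin_mul_anti H.χ_nil H.φχ (n - 1)

theorem J_φ (n t : ℤ) : H.J q n * H.φ t - H.φ t * H.J q n = Complex.I • H.χ (n + t) := by
  have key (l : ℤ) : H.φ (n - 1 - l) * H.χ l * H.φ t + (-1 : ℂ) • (H.φ t *
      (H.φ (n - 1 - l) * H.χ l)) = (-delta (n - l + t)) • H.χ l := by
    have h1 := H.φφ (n - 1 - l) t
    rw [show n - 1 - l + t + 1 = n - l + t by ring] at h1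
    have h2 : H.χ l * H.φ t = -(H.φ t * H.χ l) := by rw [H.φχ, neg_neg]
    rw [mul_assoc, h2, neg_one_smul, neg_smul, ← smul_one_mul (delta _), ← h1, add_mul, mul_neg,
      mul_assoc, mul_assoc, neg_add]
  have h := locSum_bracket (H.locFin_φχ n) (H.φ t) (-1) (n + t) fun l hl => by
    rw [key, delta, if_neg (by omega), neg_zero, zero_smul]
  rw [key, delta, if_pos (by omega), neg_one_smul, ← sub_eq_add_neg] at h
  rw [J, add_mul, mul_add, smul_mul_assoc, smul_mul_assoc, mul_smul_comm, mul_smul_comm, H.φb,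
    add_sub_add_right_eq_sub, ← smul_sub, h]
  module

theorem J_χ (n t : ℤ) : H.J q n * H.χ t - H.χ t * H.J q n = (-Complex.I) • H.φ (n + t) := by
  have key (l : ℤ) : H.φ (n - 1 - l) * H.χ l * H.χ t + (-1 : ℂ) • (H.χ t *
      (H.φ (n - 1 - l) * H.χ l)) = delta (l + t + 1) • H.φ (n - 1 - l) := by
    have h2 : H.χ t * H.φ (n - 1 - l) = -(H.φ (n - 1 - l) * H.χ t) := by rw [H.φχ, neg_neg]
    rw [← mul_assoc (H.χ t), h2, neg_mul, smul_neg, neg_one_smul, neg_neg, mul_assoc, mul_assoc,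
      ← mul_add, H.χχ, mul_smul_comm, mul_one]
  have h := locSum_bracket (H.locFin_φχ n) (H.χ t) (-1) (-t - 1) fun l hl => by
    rw [key, delta, if_neg (by omega), zero_smul]
  rw [key, delta, if_pos (by omega), neg_one_smul, ← sub_eq_add_neg,
    show n - 1 - (-t - 1) = n + t by ring] at h
  rw [J, add_mul, mul_add, smul_mul_assoc, smul_mul_assoc, mul_smul_comm, mul_smul_comm, H.χb,
    add_sub_add_right_eq_sub, ← smul_sub, h]
  module

theorem comm_locSum_φχ {T : Module.End ℂ F} {s t : ℂ} (hφ : ∀ k, T * H.φ k = s • (H.φ k * T))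
    (hχ : ∀ k, T * H.χ k = t • (H.χ k * T)) (n : ℤ) :
    T * (locSum fun l => H.φ (n - 1 - l) * H.χ l) =
      (s * t) • ((locSum fun l => H.φ (n - 1 - l) * H.χ l) * T) := by
  rw [mul_locSum (H.locFin_φχ n), locSum_mul (H.locFin_φχ n),
    smul_locSum ((H.locFin_φχ n).mul_right T)]
  congr 1
  funext n
  rw [← mul_assoc, hφ, smul_mul_assoc, mul_assoc, hχ, mul_smul_comm, smul_smul, mul_assoc]

theorem J_ah (n m : ℤ) : H.J q n * H.ah q m - H.ah q m * H.J q n = 0 := by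
  have h := H.comm_locSum_φχ (T := H.ah q m) (s := 1) (t := 1)
    (fun k => by rw [one_smul, H.φah]) (fun k => by rw [one_smul, H.χah]) n
  rw [mul_one, one_smul] at h
  rw [J, add_mul, mul_add, smul_mul_assoc, smul_mul_assoc, mul_smul_comm, mul_smul_comm, h,
    H.ah_comm q (H.ab m n).symm, sub_self]

theorem J_b (n m : ℤ) : H.J q n * H.b m - H.b m * H.J q n =
    (q * n * delta (n + m)) • 1 := by
  have h := H.comm_locSum_φχ (T := H.b m) (s := 1) (t := 1)
    (fun k => by rw [one_smul, H.φb]) (fun k => by rw [one_smul, H.χb]) n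
  rw [mul_one, one_smul] at h
  rw [J, add_mul, mul_add, smul_mul_assoc, smul_mul_assoc, mul_smul_comm, mul_smul_comm, h,
    add_sub_add_left_eq_sub, ← smul_sub, H.bb, smul_smul, mul_assoc]

theorem Γ_J (n : ℤ) : H.Γ * H.J q n = H.J q n * H.Γ := by
  have h := H.comm_locSum_φχ (T := H.Γ) (s := -1) (t := -1)
    (by simp [H.Γφ]) (by simp [H.Γχ]) n
  rw [neg_one_mul, neg_neg, one_smul] at h
  rw [J, mul_add, add_mul, mul_smul_comm, mul_smul_comm, h, H.Γb, smul_mul_assoc, smul_mul_assoc]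

theorem Δ_J (n : ℤ) : H.Δ * H.J q n = -(H.J q n * H.Δ) := by
  have h := H.comm_locSum_φχ (T := H.Δ) (s := 1) (t := -1)
    (by simp [H.Δφ]) (by simp [H.Δχ]) n
  rw [one_mul, neg_one_smul] at h
  rw [J, mul_add, add_mul, mul_smul_comm, mul_smul_comm, h, H.Δb, smul_mul_assoc, smul_mul_assoc,
    smul_neg, smul_neg, neg_add]

theorem J_vac {n : ℤ} (hn : 0 ≤ n) : H.J q n H.vac = 0 := by
  have h : (locSum fun l => H.φ (n - 1 - l) * H.χ l) H.vac = 0 := by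
    refine locSum_apply_eq_zero (H.locFin_φχ n) _ fun l => ?_
    rcases le_or_gt 0 l with hl | hl
    · rw [Module.End.mul_apply, H.χ_vac l hl, map_zero]
    · rw [H.φχ, LinearMap.neg_apply, Module.End.mul_apply, H.φ_vac _ (by omega), map_zero,
        neg_zero]
  simp [J, h, H.b_vac n hn]

theorem Γ_G' (k : ℤ) : H.Γ * H.G' q k = -(H.G' q k * H.Γ) := H.rot.Γ_G q k

theorem Δ_G' (k : ℤ) : H.Δ * H.G' q k = -(H.G' q k * H.Δ) := by
  have h1 := prodModes_anticomm H.χ_nil (H.ah_nil q) (H.χah q) (T := H.Δ) (-1) 1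
    (by simp [H.Δχ]) (fun n => by simp [H.ah_comm q (H.Δa n)]) k
  have h2 := prodModes_anticomm H.rot.χ_nil H.b_nil H.rot.χb (T := H.Δ) 1 (-1)
    (by simp [rot, H.Δφ]) (by simp [H.Δb]) k
  have h : H.G' q k = prodModes H.χ (H.ah q) k + prodModes H.rot.χ H.b k -
    (Complex.I * q * (k + 1 / 2)) • H.χ k := rfl
  rw [h, mul_sub, mul_add, h1, h2, mul_smul_comm, H.Δχ]
  simp only [add_mul, sub_mul, smul_mul_assoc]
  module

theorem J_G (n k : ℤ) : H.J q n * H.G q k - H.G q k * H.J q n =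
    Complex.I • H.G' q (k + n) := by
  rw [← sub_eq_zero]
  refine H.eq_zero_of_anticommute (-1) (by simp) (fun m => H.comm_a_of_comm_ah q ?_) (fun m => ?_)
    (fun m => ?_) (fun m => ?_) H.Γ H.Γ_vac ?_
  · rw [← sub_eq_zero, sub_mul, mul_sub, sub_sub_sub_comm,
      bracket_comm_comm (H.J_ah q n m) (H.G_ah q k m)]
    have h0 := H.G'_ah q (k + n) m
    have h1 := H.J_φ q n (k + m)
    rw [show n + (k + m) = k + n + m by ring] at h1
    simp only [mul_smul_comm, smul_mul_assoc, mul_zero, zero_mul]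
    rw [sub_eq_iff_eq_add.mp h0, sub_eq_iff_eq_add.mp h1]
    module
  · rw [← sub_eq_zero, sub_mul, mul_sub, sub_sub_sub_comm,
      bracket_comm_comm (H.J_b q n m) (H.G_b q k m)]
    have h0 := H.G'_b q (k + n) m
    have h1 := H.J_χ q n (k + m)
    rw [show n + (k + m) = k + n + m by ring] at h1
    simp only [mul_smul_comm, smul_mul_assoc, mul_one, one_mul]
    rw [sub_eq_iff_eq_add.mp h0, sub_eq_iff_eq_add.mp h1]
    module
  · rw [neg_one_smul, ← sub_eq_zero, sub_neg_eq_add, sub_mul, mul_sub, sub_add_sub_comm,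
      bracket_comm_anti (H.J_φ q n m) (H.G_φ q k m)]
    have h0 := H.G'_φ q (k + n) m
    have h1 := H.J_ah q n (k + m + 1)
    have h2 := H.G_χ q k (n + m)
    rw [show k + (n + m) + 1 = k + n + m + 1 by ring] at h2
    simp only [mul_sub, sub_mul, mul_smul_comm, smul_mul_assoc, mul_one, one_mul]
    rw [eq_sub_iff_add_eq.mpr h0, sub_eq_iff_eq_add.mp h1, eq_sub_iff_add_eq.mpr h2]
    module
  · rw [neg_one_smul, ← sub_eq_zero, sub_neg_eq_add, sub_mul, mul_sub, sub_add_sub_comm,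
      bracket_comm_anti (H.J_χ q n m) (H.G_χ q k m)]
    have h0 := H.G'_χ q (k + n) m
    have h1 := H.J_b q n (k + m + 1)
    have h2 := H.G_φ q k (n + m)
    rw [show k + (n + m) + 1 = k + n + m + 1 by ring] at h2
    rw [show n + (k + m + 1) = k + n + m + 1 by ring] at h1
    simp only [mul_smul_comm, smul_mul_assoc]
    rw [eq_sub_iff_add_eq.mpr h0, sub_eq_iff_eq_add.mp h1, eq_sub_iff_add_eq.mpr h2]
    push_cast
    match_scalars <;> ring_nf
    simp
  · rw [mul_sub, mul_sub, ← mul_assoc, ← mul_assoc, Γ_J, Γ_G, mul_assoc, Γ_G, neg_mul, mul_assoc,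
      Γ_J, mul_smul_comm, Γ_G']
    simp only [sub_mul, smul_mul_assoc, mul_neg, neg_sub, smul_neg, mul_assoc]
    abel

/-- Two quarter turns change the sign of both fermions, and the supercurrent is linear in them. -/
theorem rot_rot_G (k : ℤ) : H.rot.rot.G q k = -H.G q k := by
  have key {P A : ℤ → Module.End ℂ F} (hP : LocNil P) (hA : LocNil A)
      (hPA : ∀ m n, P m * A n = A n * P m) :
      prodModes (fun k => -P k) A k = (-1 : ℂ) • prodModes P A k := by
    rw [prodModes, prodModes, smul_locSum (hP.locFin_mul hA hPA k)]
    simp only [neg_mul, neg_one_smul]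
  have h : H.rot.rot.G q k = prodModes (fun k => -H.φ k) (H.ah q) k +
    prodModes (fun k => -H.χ k) H.b k - (Complex.I * q * (k + 1 / 2)) • -H.φ k := rfl
  rw [h, key H.φ_nil (H.ah_nil q) (H.φah q), key H.χ_nil H.b_nil H.χb, G]
  module

/-- This is `J_G` on the rotated Fock space. The rotated current differs from `J` by a scalar only,
which does not matter in a commutator. -/
theorem J_G' (n k : ℤ) : H.J q n * H.G' q k - H.G' q k * H.J q n =
    (-Complex.I) • H.G q (k + n) := by
  obtain ⟨t, ht⟩ : ∃ t : ℂ, H.rot.J q n - H.J q n = t • 1 := by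
    have h1 (m : ℤ) : H.rot.J q n * H.ah q m - H.ah q m * H.rot.J q n = 0 := H.rot.J_ah q n m
    have h2 (m : ℤ) : H.rot.J q n * H.b m - H.b m * H.rot.J q n = _ := H.rot.J_b q n m
    have h3 (m : ℤ) : H.rot.J q n * H.χ m - H.χ m * H.rot.J q n =
        Complex.I • (-H.φ (n + m)) := H.rot.J_φ q n m
    have h4 (m : ℤ) : H.rot.J q n * -H.φ m - -H.φ m * H.rot.J q n =
        (-Complex.I) • H.χ (n + m) := H.rot.J_χ q n m
    refine H.exists_eq_smul_one (fun m => H.comm_a_of_comm_ah q ?_) (fun m => ?_) (fun m => ?_)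
      (fun m => ?_) <;> rw [← sub_eq_zero, sub_mul, mul_sub, sub_sub_sub_comm]
    · rw [h1, J_ah, sub_zero]
    · rw [h2, J_b]
      exact sub_self _
    · have h5 := h4 m
      rw [mul_neg, neg_mul, ← neg_sub', neg_smul] at h5
      rw [neg_injective h5, J_φ, sub_self]
    · rw [h3, J_χ, smul_neg, neg_smul, sub_self]
  have h := H.rot.J_G q n k
  rw [eq_add_of_sub_eq ht] at h
  have h' : (t • 1 + H.J q n) * H.G' q k - H.G' q k * (t • 1 + H.J q n) =
      Complex.I • (H.rot.rot.G q (k + n)) := h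
  rw [rot_rot_G, add_mul, mul_add, smul_one_mul, mul_smul_one, add_sub_add_left_eq_sub,
    smul_neg] at h'
  rw [h', neg_smul]

theorem G_G' (k l : ℤ) : H.G q k * H.G' q l + H.G' q l * H.G q k =
    (Complex.I * ((k : ℂ) - l)) • H.J q (k + l + 1) := by
  rw [← sub_eq_zero]
  -- The difference is even, so `Γ` gives nothing. Under `Δ` the first supercurrent is even, while
  -- the second and `J` are odd, so the difference anticommutes with `Δ`.
  refine H.eq_zero_of_anticommute 1 (by simp) (fun m => H.comm_a_of_comm_ah q ?_) (fun m => ?_)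
    (fun m => ?_) (fun m => ?_) H.Δ H.Δ_vac ?_
  · rw [← sub_eq_zero, sub_mul _ _ (H.ah q m), mul_sub (H.ah q m),
      sub_sub_sub_comm,
      bracket_anti_even (H.G_ah q k m) (H.G'_ah q l m)]
    have h0 := H.J_ah q (k + l + 1) m
    have h1 := H.G_χ q k (l + m)
    have h2 := H.G'_φ q l (k + m)
    rw [show k + (l + m) + 1 = k + l + m + 1 by ring] at h1
    rw [show l + (k + m) + 1 = k + l + m + 1 by ring] at h2
    simp only [mul_smul_comm, smul_mul_assoc]
    rw [sub_eq_iff_eq_add.mp h0, eq_sub_iff_add_eq.mpr h1, eq_sub_iff_add_eq.mpr h2]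
    module
  · rw [← sub_eq_zero, sub_mul _ _ (H.b m), mul_sub (H.b m),
      sub_sub_sub_comm,
      bracket_anti_even (H.G_b q k m) (H.G'_b q l m)]
    have h0 := H.J_b q (k + l + 1) m
    have h1 := H.G_φ q k (l + m)
    have h2 := H.G'_χ q l (k + m)
    rw [show k + (l + m) + 1 = k + l + 1 + m by ring] at h1
    rw [show l + (k + m) + 1 = k + l + 1 + m by ring] at h2
    simp only [mul_smul_comm, smul_mul_assoc]
    rw [sub_eq_iff_eq_add.mp h0, eq_sub_iff_add_eq.mpr h1, eq_sub_iff_add_eq.mpr h2]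
    rcases delta_cases (k + l + 1 + m) with ⟨h, hd⟩ | hd
    · obtain rfl : m = -k - l - 1 := by omega
      rw [hd]
      push_cast
      module
    · rw [hd]
      module
  · rw [one_smul, ← sub_eq_zero, sub_mul _ _ (H.φ m), mul_sub (H.φ m),
      sub_sub_sub_comm,
      bracket_anti_odd (H.G_φ q k m) (H.G'_φ q l m)]
    have h0 := H.J_φ q (k + l + 1) m
    have h1 := H.G_b q k (l + m + 1)
    have h2 := H.G'_ah q l (k + m + 1)
    rw [show k + (l + m + 1) = k + l + 1 + m by ring] at h1
    rw [show l + (k + m + 1) = k + l + 1 + m by ring] at h2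
    simp only [mul_sub, sub_mul, mul_smul_comm, smul_mul_assoc, mul_one, one_mul, mul_neg, neg_mul]
    rw [sub_eq_iff_eq_add.mp h0, sub_eq_iff_eq_add.mp h1, sub_eq_iff_eq_add.mp h2]
    push_cast
    match_scalars <;> ring_nf
    simp
  · rw [one_smul, ← sub_eq_zero, sub_mul _ _ (H.χ m), mul_sub (H.χ m),
      sub_sub_sub_comm,
      bracket_anti_odd (H.G_χ q k m) (H.G'_χ q l m)]
    have h0 := H.J_χ q (k + l + 1) m
    have h1 := H.G_ah q k (l + m + 1)
    have h2 := H.G'_b q l (k + m + 1)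
    rw [show k + (l + m + 1) = k + l + 1 + m by ring] at h1
    rw [show l + (k + m + 1) = k + l + 1 + m by ring] at h2
    simp only [mul_sub, sub_mul, mul_smul_comm, smul_mul_assoc, mul_one, one_mul]
    rw [sub_eq_iff_eq_add.mp h0, sub_eq_iff_eq_add.mp h1, sub_eq_iff_eq_add.mp h2]
    push_cast
    match_scalars <;> ring_nf
    simp
  · have h1 : H.Δ * (H.G q k * H.G' q l) = -(H.G q k * H.G' q l * H.Δ) := by
      rw [← mul_assoc, Δ_G, mul_assoc, Δ_G', mul_neg, mul_assoc]
    have h2 : H.Δ * (H.G' q l * H.G q k) = -(H.G' q l * H.G q k * H.Δ) := by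
      rw [← mul_assoc, Δ_G', neg_mul, mul_assoc, Δ_G, mul_assoc]
    rw [mul_sub, mul_add, h1, h2, mul_smul_comm, Δ_J]
    simp only [sub_mul, add_mul, smul_mul_assoc, smul_neg]
    abel

end FockSpace

open N2 (delta delta_cases brGen Gen IsAction IsVacuum Mono piece core_add_right core_smul_right
  core_zero_left core_zero_right)

/-! ### The action of the whole algebra on the Fock space -/

namespace FockSpace

variable {F : Type*} [AddCommGroup F] [Module ℂ F] (H : FockSpace F) (q : ℂ)

/-- A consequence of the Jacobi identity, since `J n` occurs in the anticommutator of `G k` and `G'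
(n - 1 - k)`. -/
theorem J_J (m n : ℤ) : H.J q m * H.J q n - H.J q n * H.J q m =
    ((m : ℂ) * (1 + q ^ 2) * delta (m + n)) • 1 := by
  have key (k : ℤ) : (Complex.I * (2 * k + 1 - n)) • (H.J q m * H.J q n - H.J q n * H.J q m) =
      (Complex.I * (2 * k + 1 - n) * (m * (1 + q ^ 2) * delta (m + n))) •
        (1 : Module.End ℂ F) := by
    have h := bracket_anticommutator (H.J_G q m k) (H.J_G' q m (n - 1 - k))
    have h1 := H.G'_G' q (k + m) (n - 1 - k)
    have h2 := H.G_G q k (n - 1 - k + m)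
    rw [show k + m + (n - 1 - k) + 1 = m + n by ring] at h1
    rw [show k + (n - 1 - k + m) + 1 = m + n by ring] at h2
    rw [G_G', show k + (n - 1 - k) + 1 = n by ring] at h
    simp only [mul_smul_comm, smul_mul_assoc, ← smul_add, ← smul_sub] at h
    rw [h1, h2] at h
    push_cast at h
    rw [show (Complex.I * (2 * k + 1 - n) : ℂ) = Complex.I * (k - (n - 1 - k)) by ring, h]
    rcases delta_cases (m + n) with ⟨h', h''⟩ | h'
    · obtain rfl : n = -m := by omega
      rw [h'']
      push_cast
      module
    · rw [h']
      module
  -- The factor `2 k + 1 - n` may vanish for one `k`; between `k = 0` and `k = 1` it changes by `2`,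
  -- so the difference of the two cases can be divided.
  have h0 := key 0
  have h1 := key 1
  have h2 : (2 * Complex.I) • (H.J q m * H.J q n - H.J q n * H.J q m) =
      (2 * Complex.I) • (((m : ℂ) * (1 + q ^ 2) * delta (m + n)) • (1 : Module.End ℂ F)) := by
    push_cast at h0 h1
    linear_combination (norm := module) h1 - h0
  exact smul_right_injective _ (by simp : (2 * Complex.I : ℂ) ≠ 0) h2

theorem L_J (m n : ℤ) : H.L q m * H.J q n - H.J q n * H.L q m =
    (-(n : ℂ)) • H.J q (m + n) := by
  have key (k : ℤ) : (Complex.I * (2 * k + 1 - n)) • (H.L q m * H.J q n - H.J q n * H.L q m) =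
      (Complex.I * (2 * k + 1 - n) * (-n)) • H.J q (m + n) := by
    have h := bracket_anticommutator (H.L_G q m k) (H.L_G' q m (n - 1 - k))
    have h1 := H.G_G' q (m + k) (n - 1 - k)
    have h2 := H.G_G' q k (m + (n - 1 - k))
    rw [show m + k + (n - 1 - k) + 1 = m + n by ring] at h1
    rw [show k + (m + (n - 1 - k)) + 1 = m + n by ring] at h2
    rw [G_G', show k + (n - 1 - k) + 1 = n by ring] at h
    simp only [mul_smul_comm, smul_mul_assoc, ← smul_add, ← smul_sub] at h
    rw [h1, h2] at h
    push_cast at h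
    rw [show (Complex.I * (2 * k + 1 - n) : ℂ) = Complex.I * (k - (n - 1 - k)) by ring, h]
    module
  have h0 := key 0
  have h1 := key 1
  have h2 : (2 * Complex.I) • (H.L q m * H.J q n - H.J q n * H.L q m) =
      (2 * Complex.I) • ((-(n : ℂ)) • H.J q (m + n)) := by
    push_cast at h0 h1
    linear_combination (norm := module) h1 - h0
  exact smul_right_injective _ (by simp : (2 * Complex.I : ℂ) ≠ 0) h2

/-- The action of the generators of the `N = 2` algebra on the Fock space. -/
noncomputable def gen : Gen → Module.End ℂ F
  | .L m => H.L q m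
  | .J n => H.J q n
  | .G1 k => H.G q k
  | .G2 k => H.G' q k
  | .C => (3 * (1 + q ^ 2)) • 1

/-- Skew-symmetry on both sides allows a pair of labels to be treated in whichever order the
relation is known. -/
theorem gen_br_symm {a b : Gen}
    (h : H.gen q b * H.gen q a - (-1 : ℂ) ^ (b.parity.val * a.parity.val) •
      (H.gen q a * H.gen q b) = Finsupp.linearCombination ℂ (H.gen q) (brGen b a)) :
    H.gen q a * H.gen q b - (-1 : ℂ) ^ (a.parity.val * b.parity.val) •
      (H.gen q b * H.gen q a) = Finsupp.linearCombination ℂ (H.gen q) (brGen a b) := by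
  rw [N2.brGen_skew a b, map_neg, map_smul, ← h, mul_comm b.parity.val, smul_sub, smul_smul,
    ← mul_pow]
  norm_num

theorem gen_br (a b : Gen) :
    H.gen q a * H.gen q b - (-1 : ℂ) ^ (a.parity.val * b.parity.val) •
      (H.gen q b * H.gen q a) = Finsupp.linearCombination ℂ (H.gen q) (brGen a b) := by
  have hC (a : Gen) : H.gen q a * H.gen q .C -
      (-1 : ℂ) ^ (a.parity.val * Gen.C.parity.val) • (H.gen q .C * H.gen q a) =
        Finsupp.linearCombination ℂ (H.gen q) (brGen a .C) := by
    rw [show brGen a .C = 0 by cases a <;> rfl]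
    simp [gen, Gen.parity]
  have hlc (d : Gen) (t : ℂ) :
      Finsupp.linearCombination ℂ (H.gen q) (t • N2.e d) = t • H.gen q d := by
    simp [N2.e]
  rcases a with m | m | m | m | _ <;> rcases b with n | n | n | n | _
  case C.C => exact hC _
  all_goals first
    | exact hC _
    | exact H.gen_br_symm q (hC _)
    | skip
  case' J.L => apply gen_br_symm
  case' G1.L => apply gen_br_symm
  case' G2.L => apply gen_br_symm
  case' J.G1 => apply gen_br_symm
  case' J.G2 => apply gen_br_symm
  case' G2.G1 => apply gen_br_symm
  all_goals
    simp only [brGen, Gen.parity, ZMod.val_zero, ZMod.val_one, mul_zero, mul_one,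
      pow_zero, pow_one, one_smul, neg_one_smul, sub_neg_eq_add, map_add, hlc]
    simp only [gen]
  case L.L =>
    rw [L_L]
    module
  case L.J => exact H.L_J q m n
  case J.L => exact H.L_J q n m
  case L.G1 => exact H.L_G q m n
  case L.G2 => exact H.L_G' q m n
  case G1.L => exact H.L_G q n m
  case G2.L => exact H.L_G' q n m
  case J.J =>
    rw [J_J]
    module
  case G1.J =>
    rw [← neg_sub, J_G]
    module
  case G2.J =>
    rw [← neg_sub, J_G']
    module
  case J.G1 =>
    rw [← neg_sub, J_G]
    module
  case J.G2 =>
    rw [← neg_sub, J_G']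
    module
  case G1.G1 =>
    rw [G_G]
    module
  case G2.G2 =>
    rw [G'_G']
    module
  case G1.G2 => exact H.G_G' q m n
  case G2.G1 => exact H.G_G' q n m

theorem gen_isAction : IsAction (3 * (1 + q ^ 2)) (H.gen q) where
  central v := rfl
  br a b v := by
    rw [← gen_br]
    rfl

theorem G'_vac {k : ℤ} (hk : -1 ≤ k) : H.G' q k H.vac = 0 := H.rot.G_vac q hk

theorem gen_isVacuum : IsVacuum (H.gen q) H.vac := by
  rintro (m | m | m | m | _) hC hd <;> simp only [Gen.deg] at hd
  · exact H.L_vac q (by omega)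
  · exact H.J_vac q (by omega)
  · exact H.G_vac q (by omega)
  · exact H.G'_vac q (by omega)
  · exact absurd rfl hC

/-- The matrix coefficients of the field `φ` at the point at infinity. -/
noncomputable def infty (u v : F) : ℂ := ∑ᶠ t : ℤ, H.form.inner u (H.φ t v)

/-- The scalar product as an additive function of its first variable. -/
noncomputable def formLeft (v : F) : F →+ ℂ where
  toFun u := H.form.inner u v
  map_zero' := core_zero_left _ _
  map_add' _ _ := H.form.add_left _ _ _

/-- The scalar product as an additive function of its second variable. -/
noncomputable def formRight (u : F) : F →+ ℂ where
  toFun v := H.form.inner u v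
  map_zero' := core_zero_right _ _
  map_add' := core_add_right _ u

theorem inner_locSum_left {ι : Type*} {f : ι → Module.End ℂ F} (hf : LocFin f) (u v : F) :
    H.form.inner (locSum f u) v = ∑ᶠ i, H.form.inner (f i u) v := by
  rw [locSum_apply hf]
  exact (H.formLeft v).map_finsum (hf u)

theorem inner_locSum_right {ι : Type*} {f : ι → Module.End ℂ F} (hf : LocFin f) (u v : F) :
    H.form.inner u (locSum f v) = ∑ᶠ i, H.form.inner u (f i v) := by
  rw [locSum_apply hf]
  exact (H.formRight u).map_finsum (hf v)

theorem inner_support_finite {ι : Type*} {f : ι → Module.End ℂ F} (hf : LocFin f) (u v : F) :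
    (Function.support fun i => H.form.inner u (f i v)).Finite :=
  (hf v).subset fun i hi hi' => hi (by simp only at hi' ⊢; rw [hi', core_zero_right])

theorem infty_support_finite (u v : F) :
    (Function.support fun t => H.form.inner u (H.φ t v)).Finite := by
  obtain ⟨N, hN⟩ := H.φ_nil v
  obtain ⟨N', hN'⟩ := H.φ_nil u
  refine (Set.finite_Ioo (-1 - N') N).subset fun t ht => ?_
  by_contra hcon
  rw [Set.mem_Ioo, not_and_or, not_lt, not_lt] at hcon
  apply ht
  simp only
  rcases hcon with h | h
  · rw [show t = -1 - (-1 - t) by ring, ← H.φ_adj, hN' _ (by omega), core_zero_left]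
  · rw [hN _ h, core_zero_right]

theorem core_sub_left (s : InnerProductSpace.Core ℂ F) (x y z : F) :
    s.inner (x - y) z = s.inner x z - s.inner y z := by
  rw [sub_eq_add_neg, ← neg_one_smul ℂ y, s.add_left, s.smul_left]
  simp
  ring

theorem core_sub_right (s : InnerProductSpace.Core ℂ F) (x y z : F) :
    s.inner x (y - z) = s.inner x y - s.inner x z := by
  rw [sub_eq_add_neg, ← neg_one_smul ℂ z, core_add_right, core_smul_right]
  ring

/-! ### Adjoints up to a defect at the point at infinity -/

variable (r : ℝ)

theorem shift_conj (n : ℤ) : (starRingEnd ℂ) (shift n) = shift n := by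
  unfold shift
  split_ifs <;> simp [Complex.conj_ofNat]

/-- Conjugation reverses the sign of the imaginary shift, so the defect is `i r (shift n + shift
(-n)) = i r` for every `n`. The reality of `r` enters here. -/
theorem ah_adj (n : ℤ) (u v : F) : H.form.inner (H.ah r n u) v =
    H.form.inner u (H.ah r (-n) v) + Complex.I * r * H.form.inner u v := by
  have h := shift_add_shift_neg n
  simp only [ah, LinearMap.sub_apply, LinearMap.smul_apply, Module.End.one_apply]
  rw [core_sub_left, core_sub_right, H.form.smul_left, core_smul_right, H.a_adj, map_mul, map_mul,
    Complex.conj_I, Complex.conj_ofReal, shift_conj]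
  linear_combination (Complex.I * r * H.form.inner u v) * h

/-- The adjoint of a supercurrent mode. -/
theorem G_adj (k : ℤ) (u v : F) : H.form.inner (H.G r k u) v =
    H.form.inner u (H.G r (-1 - k) v) + Complex.I * r * H.infty u v := by
  have hφ (k : ℤ) : LocFin fun n => H.φ (k - n) * H.ah r n :=
    H.φ_nil.locFin_mul (H.ah_nil r) (H.φah r) k
  have hχ (k : ℤ) : LocFin fun n => H.χ (k - n) * H.b n := H.χ_nil.locFin_mul H.b_nil H.χb k
  have h2 : H.form.inner (prodModes H.χ H.b k u) v =
      H.form.inner u (prodModes H.χ H.b (-1 - k) v) := by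
    rw [prodModes, prodModes, H.inner_locSum_left (hχ k), H.inner_locSum_right (hχ _),
      ← finsum_comp_equiv (Equiv.neg ℤ)]
    refine finsum_congr fun n => ?_
    rw [Equiv.neg_apply, H.χb, Module.End.mul_apply, H.b_adj, H.χ_adj, Module.End.mul_apply,
      neg_neg, show -1 - (k - -n) = -1 - k - n by ring]
  have h1 : H.form.inner (prodModes H.φ (H.ah r) k u) v =
      H.form.inner u (prodModes H.φ (H.ah r) (-1 - k) v) + Complex.I * r * H.infty u v := by
    -- The defects of the summands involve each mode of `φ` exactly once; reindexing removes the
    -- dependence on `k`.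
    have hinf : H.infty u v = ∑ᶠ n : ℤ, H.form.inner u (H.φ (-1 - k - n) v) := by
      rw [infty, ← finsum_comp_equiv (Equiv.subLeft (-1 - k))]
      rfl
    have hsup : (Function.support fun n => H.form.inner u (H.φ (-1 - k - n) v)).Finite :=
      (H.infty_support_finite u v).preimage (Equiv.subLeft (-1 - k)).injective.injOn
    rw [prodModes, prodModes, H.inner_locSum_left (hφ k), H.inner_locSum_right (hφ _), hinf,
      ← smul_eq_mul, smul_finsum' _ hsup, ← finsum_add_distrib (H.inner_support_finite (hφ _) u v)
        (hsup.subset fun n hn hn' => hn (by simp only at hn' ⊢; rw [hn', smul_zero])),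
      ← finsum_comp_equiv (Equiv.neg ℤ)]
    refine finsum_congr fun n => ?_
    rw [Equiv.neg_apply, H.φah, Module.End.mul_apply, ah_adj, H.φ_adj, H.φ_adj,
      Module.End.mul_apply, neg_neg, show -1 - (k - -n) = -1 - k - n by ring, smul_eq_mul]
  rw [G, G]
  simp only [LinearMap.sub_apply, LinearMap.add_apply, LinearMap.smul_apply]
  rw [core_sub_left, core_sub_right, H.form.add_left, core_add_right, h1, h2, H.form.smul_left,
    core_smul_right, H.φ_adj]
  simp only [map_mul, Complex.conj_I, Complex.conj_ofReal, map_add, map_intCast, map_div₀, map_one,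
    Complex.conj_ofNat]
  push_cast
  ring

theorem J_adj (n : ℤ) (u v : F) : H.form.inner (H.J r n u) v =
    H.form.inner u (H.J r (-n) v) := by
  have h : H.form.inner ((locSum fun l => H.φ (n - 1 - l) * H.χ l) u) v =
      -H.form.inner u ((locSum fun l => H.φ (-n - 1 - l) * H.χ l) v) := by
    rw [H.inner_locSum_left (H.locFin_φχ n), H.inner_locSum_right (H.locFin_φχ (-n)),
      ← finsum_neg_distrib, ← finsum_comp_equiv (Equiv.subLeft (-1))]
    refine finsum_congr fun l => ?_
    rw [Equiv.subLeft_apply, Module.End.mul_apply, H.φ_adj, H.χ_adj, ← Module.End.mul_apply,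
      show -1 - (-1 - l) = l by ring, show -1 - (n - 1 - (-1 - l)) = -n - 1 - l by ring]
    rw [show H.χ l * H.φ (-n - 1 - l) = -(H.φ (-n - 1 - l) * H.χ l) by rw [H.φχ, neg_neg],
      LinearMap.neg_apply, ← neg_one_smul ℂ, core_smul_right, neg_one_mul]
  rw [J, J]
  simp only [LinearMap.add_apply, LinearMap.smul_apply]
  rw [H.form.add_left, core_add_right, H.form.smul_left, H.form.smul_left, core_smul_right,
    core_smul_right, h, H.b_adj, map_neg, Complex.conj_I, Complex.conj_ofReal]
  ring

/-- The zero mode is central and kills the vacuum. In `Ψ_G` it is exactly the term by which two sums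
differ. -/
theorem a_zero : H.a 0 = 0 := by
  refine H.eq_zero_of_vac 1 (fun n => ?_) (fun n => H.ab 0 n) (fun n => ?_) (fun n => ?_)
    (H.a_vac 0 le_rfl)
  · simpa [sub_eq_zero] using H.aa 0 n
  · rw [one_smul, H.φa]
  · rw [one_smul, H.χa]

/-- The annihilation part of the field `φ` at the point at infinity. -/
noncomputable def Ψ : Module.End ℂ F := locSum fun t : ℤ => if 0 ≤ t then H.φ t else 0

theorem locFin_ite {f : ℤ → Module.End ℂ F} (hf : LocNil f) :
    LocFin fun t : ℤ => if 0 ≤ t then f t else 0 := by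
  intro v
  obtain ⟨N, hN⟩ := hf v
  refine (Set.finite_Ico 0 N).subset fun t ht => ?_
  by_contra hcon
  rw [Set.mem_Ico, not_and_or, not_le, not_lt] at hcon
  apply ht
  rcases hcon with h | h
  · simp [not_le.mpr h]
  · simp only
    split_ifs
    · exact hN t h
    · rfl

theorem infty_vac (v : F) : H.infty H.vac v = H.form.inner H.vac (H.Ψ v) := by
  rw [infty, Ψ, H.inner_locSum_right (locFin_ite H.φ_nil)]
  refine finsum_congr fun t => ?_
  split_ifs with h
  · rfl
  · rw [LinearMap.zero_apply, core_zero_right, show t = -1 - (-1 - t) by ring, ← H.φ_adj,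
      H.φ_vac _ (by omega), core_zero_left]

/-- Bracketing termwise gives `∑ a (t + 1)` on the left and `∑ a t` on the right, over `t ≥ 0`, and
these differ by `a 0 = 0`. The only shift that occurs, in `ah 0` on the right, is cancelled by the
derivative term. -/
theorem Ψ_G : H.Ψ * H.G q 0 + H.G q 0 * H.Ψ = H.Ψ * H.G q (-1) + H.G q (-1) * H.Ψ := by
  have hfin := locFin_ite H.φ_nil
  have key (k : ℤ) : H.Ψ * H.G q k + H.G q k * H.Ψ =
      locSum fun t : ℤ => if 0 ≤ t then H.φ t * H.G q k + H.G q k * H.φ t else 0 := by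
    rw [Ψ, locSum_mul hfin, mul_locSum hfin, locSum_add (hfin.mul_right _) (hfin.mul_left _)]
    congr 1
    funext t
    split_ifs <;> simp
  have h0 : (fun t : ℤ => if 0 ≤ t then H.φ t * H.G q 0 + H.G q 0 * H.φ t else 0) =
      fun t : ℤ => (fun t => if 0 ≤ t then H.a t else 0) (t + 1) := by
    funext t
    simp only
    rcases lt_trichotomy (t + 1) 0 with h | h | h
    · rw [if_neg (by omega), if_neg (by omega)]
    · rw [if_neg (by omega), h, if_pos le_rfl, a_zero]
    · rw [if_pos (by omega), if_pos (by omega), add_comm, G_φ, delta, if_neg (by omega), ah, shift,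
        if_neg (by omega), if_neg (by omega)]
      simp
  have h1 : (fun t : ℤ => if 0 ≤ t then H.φ t * H.G q (-1) + H.G q (-1) * H.φ t else 0) =
      fun t => if 0 ≤ t then H.a t else 0 := by
    funext t
    split_ifs with h
    · rw [add_comm, G_φ, delta, ah, shift, show -1 + t + 1 = t by ring, if_neg (by omega)]
      split_ifs
      · push_cast
        module
      · simp
    · rfl
  have ha := locFin_ite H.a_nil
  rw [key, key, h0, h1]
  ext v
  have ha' : LocFin fun t : ℤ => (fun t => if 0 ≤ t then H.a t else 0) (t + 1) :=
    fun v => (ha v).preimage (Equiv.addRight 1).injective.injOn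
  rw [locSum_apply ha, locSum_apply ha']
  exact finsum_comp_equiv (f := fun t : ℤ => (if 0 ≤ t then H.a t else 0) v) (Equiv.addRight 1)

/-- Since `G k` kills the vacuum for `k ≥ -1`, only the defect is left in `(Ω | G k v)` for `k ≤ 0`,
so `G 0` and `G (-1)` have the same coefficients against `Ω`. By `Ψ_G` this persists with `Ψ` in
front, and `L 0`, `L 1` are half the anticommutators of `G 0` with `G (-1)` and with `G 0`. -/
theorem inner_vac_L (v : F) :
    H.form.inner H.vac (H.L r 0 v) = H.form.inner H.vac (H.L r 1 v) := by
  have hG (k : ℤ) (hk : k ≤ 0) (v : F) : H.form.inner H.vac (H.G r k v) =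
      -(Complex.I * r * H.form.inner H.vac (H.Ψ v)) := by
    have h := H.G_adj r (-1 - k) H.vac v
    rw [H.G_vac r (by omega), core_zero_left, infty_vac, show -1 - (-1 - k) = k by ring] at h
    linear_combination -h
  have h2 := LinearMap.congr_fun (H.Ψ_G (r : ℂ)) v
  simp only [LinearMap.add_apply, Module.End.mul_apply] at h2
  have h3 := congrArg (H.form.inner H.vac) h2
  rw [core_add_right, core_add_right, hG 0 le_rfl, hG (-1) (by norm_num)] at h3
  rw [L, L]
  simp only [LinearMap.smul_apply, LinearMap.add_apply, Module.End.mul_apply, sub_self]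
  rw [core_smul_right, core_smul_right, core_add_right, core_add_right,
    hG 0 le_rfl (H.G r 0 v), hG 0 le_rfl (H.G r (0 - 1) v), hG (0 - 1) (by norm_num)]
  rw [zero_sub]
  linear_combination (-Complex.I * r / 2) * (add_right_cancel h3).symm

end FockSpace

open N2 (Gen Mono piece core_add_right core_smul_right core_zero_left core_zero_right
  piece_induction piece_neg)

theorem N2.Mono.eq_or_exists {M : Type*} [AddCommGroup M] [Module ℂ M] {X : Gen → Module.End ℂ M}
    {w : M} {n : ℤ} {u : M} (h : Mono X w n u) : (n = 0 ∧ u = w) ∨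
      ∃ (a : Gen) (m : ℤ) (x : M), a.IsCreator ∧ Mono X w m x ∧ n = a.deg + m ∧ u = X a x := by
  cases h with
  | vac => exact Or.inl ⟨rfl, rfl⟩
  | step a ha m x hx => exact Or.inr ⟨a, m, x, ha, hx, rfl, rfl⟩

/-! ### Invariance of the form on the vacuum module -/

namespace FockSpace

variable {F : Type*} [AddCommGroup F] [Module ℂ F] (H : FockSpace F) (r : ℝ)

/-- The vectors of degree `n` in the cyclic module of the vacuum. -/
noncomputable abbrev vacPiece (n : ℤ) : Submodule ℂ F := piece (H.gen r) H.vac n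

theorem gen_mem {a : Gen} {n m : ℤ} (hm : a.deg + n = m) {u : F} (hu : u ∈ H.vacPiece r n) :
    H.gen r a u ∈ H.vacPiece r m :=
  (H.gen_isAction (r : ℂ)).map_piece (H.gen_isVacuum (r : ℂ)) a hm hu

theorem G'_adj (k : ℤ) (u v : F) : H.form.inner (H.G' r k u) v =
    H.form.inner u (H.G' r (-1 - k) v) + Complex.I * r * H.rot.infty u v :=
  H.rot.G_adj r k u v

/-- The only vectors of degree one are zero. -/
theorem Mono_one {u : F} (h : Mono (H.gen r) H.vac 1 u) : u = 0 := by
  rcases h.eq_or_exists with ⟨h, -⟩ | ⟨a, m, x, ha, hx, hd, rfl⟩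
  · omega
  have hpos := ha.deg_pos
  rcases hx.eq_or_pos with ⟨rfl, rfl⟩ | h
  · rcases a with k | k | k | k | _ <;> simp only [Gen.deg] at hd hpos
    · omega
    · omega
    · exact H.G_vac r (by omega)
    · exact H.G'_vac r (by omega)
    · omega
  · omega

/-- The degree in which `inner_vac_L` is inconclusive, because `L 1` maps it to the vacuum line.
Since degree one is zero, only `J (-1)` reaches it, and `J` has an exact adjoint. -/
theorem inner_vac_two {v : F} (hv : v ∈ H.vacPiece r 2) : H.form.inner H.vac v = 0 := by
  induction hv using piece_induction with
  | hm v hv =>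
    rcases hv.eq_or_exists with ⟨h, -⟩ | ⟨a, m, x, ha, hx, hd, rfl⟩
    · omega
    have hone (hm : m = 1) : x = 0 := H.Mono_one r (hm ▸ hx)
    have hm := hx.eq_or_pos
    rcases a with k | k | k | k | _ <;> simp only [Gen.IsCreator, Gen.deg] at ha hd
    · have h := H.J_adj r (-k) H.vac x
      rw [H.J_vac r (by omega), core_zero_left, neg_neg] at h
      exact h.symm
    · rw [hone (by omega), map_zero, core_zero_right]
    · rw [hone (by omega), map_zero, core_zero_right]
  | h0 => exact core_zero_right _ _
  | hadd u v _ _ h h' => rw [core_add_right, h, h', add_zero]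
  | hsmul t u _ h => rw [core_smul_right, h, mul_zero]

/-- The vacuum is orthogonal to the vectors of nonzero degree. -/
theorem inner_vac_eq_zero {n : ℤ} (hn : n ≠ 0) {v : F} (hv : v ∈ H.vacPiece r n) :
    H.form.inner H.vac v = 0 := by
  rcases lt_or_gt_of_ne hn with h | h
  · rw [vacPiece, piece_neg h, Submodule.mem_bot] at hv
    rw [hv, core_zero_right]
  lift n to ℕ using h.le
  induction n using Nat.strong_induction_on generalizing v with
  | _ n ih =>
  rcases eq_or_ne n 2 with rfl | h2
  · exact H.inner_vac_two r hv
  have h1 := H.inner_vac_L r v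
  have h3 := (H.gen_isAction (r : ℂ)).L_zero_piece (H.gen_isVacuum (r : ℂ)) hv
  have h4 : H.L r 0 v = (((n : ℤ) : ℂ) / 2) • v := h3
  -- The relation reads `(n / 2) (Ω | v) = (Ω | L 1 v)`. The degree `n - 2` is not zero, so the
  -- right side vanishes by induction or, for `n = 1`, because negative degrees are empty.
  have h5 : H.L r 1 v ∈ H.vacPiece r (n - 2) :=
    H.gen_mem r (a := .L 1) (by simp only [Gen.deg]; ring) hv
  have h6 : H.form.inner H.vac (H.L r 1 v) = 0 := by
    rcases (by omega : n = 1 ∨ 2 < n) with rfl | h'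
    · rw [vacPiece, piece_neg (by norm_num), Submodule.mem_bot] at h5
      rw [h5, core_zero_right]
    · refine ih (n - 2) (by omega) (by omega) ?_ (by omega)
      rwa [show (((n - 2 : ℕ) : ℤ)) = (n : ℤ) - 2 by omega]
  rw [h4, core_smul_right, h6] at h1
  refine (mul_eq_zero.mp h1).resolve_left ?_
  simpa using hn

/-- If the adjoint of `T k` is `T (-1 - k)` up to a form `D` independent of `k`, then `D`
vanishes as soon as the form separates degrees. -/
theorem defect_eq_zero {T : ℤ → Module.End ℂ F} {D : F → F → ℂ}
    (hadj : ∀ k u v, H.form.inner (T k u) v = H.form.inner u (T (-1 - k) v) + D u v)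
    (hT : ∀ k n u, u ∈ H.vacPiece r n → T k u ∈ H.vacPiece r (n - (2 * k + 1))) {n : ℤ} {u : F}
    (hu : u ∈ H.vacPiece r n)
    (h : ∀ m v, m ≠ n → v ∈ H.vacPiece r m → H.form.inner u v = 0) {m : ℤ} {v : F}
    (hv : v ∈ H.vacPiece r m) : D u v = 0 := by
  -- For this mode number `T k u` has negative degree and `T (-1 - k) v` has degree greater than
  -- `n`, so only the defect survives.
  have h1 := hadj (|n| + |m|) u v
  have hn := le_abs_self n
  have hm := neg_abs_le m
  have hn' := abs_nonneg n
  have hm' := abs_nonneg m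
  have h2 := hT (|n| + |m|) n u hu
  rw [vacPiece, piece_neg (by omega), Submodule.mem_bot] at h2
  rw [h2, core_zero_left, h _ _ _ (hT _ m v hv), zero_add] at h1
  · exact h1.symm
  · omega

theorem G_mem (k n : ℤ) (u : F) (hu : u ∈ H.vacPiece r n) :
    H.G r k u ∈ H.vacPiece r (n - (2 * k + 1)) :=
  H.gen_mem r (a := .G1 k) (by simp only [Gen.deg]; ring) hu

theorem G'_mem (k n : ℤ) (u : F) (hu : u ∈ H.vacPiece r n) :
    H.G' r k u ∈ H.vacPiece r (n - (2 * k + 1)) :=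
  H.gen_mem r (a := .G2 k) (by simp only [Gen.deg]; ring) hu

/-- Vectors of different degrees are orthogonal. -/
theorem inner_eq_zero {n : ℤ} {u : F} (hu : Mono (H.gen r) H.vac n u) {m : ℤ} {v : F}
    (hmn : m ≠ n) (hv : v ∈ H.vacPiece r m) : H.form.inner u v = 0 := by
  induction hu generalizing m v with
  | vac => exact H.inner_vac_eq_zero r hmn hv
  | step a ha n u hu ih =>
    rcases a with k | k | k | k | _ <;> simp only [Gen.IsCreator, Gen.deg] at ha hmn
    · rw [show H.gen r (.J k) = H.J r k from rfl, J_adj]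
      exact ih (m := m + 2 * k) (by omega)
        (H.gen_mem r (a := .J (-k)) (by simp only [Gen.deg]; ring) hv)
    -- The induction hypothesis says that the shorter word `u` is orthogonal to all other degrees,
    -- which is what removes the defect.
    · rw [show H.gen r (.G1 k) = H.G r k from rfl, G_adj,
        H.defect_eq_zero r (H.G_adj r) (H.G_mem r) hu.mem (fun m v h h' => ih h h') hv, add_zero]
      exact ih (by omega) (H.G_mem r (-1 - k) m v hv)
    · rw [show H.gen r (.G2 k) = H.G' r k from rfl, G'_adj,
        H.defect_eq_zero r (H.G'_adj r) (H.G'_mem r) hu.mem (fun m v h h' => ih h h') hv, add_zero]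
      exact ih (by omega) (H.G'_mem r (-1 - k) m v hv)

theorem inner_ext {S T : Module.End ℂ F}
    (h : ∀ n u, Mono (H.gen r) H.vac n u → ∀ m v, v ∈ H.vacPiece r m →
      H.form.inner (S u) v = H.form.inner u (T v)) {u v : F} (hu : u ∈ ⨆ n, H.vacPiece r n)
    (hv : v ∈ ⨆ n, H.vacPiece r n) : H.form.inner (S u) v = H.form.inner u (T v) := by
  induction hu using Submodule.iSup_induction' with
  | mem n u hu =>
    induction hu using piece_induction with
    | hm u hu =>
      induction hv using Submodule.iSup_induction' with
      | mem m v hv => exact h n u hu m v hv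
      | zero => rw [map_zero, core_zero_right, core_zero_right]
      | add x y _ _ h h' => rw [map_add, core_add_right, core_add_right, h, h']
    | h0 => rw [map_zero, core_zero_left, core_zero_left]
    | hadd x y _ _ h h' => rw [map_add, H.form.add_left, H.form.add_left, h, h']
    | hsmul t x _ h => rw [map_smul, H.form.smul_left, H.form.smul_left, h]
  | zero => rw [map_zero, core_zero_left, core_zero_left]
  | add x y _ _ h h' => rw [map_add, H.form.add_left, H.form.add_left, h, h']

theorem G_contravariant (k : ℤ) {u v : F} (hu : u ∈ ⨆ n, H.vacPiece r n)
    (hv : v ∈ ⨆ n, H.vacPiece r n) :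
    H.form.inner (H.G r k u) v = H.form.inner u (H.G r (-1 - k) v) := by
  refine H.inner_ext r (fun n u hu m v hv => ?_) hu hv
  rw [G_adj, H.defect_eq_zero r (H.G_adj r) (H.G_mem r) hu.mem
    (fun m v h h' => H.inner_eq_zero r hu h h') hv, add_zero]

theorem G'_contravariant (k : ℤ) {u v : F} (hu : u ∈ ⨆ n, H.vacPiece r n)
    (hv : v ∈ ⨆ n, H.vacPiece r n) :
    H.form.inner (H.G' r k u) v = H.form.inner u (H.G' r (-1 - k) v) := by
  refine H.inner_ext r (fun n u hu m v hv => ?_) hu hv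
  rw [G'_adj, H.defect_eq_zero r (H.G'_adj r) (H.G'_mem r) hu.mem
    (fun m v h h' => H.inner_eq_zero r hu h h') hv, add_zero]

theorem gen_mem_iSup (a : Gen) {u : F} (hu : u ∈ ⨆ n, H.vacPiece r n) :
    H.gen r a u ∈ ⨆ n, H.vacPiece r n :=
  (H.gen_isAction (r : ℂ)).map_iSup_piece (H.gen_isVacuum (r : ℂ)) a hu

theorem L_neg_eq (m : ℤ) : H.L r (-m) =
    (1 / 2 : ℂ) • (H.G r (-m) * H.G r (-1) + H.G r (-1) * H.G r (-m)) := by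
  rw [G_G, show -m + -1 + 1 = -m by ring]
  rcases N2.delta_cases (-m) with ⟨h, h'⟩ | h'
  · obtain rfl : m = 0 := by omega
    rw [h']
    push_cast
    module
  · rw [h']
    module

/-- The adjoint of `{G (m - 1), G 0}` is `{G (-m), G (-1)}`, which by `L_neg_eq` is twice `L (-m)`
without central term. -/
theorem L_contravariant (m : ℤ) {u v : F} (hu : u ∈ ⨆ n, H.vacPiece r n)
    (hv : v ∈ ⨆ n, H.vacPiece r n) :
    H.form.inner (H.L r m u) v = H.form.inner u (H.L r (-m) v) := by
  have hG (k : ℤ) {u : F} (hu : u ∈ ⨆ n, H.vacPiece r n) : H.G r k u ∈ ⨆ n, H.vacPiece r n :=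
    H.gen_mem_iSup r (.G1 k) hu
  rw [L_neg_eq, L]
  simp only [LinearMap.smul_apply, LinearMap.add_apply, Module.End.mul_apply]
  rw [H.form.smul_left, core_smul_right, H.form.add_left, core_add_right,
    H.G_contravariant r _ (hG _ hu) hv, H.G_contravariant r _ hu (hG _ hv),
    H.G_contravariant r _ (hG _ hu) hv, H.G_contravariant r _ hu (hG _ hv),
    show (-1 - (m - 1)) = -m by ring, sub_zero, map_div₀, map_one, Complex.conj_ofNat, add_comm]

/-- The scalar product of the Fock space is invariant on the cyclic module of the vacuum. -/
theorem gen_contravariant (a : Gen) {u v : F} (hu : u ∈ ⨆ n, H.vacPiece r n)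
    (hv : v ∈ ⨆ n, H.vacPiece r n) :
    H.form.inner (H.gen r a u) v = H.form.inner u (H.gen r a.adj v) := by
  rcases a with k | k | k | k | _
  · exact H.L_contravariant r k hu hv
  · exact H.J_adj r k u v
  · exact H.G_contravariant r k hu hv
  · exact H.G'_contravariant r k hu hv
  · simp only [gen, Gen.adj, LinearMap.smul_apply, Module.End.one_apply]
    rw [H.form.smul_left, core_smul_right]
    congr 1
    simp only [map_mul, map_add, map_pow, map_one, Complex.conj_ofNat, Complex.conj_ofReal]

end FockSpace

/-! ### A concrete Fock space in the occupation number basis -/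

namespace OccupationNumber

/-- Occupation numbers of the bosonic modes (two families) and of the fermionic modes. -/
abbrev State : Type := (Bool × ℕ →₀ ℕ) × Finset ℕ

/-- The space with the occupation numbers as an orthonormal basis. -/
abbrev Fock : Type := State →₀ ℂ

/-- The basis vectors. -/
noncomputable def ket (s : State) : Fock := Finsupp.single s 1

theorem end_ext {S T : Module.End ℂ Fock} (h : ∀ s, S (ket s) = T (ket s)) : S = T := by
  ext s : 2
  exact h s

theorem support_finite (u v : Fock) :
    (Function.support fun s => (starRingEnd ℂ) (u s) * v s).Finite :=
  v.hasFiniteSupport.subset fun s hs hs' => hs (by simp only at hs' ⊢; rw [hs', mul_zero])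

/-- The standard scalar product. -/
@[reducible]
noncomputable def form : InnerProductSpace.Core ℂ Fock where
  inner u v := ∑ᶠ s, (starRingEnd ℂ) (u s) * v s
  conj_inner_symm u v := by
    rw [map_finsum _ (support_finite v u)]
    refine finsum_congr fun s => ?_
    rw [map_mul, Complex.conj_conj, mul_comm]
  re_inner_nonneg u := by
    refine finsum_induction (fun z : ℂ => 0 ≤ RCLike.re z) (by simp)
      (fun x y hx hy => by rw [map_add]; exact add_nonneg hx hy) fun s => ?_
    rw [mul_comm, Complex.mul_conj]
    simpa using Complex.normSq_nonneg _
  add_left u v w := by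
    rw [← finsum_add_distrib (support_finite u w) (support_finite v w)]
    refine finsum_congr fun s => ?_
    rw [Finsupp.add_apply, map_add, add_mul]
  smul_left u v t := by
    rw [← smul_eq_mul, smul_finsum' _ (support_finite u v)]
    refine finsum_congr fun s => ?_
    rw [Finsupp.smul_apply, smul_eq_mul, map_mul, mul_assoc, smul_eq_mul]
  definite u hu := by
    have h : ∑ᶠ s, (starRingEnd ℂ) (u s) * u s = 0 := hu
    have h1 : ∑ᶠ s, Complex.normSq (u s) = 0 := by
      have h2 := map_finsum Complex.ofRealHom (f := fun s => Complex.normSq (u s))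
        (u.hasFiniteSupport.subset fun s hs hs' => hs (by simp only [hs', map_zero]))
      have h3 : (fun s => Complex.ofRealHom (Complex.normSq (u s))) =
          fun s => (starRingEnd ℂ) (u s) * u s := by
        funext s
        rw [mul_comm, Complex.mul_conj]
        rfl
      rw [h3, h] at h2
      simpa using h2
    ext s
    by_contra hs
    have hpos : 0 < Complex.normSq (u s) := Complex.normSq_pos.mpr hs
    have := single_le_finsum s
      (u.hasFiniteSupport.subset fun s hs hs' => hs (by simp only [hs', map_zero]))
      fun s => Complex.normSq_nonneg (u s)
    linarith

open Classical in
theorem inner_ket (s t : State) : form.inner (ket s) (ket t) = if s = t then 1 else 0 := by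
  change ∑ᶠ x, (starRingEnd ℂ) (ket s x) * ket t x = _
  rw [finsum_eq_single _ s fun x hx => by simp [ket, Finsupp.single_apply, hx.symm]]
  simp [ket, Finsupp.single_apply, eq_comm]

/-- `T` is the adjoint of `S`. -/
def IsAdj (S T : Module.End ℂ Fock) : Prop :=
  ∀ u v, form.inner (S u) v = form.inner u (T v)

theorem isAdj_of_ket {S T : Module.End ℂ Fock}
    (h : ∀ s t, form.inner (S (ket s)) (ket t) = form.inner (ket s) (T (ket t))) : IsAdj S T := by
  intro u v
  have hsingle (s : State) (z : ℂ) : Finsupp.single s z = z • ket s := by simp [ket]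
  induction u using Finsupp.induction_linear with
  | zero => rw [map_zero, N2.core_zero_left, N2.core_zero_left]
  | add x y hx hy => rw [map_add, form.add_left, form.add_left, hx, hy]
  | single s z =>
    rw [hsingle, map_smul, form.smul_left, form.smul_left]
    congr 1
    induction v using Finsupp.induction_linear with
    | zero => rw [map_zero, N2.core_zero_right, N2.core_zero_right]
    | add x y hx hy => rw [map_add, N2.core_add_right, N2.core_add_right, hx, hy]
    | single t y => rw [hsingle, map_smul, N2.core_smul_right, N2.core_smul_right, h]

theorem ext_inner_right {x y : Fock} (h : ∀ u, form.inner u x = form.inner u y) : x = y := by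
  have h1 := form.definite (x - y)
  rw [sub_eq_add_neg, ← neg_one_smul ℂ y, N2.core_add_right, N2.core_smul_right, h] at h1
  rw [← sub_eq_zero, sub_eq_add_neg, ← neg_one_smul ℂ y]
  exact h1 (by ring)

theorem IsAdj.symm {S T : Module.End ℂ Fock} (h : IsAdj S T) : IsAdj T S := fun u v => by
  rw [← form.conj_inner_symm, ← h, form.conj_inner_symm]

/-- Relations among annihilation operators, and mixed ones, are obtained from those of creation
operators by taking adjoints. -/
theorem IsAdj.unique {S T T' : Module.End ℂ Fock} (h : IsAdj S T) (h' : IsAdj S T') : T = T' :=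
  LinearMap.ext fun v => ext_inner_right fun u => (h u v).symm.trans (h' u v)

theorem IsAdj.mul {S S' T T' : Module.End ℂ Fock} (hS : IsAdj S S') (hT : IsAdj T T') :
    IsAdj (S * T) (T' * S') := fun u v => by
  rw [Module.End.mul_apply, hS, hT, Module.End.mul_apply]

theorem IsAdj.real_smul {S S' : Module.End ℂ Fock} (hS : IsAdj S S') (r : ℝ) :
    IsAdj ((r : ℂ) • S) ((r : ℂ) • S') := fun u v => by
  rw [LinearMap.smul_apply, LinearMap.smul_apply, form.smul_left, N2.core_smul_right, hS,
    Complex.conj_ofReal]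

theorem IsAdj.neg {S S' : Module.End ℂ Fock} (hS : IsAdj S S') : IsAdj (-S) (-S') := fun u v => by
  rw [LinearMap.neg_apply, LinearMap.neg_apply, ← neg_one_smul ℂ (S u), ← neg_one_smul ℂ (S' v),
    form.smul_left, N2.core_smul_right, hS]
  simp

section Bosons

/-- The bosonic creation operators. -/
noncomputable def cre (i : Bool × ℕ) : Module.End ℂ Fock :=
  Finsupp.linearCombination ℂ fun s : State =>
    ((√(s.1 i + 1) : ℝ) : ℂ) • ket (s.1 + Finsupp.single i 1, s.2)

/-- The bosonic annihilation operators. -/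
noncomputable def ann (i : Bool × ℕ) : Module.End ℂ Fock :=
  Finsupp.linearCombination ℂ fun s : State =>
    ((√(s.1 i) : ℝ) : ℂ) • ket (s.1 - Finsupp.single i 1, s.2)

theorem cre_ket (i : Bool × ℕ) (f : Bool × ℕ →₀ ℕ) (S : Finset ℕ) :
    cre i (ket (f, S)) = ((√(f i + 1) : ℝ) : ℂ) • ket (f + Finsupp.single i 1, S) := by
  simp [cre, ket]

theorem ann_ket (i : Bool × ℕ) (f : Bool × ℕ →₀ ℕ) (S : Finset ℕ) :
    ann i (ket (f, S)) = ((√(f i) : ℝ) : ℂ) • ket (f - Finsupp.single i 1, S) := by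
  simp [ann, ket]

theorem ann_ket_zero {i : Bool × ℕ} {f : Bool × ℕ →₀ ℕ} (h : f i = 0) (S : Finset ℕ) :
    ann i (ket (f, S)) = 0 := by
  simp [ann_ket, h]

theorem ann_ket_add (i : Bool × ℕ) (f : Bool × ℕ →₀ ℕ) (S : Finset ℕ) :
    ann i (ket (f + Finsupp.single i 1, S)) = ((√(f i + 1) : ℝ) : ℂ) • ket (f, S) := by
  rw [ann_ket, add_tsub_cancel_right]
  simp

/-- Case distinction that avoids truncated subtraction of occupation numbers. -/
theorem eq_zero_or_add (i : Bool × ℕ) (f : Bool × ℕ →₀ ℕ) :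
    f i = 0 ∨ ∃ g, f = g + Finsupp.single i 1 := by
  rcases Nat.eq_zero_or_pos (f i) with h | h
  · exact Or.inl h
  · refine Or.inr ⟨f - Finsupp.single i 1, (tsub_add_cancel_of_le ?_).symm⟩
    rwa [Finsupp.single_le_iff]

theorem cre_adj (i : Bool × ℕ) : IsAdj (cre i) (ann i) := by
  refine isAdj_of_ket fun ⟨f, S⟩ ⟨g, T⟩ => ?_
  rw [cre_ket, form.smul_left, inner_ket]
  rcases eq_zero_or_add i g with h | ⟨g, rfl⟩
  · rw [ann_ket_zero h, N2.core_zero_right, if_neg, mul_zero]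
    intro heq
    have := DFunLike.congr_fun (congrArg Prod.fst heq) i
    simp [h] at this
  · rw [ann_ket_add, N2.core_smul_right, inner_ket, Complex.conj_ofReal]
    by_cases h : (f, S) = (g, T)
    · obtain ⟨rfl, rfl⟩ := Prod.mk.inj h
      simp
    · rw [if_neg h, if_neg, mul_zero, mul_zero]
      intro heq
      obtain ⟨h1, rfl⟩ := Prod.mk.inj heq
      exact h (by rw [add_right_cancel h1])

theorem cre_cre (i j : Bool × ℕ) : cre i * cre j = cre j * cre i := by
  rcases eq_or_ne i j with rfl | hij
  · rfl
  refine end_ext fun ⟨f, S⟩ => ?_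
  simp only [Module.End.mul_apply, cre_ket, map_smul, smul_smul, Finsupp.add_apply,
    Finsupp.single_apply, hij, hij.symm, if_false, add_zero]
  rw [add_right_comm, mul_comm]

theorem ann_ann (i j : Bool × ℕ) : ann i * ann j = ann j * ann i :=
  ((cre_adj j).mul (cre_adj i)).unique ((cre_cre j i) ▸ (cre_adj i).mul (cre_adj j))

theorem sqrt_mul_sqrt_cast (n : ℕ) : ((√(n + 1) : ℝ) : ℂ) * ((√(n + 1) : ℝ) : ℂ) = n + 1 := by
  rw [← Complex.ofReal_mul, Real.mul_self_sqrt (by positivity)]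
  push_cast
  rfl

open Classical in
theorem ann_cre (i j : Bool × ℕ) :
    ann i * cre j - cre j * ann i = (if i = j then (1 : ℂ) else 0) • 1 := by
  refine end_ext fun ⟨f, S⟩ => ?_
  simp only [LinearMap.sub_apply, LinearMap.smul_apply, Module.End.mul_apply,
    Module.End.one_apply]
  rcases eq_or_ne i j with rfl | hij
  · rw [if_pos rfl, cre_ket, map_smul, ann_ket_add, smul_smul, sqrt_mul_sqrt_cast]
    rcases eq_zero_or_add i f with h | ⟨f, rfl⟩
    · rw [ann_ket_zero h, map_zero, h]
      simp
    · rw [ann_ket_add, map_smul, cre_ket, smul_smul, sqrt_mul_sqrt_cast, ← sub_smul]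
      simp
  · rw [if_neg hij, zero_smul, sub_eq_zero, cre_ket]
    rcases eq_zero_or_add i f with h | ⟨f, rfl⟩
    · rw [ann_ket_zero h, map_zero, map_smul, ann_ket_zero, smul_zero]
      simp [h, hij.symm]
    · rw [add_right_comm, map_smul, ann_ket_add, ann_ket_add, map_smul, cre_ket, smul_smul,
        smul_smul]
      simp [hij, hij.symm, mul_comm]

end Bosons

/-! ### Fermionic operators with Jordan-Wigner signs -/

section Fermions

/-- The Jordan-Wigner sign. -/
def sgn (j : ℕ) (S : Finset ℕ) : ℂ := (-1) ^ (S.filter (· < j)).card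

theorem sgn_mul_self (j : ℕ) (S : Finset ℕ) : sgn j S * sgn j S = 1 := by
  rw [sgn, ← mul_pow]
  norm_num

theorem sgn_conj (j : ℕ) (S : Finset ℕ) : (starRingEnd ℂ) (sgn j S) = sgn j S := by
  simp [sgn]

theorem sgn_insert {j k : ℕ} {S : Finset ℕ} (hk : k ∉ S) :
    sgn j (insert k S) = if k < j then -sgn j S else sgn j S := by
  rw [sgn, Finset.filter_insert]
  split_ifs with h
  · rw [Finset.card_insert_of_notMem (by simp [hk]), pow_succ, sgn]
    ring
  · rfl

/-- Exactly one of `j < k` and `k < j` holds, so exactly one of the two signs changes. This is the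
source of anticommutation at different places. -/
theorem sgn_insert_mul {j k : ℕ} (hjk : j ≠ k) {S : Finset ℕ} (hj : j ∉ S) (hk : k ∉ S) :
    sgn j (insert k S) * sgn k (insert j S) = -(sgn j S * sgn k S) := by
  rw [sgn_insert hk, sgn_insert hj]
  rcases lt_or_gt_of_ne hjk with h | h
  · rw [if_neg h.not_gt, if_pos h]
    ring
  · rw [if_pos h, if_neg h.not_gt]
    ring

theorem sgn_insert_mul' {j k : ℕ} (hjk : j ≠ k) {S : Finset ℕ} (hj : j ∉ S) (hk : k ∉ S) :
    sgn j (insert k S) * sgn k S = -(sgn k (insert j S) * sgn j S) := by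
  rw [sgn_insert hk, sgn_insert hj]
  rcases lt_or_gt_of_ne hjk with h | h
  · rw [if_neg h.not_gt, if_pos h]
    ring
  · rw [if_pos h, if_neg h.not_gt]
    ring

/-- The fermionic creation operators. -/
noncomputable def fcre (j : ℕ) : Module.End ℂ Fock :=
  Finsupp.linearCombination ℂ fun s : State =>
    if j ∈ s.2 then 0 else sgn j s.2 • ket (s.1, insert j s.2)

/-- The fermionic annihilation operators. -/
noncomputable def fann (j : ℕ) : Module.End ℂ Fock :=
  Finsupp.linearCombination ℂ fun s : State =>
    if j ∈ s.2 then sgn j s.2 • ket (s.1, s.2.erase j) else 0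

theorem fcre_ket {j : ℕ} {S : Finset ℕ} (hj : j ∉ S) (f : Bool × ℕ →₀ ℕ) :
    fcre j (ket (f, S)) = sgn j S • ket (f, insert j S) := by
  simp [fcre, ket, hj]

theorem fcre_ket_insert (j : ℕ) (S : Finset ℕ) (f : Bool × ℕ →₀ ℕ) :
    fcre j (ket (f, insert j S)) = 0 := by
  simp [fcre, ket]

theorem fann_ket {j : ℕ} {S : Finset ℕ} (hj : j ∉ S) (f : Bool × ℕ →₀ ℕ) :
    fann j (ket (f, S)) = 0 := by
  simp [fann, ket, hj]

theorem fann_ket_insert {j : ℕ} {S : Finset ℕ} (hj : j ∉ S) (f : Bool × ℕ →₀ ℕ) :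
    fann j (ket (f, insert j S)) = sgn j S • ket (f, S) := by
  simp [fann, ket, hj, sgn_insert hj]

theorem notMem_or_insert (j : ℕ) (S : Finset ℕ) : j ∉ S ∨ ∃ T, j ∉ T ∧ S = insert j T := by
  by_cases h : j ∈ S
  · exact Or.inr ⟨S.erase j, Finset.notMem_erase j S, (Finset.insert_erase h).symm⟩
  · exact Or.inl h

theorem fcre_adj (j : ℕ) : IsAdj (fcre j) (fann j) := by
  refine isAdj_of_ket fun ⟨f, S⟩ ⟨g, T⟩ => ?_
  rcases notMem_or_insert j S with hS | ⟨S, hS, rfl⟩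
  · rw [fcre_ket hS, form.smul_left, inner_ket, sgn_conj]
    rcases notMem_or_insert j T with hT | ⟨T, hT, rfl⟩
    · rw [fann_ket hT, N2.core_zero_right, if_neg, mul_zero]
      intro h
      obtain ⟨-, rfl⟩ := Prod.mk.inj h
      simp at hT
    · rw [fann_ket_insert hT, N2.core_smul_right, inner_ket]
      by_cases h : (f, S) = (g, T)
      · obtain ⟨rfl, rfl⟩ := Prod.mk.inj h
        simp
      · rw [if_neg h, if_neg, mul_zero, mul_zero]
        intro heq
        obtain ⟨rfl, h2⟩ := Prod.mk.inj heq
        apply h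
        rw [← Finset.erase_insert hS, h2, Finset.erase_insert hT]
  · rw [fcre_ket_insert, N2.core_zero_left]
    rcases notMem_or_insert j T with hT | ⟨T, hT, rfl⟩
    · rw [fann_ket hT, N2.core_zero_right]
    · rw [fann_ket_insert hT, N2.core_smul_right, inner_ket, if_neg, mul_zero]
      intro h
      obtain ⟨-, rfl⟩ := Prod.mk.inj h
      simp at hT

theorem fcre_fcre (j k : ℕ) : fcre j * fcre k = -(fcre k * fcre j) := by
  refine end_ext fun ⟨f, S⟩ => ?_
  simp only [LinearMap.neg_apply, Module.End.mul_apply]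
  rcases notMem_or_insert k S with hk | ⟨S, hk, rfl⟩
  · rcases notMem_or_insert j S with hj | ⟨S, hj, rfl⟩
    · rw [fcre_ket hk, fcre_ket hj, map_smul, map_smul]
      rcases eq_or_ne j k with rfl | hjk
      · simp [fcre_ket_insert]
      · rw [fcre_ket (by simp [hj, hjk]), fcre_ket (by simp [hk, hjk.symm]), smul_smul, smul_smul,
          Finset.insert_comm, ← neg_smul, mul_comm, sgn_insert_mul' hjk hj hk, mul_comm]
    · rw [fcre_ket_insert, map_zero, neg_zero, fcre_ket hk, map_smul, Finset.insert_comm,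
        fcre_ket_insert, smul_zero]
  · rw [fcre_ket_insert, map_zero]
    rcases notMem_or_insert j (insert k S) with hj | ⟨T, hj, hT⟩
    · rw [fcre_ket hj, map_smul, Finset.insert_comm, fcre_ket_insert, smul_zero, neg_zero]
    · rw [hT, fcre_ket_insert, map_zero, neg_zero]

theorem fann_fann (j k : ℕ) : fann j * fann k = -(fann k * fann j) :=
  ((fcre_adj k).mul (fcre_adj j)).unique
    ((fcre_fcre k j).symm ▸ ((fcre_adj j).mul (fcre_adj k)).neg)

theorem fann_fcre (j k : ℕ) :
    fann j * fcre k + fcre k * fann j = (if j = k then (1 : ℂ) else 0) • 1 := by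
  refine end_ext fun ⟨f, S⟩ => ?_
  simp only [LinearMap.add_apply, LinearMap.smul_apply, Module.End.mul_apply,
    Module.End.one_apply]
  rcases eq_or_ne j k with rfl | hjk
  · rw [if_pos rfl, one_smul]
    rcases notMem_or_insert j S with hj | ⟨S, hj, rfl⟩
    · rw [fcre_ket hj, fann_ket hj, map_smul, fann_ket_insert hj, smul_smul, sgn_mul_self,
        one_smul, map_zero, add_zero]
    · rw [fcre_ket_insert, fann_ket_insert hj, map_smul, fcre_ket hj, smul_smul, sgn_mul_self,
        one_smul, map_zero, zero_add]
  · rw [if_neg hjk, zero_smul]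
    rcases notMem_or_insert j S with hj | ⟨S, hj, rfl⟩
    · rw [fann_ket hj, map_zero, add_zero]
      rcases notMem_or_insert k S with hk | ⟨S, hk, rfl⟩
      · rw [fcre_ket hk, map_smul, fann_ket (by simp [hj, hjk]), smul_zero]
      · rw [fcre_ket_insert, map_zero]
    · rw [fann_ket_insert hj, map_smul]
      rcases notMem_or_insert k S with hk | ⟨S, hk, rfl⟩
      · rw [fcre_ket (by simp [hk, hjk.symm]), fcre_ket hk, map_smul, Finset.insert_comm,
          fann_ket_insert (by simp [hj, hjk]), smul_smul, smul_smul, mul_comm,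
          sgn_insert_mul hjk hj hk, ← add_smul]
        simp
      · rw [Finset.insert_comm, fcre_ket_insert, fcre_ket_insert, map_zero, smul_zero, add_zero]

theorem fcre_cre (j : ℕ) (i : Bool × ℕ) : fcre j * cre i = cre i * fcre j := by
  refine end_ext fun ⟨f, S⟩ => ?_
  simp only [Module.End.mul_apply]
  rcases notMem_or_insert j S with hj | ⟨S, hj, rfl⟩
  · rw [cre_ket, map_smul, fcre_ket hj, fcre_ket hj, map_smul, cre_ket, smul_comm]
  · rw [cre_ket, map_smul, fcre_ket_insert, fcre_ket_insert, map_zero, smul_zero]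

theorem fann_cre (j : ℕ) (i : Bool × ℕ) : fann j * cre i = cre i * fann j := by
  refine end_ext fun ⟨f, S⟩ => ?_
  simp only [Module.End.mul_apply]
  rcases notMem_or_insert j S with hj | ⟨S, hj, rfl⟩
  · rw [cre_ket, map_smul, fann_ket hj, fann_ket hj, map_zero, smul_zero]
  · rw [cre_ket, map_smul, fann_ket_insert hj, fann_ket_insert hj, map_smul, cre_ket, smul_comm]

theorem fann_ann (j : ℕ) (i : Bool × ℕ) : fann j * ann i = ann i * fann j :=
  ((cre_adj i).mul (fcre_adj j)).unique
    ((fcre_cre j i) ▸ (fcre_adj j).mul (cre_adj i))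

theorem fcre_ann (j : ℕ) (i : Bool × ℕ) : fcre j * ann i = ann i * fcre j :=
  ((cre_adj i).mul (fcre_adj j).symm).unique
    ((fann_cre j i) ▸ (fcre_adj j).symm.mul (cre_adj i))

end Fermions

/-! ### Diagonal sign operators -/

section Sign

/-- The diagonal operator with entries `w`. -/
noncomputable def diag (w : State → ℝ) : Module.End ℂ Fock :=
  Finsupp.linearCombination ℂ fun s => (w s : ℂ) • ket s

theorem diag_ket (w : State → ℝ) (s : State) : diag w (ket s) = (w s : ℂ) • ket s := by
  simp [diag, ket]

theorem diag_adj (w : State → ℝ) : IsAdj (diag w) (diag w) := by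
  refine isAdj_of_ket fun s t => ?_
  rw [diag_ket, diag_ket, form.smul_left, N2.core_smul_right, inner_ket, Complex.conj_ofReal]
  split_ifs with h
  · rw [h]
  · rw [mul_zero, mul_zero]

variable {w : State → ℝ} {ε : ℝ}

theorem diag_cre {i : Bool × ℕ} (h : ∀ f S, w (f + Finsupp.single i 1, S) = ε * w (f, S)) :
    diag w * cre i = (ε : ℂ) • (cre i * diag w) := by
  refine end_ext fun ⟨f, S⟩ => ?_
  simp only [LinearMap.smul_apply, Module.End.mul_apply, cre_ket, diag_ket, map_smul, smul_smul, h]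
  congr 1
  push_cast
  ring

theorem diag_fcre {j : ℕ} (h : ∀ f S, j ∉ S → w (f, insert j S) = ε * w (f, S)) :
    diag w * fcre j = (ε : ℂ) • (fcre j * diag w) := by
  refine end_ext fun ⟨f, S⟩ => ?_
  simp only [LinearMap.smul_apply, Module.End.mul_apply]
  rcases notMem_or_insert j S with hj | ⟨S, hj, rfl⟩
  · simp only [fcre_ket hj, diag_ket, map_smul, smul_smul, h f S hj]
    congr 1
    push_cast
    ring
  · simp only [fcre_ket_insert, diag_ket, map_smul, map_zero, smul_zero]

theorem diag_adjoint {T T' : Module.End ℂ Fock} (hT : IsAdj T T') (hε : ε * ε = 1)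
    (h : diag w * T = (ε : ℂ) • (T * diag w)) : diag w * T' = (ε : ℂ) • (T' * diag w) := by
  have hε' : (ε : ℂ) * ε = 1 := by exact_mod_cast hε
  have h2 : T * diag w = (ε : ℂ) • (diag w * T) := by rw [h, smul_smul, hε', one_smul]
  have h3 := (hT.mul (diag_adj w)).unique (h2 ▸ ((diag_adj w).mul hT).real_smul ε)
  exact h3

end Sign

end OccupationNumber

section Commutator

variable {M : Type*} [AddCommGroup M] [Module ℂ M] {A B C : Module.End ℂ M}

theorem smul_commutator_smul (s t : ℂ) (h : A * B - B * A = C) :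
    (s • A) * (t • B) - (t • B) * (s • A) = (s * t) • C := by
  rw [smul_mul_smul_comm, smul_mul_smul_comm, mul_comm t, ← smul_sub, h]

theorem commutator_eq_zero (h : A * B = B * A) : A * B - B * A = 0 := sub_eq_zero.mpr h

theorem commutator_swap {x : ℂ} (h : A * B - B * A = x • 1) : B * A - A * B = (-x) • 1 := by
  rw [neg_smul, ← h, neg_sub]

theorem commute_of_commutator (h : A * B - B * A = (0 : ℂ) • 1) : A * B = B * A := by
  rwa [zero_smul, sub_eq_zero] at h

theorem anticommutator_eq_zero (h : A * B = -(B * A)) : A * B + B * A = 0 := by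
  rw [h, neg_add_cancel]

theorem anticommute_of_anticommutator (h : A * B + B * A = (0 : ℂ) • 1) :
    A * B = -(B * A) := by
  rw [zero_smul] at h
  exact eq_neg_of_add_eq_zero_left h

theorem anticommutator_swap {x : ℂ} (h : A * B + B * A = x • 1) : B * A + A * B = x • 1 := by
  rwa [add_comm]

theorem commute_of_one_smul (h : A * B = ((1 : ℝ) : ℂ) • (B * A)) : A * B = B * A := by
  simpa using h

theorem anticommute_of_neg_one_smul (h : A * B = ((-1 : ℝ) : ℂ) • (B * A)) :
    A * B = -(B * A) := by
  simpa using h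

end Commutator

namespace OccupationNumber

/-! ### The modes of the free fields -/

section Modes

/-- The modes of a free boson. -/
noncomputable def bos (i : Bool) : ℤ → Module.End ℂ Fock
  | (n : ℕ) => ((√n : ℝ) : ℂ) • ann (i, n - 1)
  | Int.negSucc m => ((√(m + 1) : ℝ) : ℂ) • cre (i, m)

/-- The modes of a free fermion occupying the places `σ k`. -/
noncomputable def fer (σ : ℕ → ℕ) : ℤ → Module.End ℂ Fock
  | (k : ℕ) => fann (σ k)
  | Int.negSucc k => fcre (σ k)

/-- At `n = 0` the truncated index `n - 1` is meaningless, but the coefficient `√0` removes the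
term. -/
theorem bos_zero (i : Bool) : bos i 0 = 0 := by
  change ((√((0 : ℕ) : ℝ) : ℝ) : ℂ) • ann (i, 0 - 1) = 0
  simp

theorem bos_succ (i : Bool) (m : ℕ) :
    bos i ((m + 1 : ℕ) : ℤ) = ((√(m + 1) : ℝ) : ℂ) • ann (i, m) := by
  change ((√((m + 1 : ℕ) : ℝ) : ℝ) : ℂ) • ann (i, m + 1 - 1) = _
  simp

theorem bos_negSucc (i : Bool) (m : ℕ) :
    bos i (Int.negSucc m) = ((√(m + 1) : ℝ) : ℂ) • cre (i, m) := rfl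

theorem fer_natCast (σ : ℕ → ℕ) (k : ℕ) : fer σ (k : ℤ) = fann (σ k) := rfl

theorem fer_negSucc (σ : ℕ → ℕ) (k : ℕ) : fer σ (Int.negSucc k) = fcre (σ k) := rfl

theorem int_cases (n : ℤ) : n = 0 ∨ (∃ m : ℕ, n = ((m + 1 : ℕ) : ℤ)) ∨ ∃ m, n = Int.negSucc m := by
  rcases n with (_ | m) | m
  · exact Or.inl rfl
  · exact Or.inr (Or.inl ⟨m, rfl⟩)
  · exact Or.inr (Or.inr ⟨m, rfl⟩)

theorem delta_of_ne {n : ℤ} (h : n ≠ 0) : delta n = 0 := if_neg h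

theorem bos_succ_negSucc (i j : Bool) (m n : ℕ) :
    bos i ((m + 1 : ℕ) : ℤ) * bos j (Int.negSucc n) - bos j (Int.negSucc n) *
      bos i ((m + 1 : ℕ) : ℤ) = (if i = j then ((m + 1 : ℕ) : ℂ) *
        delta (((m + 1 : ℕ) : ℤ) + Int.negSucc n) else 0) • 1 := by
  classical
  rw [bos_succ, bos_negSucc]
  refine (smul_commutator_smul _ _ (ann_cre (i, m) (j, n))).trans ?_
  rw [smul_smul]
  congr 1
  rcases eq_or_ne i j with rfl | hij
  · rcases eq_or_ne m n with rfl | hmn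
    · have : ((m + 1 : ℕ) : ℤ) + Int.negSucc m = 0 := by omega
      rw [if_pos rfl, if_pos rfl, this, sqrt_mul_sqrt_cast]
      simp [delta]
    · rw [if_neg (by simpa using hmn), if_pos rfl, delta_of_ne (by omega), mul_zero, mul_zero]
  · rw [if_neg (by simp [hij]), if_neg hij, mul_zero]

theorem bos_comm (i j : Bool) (m n : ℤ) : bos i m * bos j n - bos j n * bos i m =
    (if i = j then (m : ℂ) * delta (m + n) else 0) • 1 := by
  have hzero {A B : Module.End ℂ Fock} {m n : ℤ} (h : A * B = B * A)
      (hmn : (m : ℂ) * delta (m + n) = 0) :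
      A * B - B * A = (if i = j then (m : ℂ) * delta (m + n) else 0) • 1 := by
    rw [hmn, ite_self, zero_smul]
    exact commutator_eq_zero h
  rcases int_cases m with rfl | ⟨m, rfl⟩ | ⟨m, rfl⟩
  · exact hzero (by rw [bos_zero, zero_mul, mul_zero]) (by simp)
  · rcases int_cases n with rfl | ⟨n, rfl⟩ | ⟨n, rfl⟩
    · exact hzero (by rw [bos_zero, zero_mul, mul_zero]) (by rw [delta_of_ne (by omega), mul_zero])
    · refine hzero ?_ (by rw [delta_of_ne (by omega), mul_zero])
      rw [bos_succ, bos_succ, smul_mul_smul_comm, smul_mul_smul_comm, ann_ann, mul_comm (_ : ℂ)]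
    · exact bos_succ_negSucc i j m n
  · rcases int_cases n with rfl | ⟨n, rfl⟩ | ⟨n, rfl⟩
    · exact hzero (by rw [bos_zero, zero_mul, mul_zero]) (by rw [delta_of_ne (by omega), mul_zero])
    · refine (commutator_swap (bos_succ_negSucc j i n m)).trans ?_
      congr 1
      rcases eq_or_ne i j with rfl | hij
      · rw [if_pos rfl, if_pos rfl, add_comm (((n + 1 : ℕ)) : ℤ)]
        rcases N2.delta_cases (Int.negSucc m + ((n + 1 : ℕ) : ℤ)) with ⟨h, h'⟩ | h'
        · have : Int.negSucc m = -((n + 1 : ℕ) : ℤ) := by omega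
          rw [this]
          push_cast
          ring
        · rw [h', mul_zero, mul_zero, neg_zero]
      · rw [if_neg hij, if_neg hij.symm, neg_zero]
    · refine hzero ?_ (by rw [delta_of_ne (by omega), mul_zero])
      rw [bos_negSucc, bos_negSucc, smul_mul_smul_comm, smul_mul_smul_comm, cre_cre,
        mul_comm (_ : ℂ)]

theorem bos_adj (i : Bool) (n : ℤ) : IsAdj (bos i n) (bos i (-n)) := by
  rcases int_cases n with rfl | ⟨n, rfl⟩ | ⟨n, rfl⟩
  · intro u v
    rw [neg_zero, bos_zero, LinearMap.zero_apply, LinearMap.zero_apply, N2.core_zero_left,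
      N2.core_zero_right]
  · change IsAdj (bos i ((n + 1 : ℕ) : ℤ)) (bos i (Int.negSucc n))
    rw [bos_succ, bos_negSucc]
    exact (cre_adj _).symm.real_smul _
  · change IsAdj (bos i (Int.negSucc n)) (bos i ((n + 1 : ℕ) : ℤ))
    rw [bos_succ, bos_negSucc]
    exact (cre_adj _).real_smul _

theorem fer_adj (σ : ℕ → ℕ) (k : ℤ) : IsAdj (fer σ k) (fer σ (-1 - k)) := by
  rcases k with k | k
  · have : -1 - Int.ofNat k = Int.negSucc k := by rw [Int.ofNat_eq_natCast]; omega
    rw [this]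
    exact (fcre_adj _).symm
  · have : -1 - Int.negSucc k = (k : ℤ) := by omega
    rw [this]
    exact fcre_adj _

theorem fer_fer_of_ne {σ τ : ℕ → ℕ} (h : ∀ k l, σ k ≠ τ l) (k l : ℤ) :
    fer σ k * fer τ l = -(fer τ l * fer σ k) := by
  rcases k with k | k <;> rcases l with l | l
  · exact fann_fann _ _
  · have := fann_fcre (σ k) (τ l)
    rw [if_neg (h k l)] at this
    exact anticommute_of_anticommutator this
  · have := fann_fcre (τ l) (σ k)
    rw [if_neg (h k l).symm] at this
    exact anticommute_of_anticommutator (anticommutator_swap this)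
  · exact fcre_fcre _ _

theorem fer_natCast_negSucc {σ : ℕ → ℕ} (h : Function.Injective σ) (k l : ℕ) :
    fer σ (k : ℤ) * fer σ (Int.negSucc l) + fer σ (Int.negSucc l) * fer σ (k : ℤ) =
      delta (k + Int.negSucc l + 1) • 1 := by
  rw [fer_natCast, fer_negSucc, fann_fcre]
  congr 1
  refine if_congr ?_ rfl rfl
  rw [h.eq_iff]
  omega

theorem fer_fer {σ : ℕ → ℕ} (h : Function.Injective σ) (k l : ℤ) :
    fer σ k * fer σ l + fer σ l * fer σ k = delta (k + l + 1) • 1 := by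
  rcases k with k | k <;> rcases l with l | l
  · rw [delta_of_ne (by simp only [Int.ofNat_eq_natCast]; omega), zero_smul]
    exact anticommutator_eq_zero (fann_fann _ _)
  · exact fer_natCast_negSucc h k l
  · rw [add_comm (Int.negSucc k)]
    exact anticommutator_swap (fer_natCast_negSucc h l k)
  · rw [delta_of_ne (by omega), zero_smul]
    exact anticommutator_eq_zero (fcre_fcre _ _)

theorem fer_bos (σ : ℕ → ℕ) (i : Bool) (k n : ℤ) : fer σ k * bos i n = bos i n * fer σ k := by
  rcases k with k | k <;> rcases n with n | n <;>
    simp only [fer, bos, mul_smul_comm, smul_mul_assoc, fcre_cre, fann_cre, fann_ann, fcre_ann]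

end Modes

section Vacuum

theorem locNil_of_ket {X : ℤ → Module.End ℂ Fock}
    (h : ∀ s, ∃ N : ℤ, ∀ n, N ≤ n → X n (ket s) = 0) : LocNil X := by
  intro v
  induction v using Finsupp.induction_linear with
  | zero => exact ⟨0, fun n _ => map_zero _⟩
  | add u v hu hv =>
    obtain ⟨N, hN⟩ := hu
    obtain ⟨M, hM⟩ := hv
    refine ⟨max N M, fun n hn => ?_⟩
    rw [map_add, hN n (le_of_max_le_left hn), hM n (le_of_max_le_right hn), add_zero]
  | single s z =>
    obtain ⟨N, hN⟩ := h s
    refine ⟨N, fun n hn => ?_⟩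
    rw [show Finsupp.single s z = z • ket s by simp [ket], map_smul, hN n hn, smul_zero]

theorem bos_locNil (i : Bool) : LocNil (bos i) := by
  refine locNil_of_ket fun ⟨f, S⟩ => ⟨((f.support.sup Prod.snd + 2 : ℕ) : ℤ), fun n hn => ?_⟩
  obtain ⟨m, rfl⟩ : ∃ m : ℕ, n = ((m + 1 : ℕ) : ℤ) := ⟨(n - 1).toNat, by omega⟩
  rw [bos_succ, LinearMap.smul_apply, ann_ket_zero, smul_zero]
  by_contra hf
  have : m ≤ f.support.sup Prod.snd :=
    Finset.le_sup (f := Prod.snd) (Finsupp.mem_support_iff.mpr hf)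
  omega

/-- The hypothesis makes the places `σ k` leave any finite set of occupied ones. -/
theorem fer_locNil {σ : ℕ → ℕ} (h : ∀ k, k ≤ σ k) : LocNil (fer σ) := by
  refine locNil_of_ket fun ⟨f, S⟩ => ⟨((S.sup id + 1 : ℕ) : ℤ), fun n hn => ?_⟩
  obtain ⟨m, rfl⟩ : ∃ m : ℕ, n = (m : ℤ) := ⟨n.toNat, by omega⟩
  rw [fer_natCast, fann_ket]
  intro hmem
  have : σ m ≤ S.sup id := Finset.le_sup (f := id) hmem
  have := h m
  omega

theorem bos_vac (i : Bool) (n : ℤ) (hn : 0 ≤ n) : bos i n (ket (0, ∅)) = 0 := by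
  obtain ⟨n, rfl⟩ := Int.eq_ofNat_of_zero_le hn
  change ((√n : ℝ) : ℂ) • ann (i, n - 1) (ket (0, ∅)) = 0
  rw [ann_ket_zero (by simp), smul_zero]

theorem fer_vac (σ : ℕ → ℕ) (k : ℤ) (hk : 0 ≤ k) : fer σ k (ket (0, ∅)) = 0 := by
  obtain ⟨k, rfl⟩ := Int.eq_ofNat_of_zero_le hk
  exact fann_ket (by simp) _

theorem eq_top_of_cre {W : Submodule ℂ Fock} (h0 : ket (0, ∅) ∈ W)
    (hcre : ∀ i, ∀ v ∈ W, cre i v ∈ W) (hfcre : ∀ j, ∀ v ∈ W, fcre j v ∈ W) : W = ⊤ := by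
  have hS (S : Finset ℕ) : ket (0, S) ∈ W := by
    induction S using Finset.induction_on with
    | empty => exact h0
    | insert j S hj hS =>
      have h1 := W.smul_mem (sgn j S) (hfcre j _ hS)
      rwa [fcre_ket hj, smul_smul, sgn_mul_self, one_smul] at h1
  have hstep (S : Finset ℕ) (g : Bool × ℕ →₀ ℕ) : ∀ f, ket (f, S) ∈ W → ket (f + g, S) ∈ W := by
    induction g using Finsupp.induction_linear with
    | zero => simp
    | add g g' h h' =>
      intro f hf
      rw [← add_assoc]
      exact h' _ (h _ hf)
    | single i n =>
      induction n with
      | zero => simp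
      | succ n ih =>
        intro f hf
        rw [Finsupp.single_add, ← add_assoc]
        have h1 := hcre i _ (ih f hf)
        rw [cre_ket] at h1
        refine (W.smul_mem_iff ?_).mp h1
        exact_mod_cast (Real.sqrt_pos.mpr (by positivity)).ne'
  rw [eq_top_iff]
  rintro v -
  induction v using Finsupp.induction_linear with
  | zero => exact W.zero_mem
  | add u v hu hv => exact W.add_mem hu hv
  | single s z =>
    rw [show Finsupp.single s z = z • ket (0 + s.1, s.2) by simp [ket]]
    exact W.smul_mem z (hstep _ _ _ (hS _))

theorem eq_top_of_modes {W : Submodule ℂ Fock} {σ τ : ℕ → ℕ} (hστ : ∀ j, ∃ k, j = σ k ∨ j = τ k)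
    (h0 : ket (0, ∅) ∈ W) (hb : ∀ i, ∀ n < 0, ∀ v ∈ W, bos i n v ∈ W)
    (hσ : ∀ k < 0, ∀ v ∈ W, fer σ k v ∈ W) (hτ : ∀ k < 0, ∀ v ∈ W, fer τ k v ∈ W) : W = ⊤ := by
  refine eq_top_of_cre h0 (fun ⟨i, m⟩ v hv => ?_) fun j v hv => ?_
  · have h1 := hb i (Int.negSucc m) (by omega) v hv
    rw [bos_negSucc, LinearMap.smul_apply] at h1
    refine (W.smul_mem_iff ?_).mp h1
    exact_mod_cast (Real.sqrt_pos.mpr (by positivity)).ne'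
  · obtain ⟨k, rfl | rfl⟩ := hστ j
    · exact hσ (Int.negSucc k) (by omega) v hv
    · exact hτ (Int.negSucc k) (by omega) v hv

end Vacuum

section Parity

variable {w : State → ℝ} {ε : ℝ}

theorem diag_bos {i : Bool} (hε : ε * ε = 1)
    (h : ∀ m f S, w (f + Finsupp.single (i, m) 1, S) = ε * w (f, S)) (n : ℤ) :
    diag w * bos i n = (ε : ℂ) • (bos i n * diag w) := by
  rcases n with n | n
  · simp only [bos, mul_smul_comm, smul_mul_assoc,
      diag_adjoint (cre_adj (i, n - 1)) hε (diag_cre (h (n - 1)))]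
    rw [smul_comm]
  · simp only [bos, mul_smul_comm, smul_mul_assoc, diag_cre (h n)]
    rw [smul_comm]

theorem diag_fer {σ : ℕ → ℕ} (hε : ε * ε = 1)
    (h : ∀ k f S, σ k ∉ S → w (f, insert (σ k) S) = ε * w (f, S)) (n : ℤ) :
    diag w * fer σ n = (ε : ℂ) • (fer σ n * diag w) := by
  rcases n with n | n
  · exact diag_adjoint (fcre_adj (σ n)) hε (diag_fcre (h n))
  · exact diag_fcre (h n)

/-- The sign `(-1)^n`, where `n` counts the fermions. -/
def parity (s : State) : ℝ := (-1) ^ s.2.card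

/-- The sign `(-1)^n`, where `n` counts the particles of the second boson and the second
fermion. -/
noncomputable def parityTwo (s : State) : ℝ :=
  (-1) ^ (s.1.sum fun p k => if p.1 then k else 0) * (-1) ^ (s.2.filter Odd).card

theorem parity_insert {j : ℕ} {S : Finset ℕ} (hj : j ∉ S) (f : Bool × ℕ →₀ ℕ) :
    parity (f, insert j S) = -1 * parity (f, S) := by
  rw [parity, Finset.card_insert_of_notMem hj, pow_succ', parity]

theorem parityTwo_insert {j : ℕ} {S : Finset ℕ} (hj : j ∉ S) (f : Bool × ℕ →₀ ℕ) :
    parityTwo (f, insert j S) = (if Odd j then -1 else 1) * parityTwo (f, S) := by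
  simp only [parityTwo, Finset.filter_insert]
  split_ifs with h
  · rw [Finset.card_insert_of_notMem (by simp [hj]), pow_succ']
    ring
  · rw [one_mul]

theorem parityTwo_add (p : Bool × ℕ) (f : Bool × ℕ →₀ ℕ) (S : Finset ℕ) :
    parityTwo (f + Finsupp.single p 1, S) = (if p.1 then -1 else 1) * parityTwo (f, S) := by
  simp only [parityTwo]
  rw [Finsupp.sum_add_index' (by simp) (by intro a b c; split_ifs <;> simp), pow_add]
  rw [Finsupp.sum_single_index (by simp)]
  split_ifs <;> simp

end Parity

/-- The Fock space of two free bosons and two free fermions. -/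
noncomputable def fockSpace : FockSpace Fock where
  a := bos false
  b := bos true
  -- The two fermions share one row of places, even ones for `φ` and odd ones for `χ`, so that the
  -- Jordan-Wigner signs make them anticommute.
  φ := fer fun k => 2 * k
  χ := fer fun k => 2 * k + 1
  Γ := diag parity
  Δ := diag parityTwo
  vac := ket (0, ∅)
  form := form
  aa := bos_comm false false
  bb := bos_comm true true
  ab m n := commute_of_commutator (bos_comm false true m n)
  φa := fer_bos _ _
  φb := fer_bos _ _
  χa := fer_bos _ _
  χb := fer_bos _ _
  φφ := fer_fer fun k l h => by simpa using h
  χχ := fer_fer fun k l h => by simpa using h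
  φχ := fer_fer_of_ne fun k l => by omega
  a_nil := bos_locNil _
  b_nil := bos_locNil _
  φ_nil := fer_locNil fun k => by omega
  χ_nil := fer_locNil fun k => by omega
  a_vac := bos_vac _
  b_vac := bos_vac _
  φ_vac := fer_vac _
  χ_vac := fer_vac _
  a_adj := bos_adj _
  b_adj := bos_adj _
  φ_adj := fer_adj _
  χ_adj := fer_adj _
  vac_ne := by simp [ket]
  cyclic W h0 ha hb hφ hχ :=
    eq_top_of_modes (fun j => ⟨j / 2, by omega⟩) h0 (fun i => by cases i <;> assumption) hφ hχ
  Γa n := commute_of_one_smul (diag_bos (one_mul 1) (fun m f S => by simp [parity]) n)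
  Γb n := commute_of_one_smul (diag_bos (one_mul 1) (fun m f S => by simp [parity]) n)
  Γφ n := anticommute_of_neg_one_smul
    (diag_fer (by norm_num) (fun k f S h => parity_insert h f) n)
  Γχ n := anticommute_of_neg_one_smul
    (diag_fer (by norm_num) (fun k f S h => parity_insert h f) n)
  Γ_vac := by simp [diag_ket, parity]
  Δa n := commute_of_one_smul (diag_bos (one_mul 1) (fun m f S => by simp [parityTwo_add]) n)
  Δb n := anticommute_of_neg_one_smul
    (diag_bos (by norm_num) (fun m f S => by simp [parityTwo_add]) n)
  Δφ n := commute_of_one_smul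
    (diag_fer (one_mul 1) (fun k f S h => by simp [parityTwo_insert h]) n)
  Δχ n := anticommute_of_neg_one_smul
    (diag_fer (by norm_num) (fun k f S h => by simp [parityTwo_insert h]) n)
  Δ_vac := by simp [diag_ket, parityTwo]

end OccupationNumber

/-- Every irreducible lowest weight representation of the `N = 2` super-Virasoro algebra with
central charge `c ≥ 3` and lowest weight `(h, q) = (0, 0)` is unitary. -/
theorem mainTheorem8 {V : Type*} [AddCommGroup V] [Module ℂ V] (c : ℝ) (hc : 3 ≤ c)
    (π : N2.alg.Rep V) (hπc : N2.HasCentralCharge π (c : ℂ)) (hirr : π.IsIrreducible)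
    (hlw : N2.IsLowestWeight π 0 0) :
    N2.IsUnitary π := by
  -- The background charge `r = √((c - 3) / 3)`; the square root has the right square because `c ≥
  -- 3`.
  have hr : 3 * (1 + √((c - 3) / 3) ^ 2) = c := by
    rw [Real.sq_sqrt (by linarith)]
    ring
  rw [← hr] at hπc
  push_cast at hπc
  exact N2.isUnitary_of_contravariant hπc hirr hlw
    (OccupationNumber.fockSpace.gen_isAction _) (OccupationNumber.fockSpace.gen_isVacuum _) OccupationNumber.fockSpace.vac_ne
    fun a u hu v hv => OccupationNumber.fockSpace.gen_contravariant _ a hu hv
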